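/- Let $\Omega\subset\mathbb{R}^n$ be a bounded domain with Lipschitz boundary, $T>0$, $Q=\Omega\times(0,T)$, $\nu>0$, and let $b,c\in L^\infty(\Omega;\mathbb{R}^n)$. For $u\in\mathbb{R}^n$ put $B[u](x)=c(x)+b(x)\otimes u$, where $\otimes$ is the componentwise product, and $$a[u](\psi,\varphi)=\int_\Omega\big(\nu\nabla\psi+\psi B[u]\big)\cdot\nabla\varphi\,dx\qquad(\psi,\varphi\in H^1(\Omega)).$$ Let $W(0,T)=\{\rho\in L^2(0,T;H^1(\Omega)):\partial_t\rho\in L^2(0,T;H^1(\Omega)^*)\}$, whose elements are identified with their representatives in $C([0,T];L^2(\Omega))$, and let $(\cdot,\cdot)$ be the scalar product of $L^2(\Omega)$. Let $\rho_0\in L^2(\Omega)$ with $\rho_0\ge 0$ and $\int_\Omega\rho_0\,dx=1$, $\rho_Q\in L^2(Q)$, $\rho_\Omega\in L^2(\Omega)$, $\alpha_Q,\alpha_\Omega\in\mathbb{R}$, $\gamma_i,\beta_i\ge 0$ for $i=1,\dots,n$, and $u^{\min},u^{\max}\in L^\infty(0,T;\mathbb{R}^n)$. For every control $u\in L^\infty(0,T;\mathbb{R}^n)$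 there is a unique $\rho=G(u)\in W(0,T)$ (the state) with $$\tfrac{d}{dt}(\rho(\cdot),\varphi)+a[u(\cdot)](\rho(\cdot),\varphi)=0\ \text{ in }\mathcal{D}'(0,T)\text{ for all }\varphi\in H^1(\Omega),\qquad \rho(0)=\rho_0,$$ and a unique $p\in W(0,T)$ (the adjoint state) with $$-\tfrac{d}{dt}(p(\cdot),\varphi)+a[u(\cdot)](\varphi,p(\cdot))=\alpha_Q(\rho-\rho_Q,\varphi)\ \text{ in }\mathcal{D}'(0,T)\text{ for all }\varphi\in H^1(\Omega),\qquad p(T)=\alpha_\Omega(\rho(T)-\rho_\Omega).$$ Define on $L^\infty(0,T;\mathbb{R}^n)$ the reduced cost functional $$F(u)=\frac{\alpha_Q}{2}\int_0^T\|\rho(t)-\rho_Q(t)\|_{L^2(\Omega)}^2dt+\frac{\alpha_\Omega}{2}\|\rho(T)-\rho_\Omega\|_{L^2(\Omega)}^2+\sum_{i=1}^n\Big(\frac{\gamma_i}{2}\int_0^Tu_i(t)^2dt+\beta_i\int_0^Tu_i(t)\,dt\Big),\qquad \rho=G(u),$$ and, with $\rho=G(u)$ and $p$ the adjoint state belonging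 to $u$, $$\Phi_i(t)=-\int_\Omega\rho(t)\,b_i\,\frac{\partial p(t)}{\partial x_i}\,dx+\gamma_iu_i(t)+\beta_i,\qquad i=1,\dots,n.$$ Then, for every $u\in L^\infty(0,T;\mathbb{R}^n)$, the functions $\Phi_i$ are integrable on $(0,T)$, $F$ is Fréchet differentiable at $u$, and $$F'(u)v=\sum_{i=1}^n\int_0^T\Phi_i(t)v_i(t)\,dt\qquad\text{for all }v\in L^\infty(0,T;\mathbb{R}^n).$$ Moreover, let $\mathcal{U}_{\rm ad}=\{u\in L^\infty(0,T;\mathbb{R}^n):u^{\min}\le u\le u^{\max}\text{ componentwise a.e. on }[0,T]\}$ and let $\bar u$ be an $L^\infty$-local minimum, i.e. $\bar u\in\mathcal{U}_{\rm ad}$ and for some $\varepsilon>0$ one has $F(\bar u)\le F(u)$ for all $u\in\mathcal{U}_{\rm ad}$ with $\|u-\bar u\|_{L^\infty(0,T;\mathbb{R}^n)}<\varepsilon$. Let $\bar\Phi$ be the function $\Phi$ belonging to $\bar u$. Then $$\sum_{i=1}^n\int_0^T\bar\Phi_i(t)\big(u_i(t)-\bar u_i(t)\big)\,dt\ge 0\qquad\text{for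 all }u\in\mathcal{U}_{\rm ad},$$ and for a.e. $t\in[0,T]$ and all $i=1,\dots,n$: $$\bar\Phi_i(t)>0\Rightarrow\bar u_i(t)=u_i^{\min}(t),\qquad \bar\Phi_i(t)<0\Rightarrow\bar u_i(t)=u_i^{\max}(t),\qquad u_i^{\min}(t)<\bar u_i(t)<u_i^{\max}(t)\Rightarrow\bar\Phi_i(t)=0.$$ -/

import Mathlib

open MeasureTheory Set Filter Topology
open scoped ContDiff ENNReal

noncomputable section

namespace FokkerPlanck

/-- `ℝⁿ` with the Euclidean norm. -/
abbrev Vec (n : ℕ) : Type := EuclideanSpace ℝ (Fin n)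

/-- Componentwise multiplication `u ⊗ v` of vectors, `(u ⊗ v)ᵢ = uᵢ vᵢ`. -/
def cwMul {n : ℕ} (u v : Vec n) : Vec n := WithLp.toLp 2 (fun i => u i * v i)

/-- `Ω` has a Lipschitz boundary: near every boundary point, after choosing a unit direction `e`,
the set `Ω` is the strict epigraph, in direction `e`, of a Lipschitz function `g` of the
coordinates orthogonal to `e`. -/
def HasLipschitzBoundary {n : ℕ} (Ω : Set (Vec n)) : Prop :=
  ∀ x ∈ frontier Ω, ∃ (e : Vec n) (g : Vec n → ℝ) (K : NNReal) (r : ℝ),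
    ‖e‖ = 1 ∧ LipschitzWith K g ∧ (∀ (y : Vec n) (s : ℝ), g (y + s • e) = g y) ∧ 0 < r ∧
      ∀ y ∈ Metric.ball x r, (y ∈ Ω ↔ g y < inner ℝ e y)

/-- Test functions: `C_c^∞(U)`. -/
def IsTestFunction {V : Type*} [NormedAddCommGroup V] [NormedSpace ℝ V]
    (U : Set V) (φ : V → ℝ) : Prop :=
  ContDiff ℝ ∞ φ ∧ HasCompactSupport φ ∧ tsupport φ ⊆ U

/-- `L²(Ω)`. -/
abbrev L2 {n : ℕ} (Ω : Set (Vec n)) : Type := Lp ℝ 2 (volume.restrict Ω)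

/-- `L²(Ω; ℝⁿ)`. -/
abbrev L2Vec {n : ℕ} (Ω : Set (Vec n)) : Type := Lp (Vec n) 2 (volume.restrict Ω)

/-- `g` is the weak gradient of `f` on `Ω`:
`∫_Ω f ∂ᵢφ dx = - ∫_Ω gᵢ φ dx` for all `i` and all `φ ∈ C_c^∞(Ω)`. -/
def IsWeakGradient {n : ℕ} (Ω : Set (Vec n)) (f : Vec n → ℝ) (g : Vec n → Vec n) : Prop :=
  ∀ φ : Vec n → ℝ, IsTestFunction Ω φ → ∀ i : Fin n,
    ∫ x in Ω, f x * fderiv ℝ φ x (EuclideanSpace.single i 1) = - ∫ x in Ω, g x i * φ x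

theorem memLp_test {n : ℕ} {Ω : Set (Vec n)} {φ : Vec n → ℝ} (hφ : IsTestFunction Ω φ) :
    MemLp φ 2 (volume.restrict Ω) :=
  (hφ.1.continuous.memLp_of_hasCompactSupport hφ.2.1).restrict Ω

theorem memLp_fderiv_test {n : ℕ} {Ω : Set (Vec n)} {φ : Vec n → ℝ} (hφ : IsTestFunction Ω φ)
    (e : Vec n) : MemLp (fun x => fderiv ℝ φ x e) 2 (volume.restrict Ω) := by
  have hc : Continuous (fun x => fderiv ℝ φ x e) :=
    (hφ.1.continuous_fderiv (by simp)).clm_apply continuous_const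
  exact (hc.memLp_of_hasCompactSupport (hφ.2.1.fderiv_apply (𝕜 := ℝ) e)).restrict Ω

theorem memLp_coord {n : ℕ} {Ω : Set (Vec n)} (g : L2Vec Ω) (i : Fin n) :
    MemLp (fun x => g x i) 2 (volume.restrict Ω) := by
  exact (EuclideanSpace.proj i : Vec n →L[ℝ] ℝ).comp_memLp' (Lp.memLp g)

/-- The graph of the weak gradient, as a subspace of `L²(Ω) × L²(Ω; ℝⁿ)` with the Hilbert norm
`(‖f‖² + ‖g‖²)^{1/2}`. -/
def h1Submodule {n : ℕ} (Ω : Set (Vec n)) : Submodule ℝ (WithLp 2 (L2 Ω × L2Vec Ω)) where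
  carrier := {w | IsWeakGradient Ω w.fst w.snd}
  zero_mem' := by
    intro φ _ i
    have h1 : ∀ᵐ x ∂(volume.restrict Ω), (0 : L2 Ω) x = 0 := Lp.coeFn_zero _ _ _
    have h2 : ∀ᵐ x ∂(volume.restrict Ω), (0 : L2Vec Ω) x = 0 := Lp.coeFn_zero _ _ _
    have e1 : ∫ x in Ω, (0 : L2 Ω) x * fderiv ℝ φ x (EuclideanSpace.single i 1) = 0 :=
      integral_eq_zero_of_ae (by
        filter_upwards [h1] with x hx
        change (0 : L2 Ω) x * _ = 0
        rw [hx, zero_mul])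
    have e2 : ∫ x in Ω, (0 : L2Vec Ω) x i * φ x = 0 :=
      integral_eq_zero_of_ae (by
        filter_upwards [h2] with x hx
        change (0 : L2Vec Ω) x i * _ = 0
        rw [hx, PiLp.zero_apply, zero_mul])
    change ∫ x in Ω, (0 : L2 Ω) x * fderiv ℝ φ x (EuclideanSpace.single i 1)
      = - ∫ x in Ω, (0 : L2Vec Ω) x i * φ x
    rw [e1, e2, neg_zero]
  add_mem' := by
    intro w z hw hz φ hφ i
    have e1 : ∫ x in Ω, (w.fst + z.fst) x * fderiv ℝ φ x (EuclideanSpace.single i 1)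
        = (∫ x in Ω, w.fst x * fderiv ℝ φ x (EuclideanSpace.single i 1))
          + ∫ x in Ω, z.fst x * fderiv ℝ φ x (EuclideanSpace.single i 1) := by
      refine Eq.trans (integral_congr_ae ?_)
        (integral_add ((Lp.memLp w.fst).integrable_mul (memLp_fderiv_test hφ _))
          ((Lp.memLp z.fst).integrable_mul (memLp_fderiv_test hφ _)))
      filter_upwards [Lp.coeFn_add w.fst z.fst] with x hx
      rw [hx]
      exact add_mul _ _ _
    have e2 : ∫ x in Ω, (w.snd + z.snd) x i * φ x
        = (∫ x in Ω, w.snd x i * φ x) + ∫ x in Ω, z.snd x i * φ x := by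
      refine Eq.trans (integral_congr_ae ?_)
        (integral_add ((memLp_coord w.snd i).integrable_mul (memLp_test hφ))
          ((memLp_coord z.snd i).integrable_mul (memLp_test hφ)))
      filter_upwards [Lp.coeFn_add w.snd z.snd] with x hx
      rw [hx]
      exact add_mul _ _ _
    change ∫ x in Ω, (w.fst + z.fst) x * fderiv ℝ φ x (EuclideanSpace.single i 1)
      = - ∫ x in Ω, (w.snd + z.snd) x i * φ x
    rw [e1, e2, hw φ hφ i, hz φ hφ i]
    ring
  smul_mem' := by
    intro a w hw φ hφ i
    have e1 : ∫ x in Ω, (a • w.fst) x * fderiv ℝ φ x (EuclideanSpace.single i 1)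
        = a * ∫ x in Ω, w.fst x * fderiv ℝ φ x (EuclideanSpace.single i 1) := by
      rw [← integral_const_mul]
      refine integral_congr_ae ?_
      filter_upwards [Lp.coeFn_smul a w.fst] with x hx
      simp [hx, mul_assoc]
    have e2 : ∫ x in Ω, (a • w.snd) x i * φ x = a * ∫ x in Ω, w.snd x i * φ x := by
      rw [← integral_const_mul]
      refine integral_congr_ae ?_
      filter_upwards [Lp.coeFn_smul a w.snd] with x hx
      simp [hx, mul_assoc]
    change ∫ x in Ω, (a • w.fst) x * fderiv ℝ φ x (EuclideanSpace.single i 1)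
      = - ∫ x in Ω, (a • w.snd) x i * φ x
    rw [e1, e2, hw φ hφ i]
    ring

/-- The Sobolev space `H¹(Ω)`, each element being carried together with its weak gradient, with
the norm `(‖f‖²_{L²} + ‖∇f‖²_{L²})^{1/2}`. -/
abbrev H1 {n : ℕ} (Ω : Set (Vec n)) : Type := ↥(h1Submodule Ω)

/-- The embedding `H¹(Ω) → L²(Ω)`. -/
def H1.toL2 {n : ℕ} {Ω : Set (Vec n)} (f : H1 Ω) : L2 Ω := (f : WithLp 2 (L2 Ω × L2Vec Ω)).fst

/-- The weak gradient `∇f ∈ L²(Ω; ℝⁿ)`. -/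
def H1.grad {n : ℕ} {Ω : Set (Vec n)} (f : H1 Ω) : L2Vec Ω :=
  (f : WithLp 2 (L2 Ω × L2Vec Ω)).snd

/-- Lebesgue measure on the time interval `(0,T)`. -/
abbrev timeMeasure (T : ℝ) : Measure ℝ := volume.restrict (Ioo 0 T)

/-- `L²(0,T;H¹(Ω))`. -/
abbrev L2H1 {n : ℕ} (T : ℝ) (Ω : Set (Vec n)) : Type := Lp (H1 Ω) 2 (timeMeasure T)

/-- `L²(0,T;H¹(Ω)*)`. -/
abbrev L2H1Dual {n : ℕ} (T : ℝ) (Ω : Set (Vec n)) : Type :=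
  Lp (StrongDual ℝ (H1 Ω)) 2 (timeMeasure T)

/-- `L^∞(0,T;ℝⁿ)`. -/
abbrev LInfTime (T : ℝ) (n : ℕ) : Type := Lp (Vec n) ∞ (timeMeasure T)

/-- `∂ₜρ = g` in the sense of distributions on `(0,T)` with values in `H¹(Ω)*`:
`∫₀ᵀ (ρ(t), φ) ψ'(t) dt = - ∫₀ᵀ ⟨g(t), φ⟩ ψ(t) dt`. -/
def HasWeakTimeDeriv {n : ℕ} {T : ℝ} {Ω : Set (Vec n)} (ρ : L2H1 T Ω) (g : L2H1Dual T Ω) : Prop :=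
  ∀ φ : H1 Ω, ∀ ψ : ℝ → ℝ, IsTestFunction (Ioo 0 T) ψ →
    ∫ t in Ioo 0 T, inner ℝ (ρ t).toL2 φ.toL2 * deriv ψ t = - ∫ t in Ioo 0 T, g t φ * ψ t

/-- `ρ ∈ W(0,T)`, i.e. `ρ ∈ L²(0,T;H¹(Ω))` and `∂ₜρ ∈ L²(0,T;H¹(Ω)*)`. -/
def MemW {n : ℕ} {T : ℝ} {Ω : Set (Vec n)} (ρ : L2H1 T Ω) : Prop :=
  ∃ g : L2H1Dual T Ω, HasWeakTimeDeriv ρ g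

/-- `c` is a representative of `ρ` in `C([0,T];L²(Ω))`. -/
def IsContRep {n : ℕ} {T : ℝ} {Ω : Set (Vec n)} (ρ : L2H1 T Ω) (c : ℝ → L2 Ω) : Prop :=
  ContinuousOn c (Icc 0 T) ∧ ∀ᵐ t ∂(timeMeasure T), c t = (ρ t).toL2

/-- The representative in `C([0,T];L²(Ω))` of an element `ρ` of `W(0,T)`. -/
def contRep {n : ℕ} {T : ℝ} {Ω : Set (Vec n)} (ρ : L2H1 T Ω) : ℝ → L2 Ω :=
  Classical.epsilon (IsContRep ρ)

/-- The data of the control problem in dimension `n`, with the standing assumptions on them. -/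
structure Data (n : ℕ) where
  /-- the spatial domain -/
  Ω : Set (Vec n)
  isOpen_Ω : IsOpen Ω
  isConnected_Ω : IsConnected Ω
  isBounded_Ω : Bornology.IsBounded Ω
  lipschitz_Ω : HasLipschitzBoundary Ω
  /-- the time horizon -/
  T : ℝ
  T_pos : 0 < T
  /-- the diffusion coefficient -/
  ν : ℝ
  ν_pos : 0 < ν
  /-- the vector functions of `B[u](x) = c(x) + b(x) ⊗ u` -/
  c : Lp (Vec n) ∞ (volume.restrict Ω)
  b : Lp (Vec n) ∞ (volume.restrict Ω)
  /-- the initial probability distribution -/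
  ρ₀ : L2 Ω
  ρ₀_nonneg : ∀ᵐ x ∂(volume.restrict Ω), 0 ≤ ρ₀ x
  ρ₀_integral : ∫ x in Ω, ρ₀ x = 1
  /-- the weights and targets of the cost functional; `L²(Q)` is `L²(0,T;L²(Ω))` -/
  αQ : ℝ
  αΩ : ℝ
  ρQ : Lp (L2 Ω) 2 (timeMeasure T)
  ρΩ : L2 Ω
  γ : Fin n → ℝ
  γ_nonneg : ∀ i, 0 ≤ γ i
  β : Fin n → ℝ
  β_nonneg : ∀ i, 0 ≤ β i
  /-- the control bounds -/
  umin : LInfTime T n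
  umax : LInfTime T n

namespace Data

variable {n : ℕ} (D : Data n)

/-- `B[u](x) = c(x) + b(x) ⊗ u`, for `u ∈ ℝⁿ`. -/
def B (u : Vec n) (x : Vec n) : Vec n := D.c x + cwMul (D.b x) u

/-- The bilinear form `a[u](ψ,φ) = ∫_Ω (ν ∇ψ + ψ B[u]) · ∇φ dx`, for `u ∈ ℝⁿ`. -/
def a (u : Vec n) (ψ φ : H1 D.Ω) : ℝ :=
  ∫ x in D.Ω, inner ℝ (D.ν • ψ.grad x + ψ.toL2 x • D.B u x) (φ.grad x)

/-- `ρ` is a weak solution of the Fokker-Planck equation with control `u`: `ρ ∈ W(0,T)`,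
`d/dt (ρ(·),φ) + a[u(·)](ρ(·),φ) = 0` in `𝓓'(0,T)` for all `φ ∈ H¹(Ω)`, and `ρ(0) = ρ₀`. -/
def IsWeakSolution (u : LInfTime D.T n) (ρ : L2H1 D.T D.Ω) : Prop :=
  MemW ρ ∧
  (∀ φ : H1 D.Ω, ∀ ψ : ℝ → ℝ, IsTestFunction (Ioo 0 D.T) ψ →
    -(∫ t in Ioo 0 D.T, inner ℝ (ρ t).toL2 φ.toL2 * deriv ψ t)
      + ∫ t in Ioo 0 D.T, D.a (u t) (ρ t) φ * ψ t = 0) ∧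
  ∃ r, IsContRep ρ r ∧ r 0 = D.ρ₀

/-- The control-to-state mapping `G`: the unique weak solution belonging to `u`. -/
def G (u : LInfTime D.T n) : L2H1 D.T D.Ω := Classical.epsilon (D.IsWeakSolution u)

/-- `p` is a weak solution of the adjoint equation at `(ρ,u)`: `p ∈ W(0,T)`,
`-d/dt (p(·),φ) + a[u(·)](φ,p(·)) = α_Q (ρ - ρ_Q, φ)` in `𝓓'(0,T)` for all `φ ∈ H¹(Ω)`, and
`p(T) = α_Ω (ρ(T) - ρ_Ω)`. -/
def IsAdjointState (ρ : L2H1 D.T D.Ω) (u : LInfTime D.T n) (p : L2H1 D.T D.Ω) : Prop :=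
  MemW p ∧
  (∀ φ : H1 D.Ω, ∀ ψ : ℝ → ℝ, IsTestFunction (Ioo 0 D.T) ψ →
    (∫ t in Ioo 0 D.T, inner ℝ (p t).toL2 φ.toL2 * deriv ψ t)
      + ∫ t in Ioo 0 D.T, D.a (u t) φ (p t) * ψ t
      = ∫ t in Ioo 0 D.T, D.αQ * inner ℝ ((ρ t).toL2 - D.ρQ t) φ.toL2 * ψ t) ∧
  ∃ r, IsContRep p r ∧ r D.T = D.αΩ • (contRep ρ D.T - D.ρΩ)

/-- The adjoint state associated with `(G(u),u)`. -/
def adjoint (u : LInfTime D.T n) : L2H1 D.T D.Ω :=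
  Classical.epsilon (D.IsAdjointState (D.G u) u)

/-- The cost functional `J(ρ,u)`. -/
def J (ρ : L2H1 D.T D.Ω) (u : LInfTime D.T n) : ℝ :=
  D.αQ / 2 * (∫ t in Ioo 0 D.T, ‖(ρ t).toL2 - D.ρQ t‖ ^ 2)
    + D.αΩ / 2 * ‖contRep ρ D.T - D.ρΩ‖ ^ 2
    + ∑ i, (D.γ i / 2 * (∫ t in Ioo 0 D.T, (u t i) ^ 2) + D.β i * ∫ t in Ioo 0 D.T, u t i)

/-- The reduced cost functional `F(u) = J(G(u),u)` on `L^∞(0,T;ℝⁿ)`. -/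
def F (u : LInfTime D.T n) : ℝ := D.J (D.G u) u

/-- The set of admissible controls. -/
def Uad : Set (LInfTime D.T n) :=
  {u | ∀ᵐ t ∂(timeMeasure D.T), ∀ i, D.umin t i ≤ u t i ∧ u t i ≤ D.umax t i}

/-- `L^∞`-local minima of the control problem `min {J(G(u),u) : u ∈ U_ad}`. -/
def IsLInfLocalMin (u : LInfTime D.T n) : Prop :=
  u ∈ D.Uad ∧ ∃ ε > 0, ∀ v ∈ D.Uad ∩ Metric.ball u ε, D.F u ≤ D.F v

/-- `Φᵢ(t) = - ∫_Ω ρ(t) bᵢ ∂ᵢp(t) dx + γᵢ uᵢ(t) + βᵢ`, where `ρ = G(u)` and `p` is the adjoint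
state. -/
def Φ (u : LInfTime D.T n) (i : Fin n) (t : ℝ) : ℝ :=
  -(∫ x in D.Ω, (D.G u t).toL2 x * D.b x i * (D.adjoint u t).grad x i)
    + D.γ i * u t i + D.β i

end Data

end FokkerPlanck

end

noncomputable section

open scoped InnerProductSpace InnerProduct

set_option linter.unusedSectionVars false

namespace FokkerPlanck

/-! ### Primitives of integrable functions -/

section Antideriv

/-! The derivative of the control-to-state map is never needed: one compares two states directly.
Let ρ and ρ' be the states of u and u + v, δ = ρ' - ρ, and let A_i be the operator with ⟨A_i ψ, φ⟩ =
∫ ψ b_i ∂_i φ. Since a[u] is affine in u, δ starts at zero and solves the linear equation with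
control u + v and source -∑ v_i A_i ρ. Integrating by parts between δ and the adjoint state p of u
turns the first order part of the tracking cost into -∫ ∑ v_i ⟨A_i ρ, p⟩. What remains is
(α_Q/2)∫‖δ‖² + (α_Ω/2)‖δ(T)‖² - ∫ ∑ v_i ⟨A_i δ, p⟩ (`trackingCost_sub`). By the energy estimate δ =
O(‖v‖), uniformly for ‖v‖ ≤ 1 (`exists_norm_sub_state_le`), so this remainder is O(‖v‖²). The
control cost is a quadratic polynomial, and the two first order parts together give ∑ ∫ Φ_i v_i
(`hasFDerivAt_F`).

The parabolic theory behind this is developed for an injective operator ι : V → H between Hilbert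
spaces with injective adjoint. Identifying V* with V by Riesz makes the embedding H → V* the adjoint
ι†, and the equation reads (ι† ι w)' = g with g valued in V. Existence comes from Lions' projection
lemma applied to a coercivity inequality for primitives vanishing at T (`lions_coercive`,
`exists_isEvolution`). The energy identity and the continuous H-valued representative come from
applying operators R_k that approximate (ι† ι)⁻¹: ι R_k maps the V-valued primitive ι† ι w to an
H-valued primitive, to which the ordinary product rule applies (`IsEvolution.exists_continuousOn`).
Polarization gives integration by parts, the weighted energy estimate gives uniqueness and
stability, and time reversal reduces the adjoint equation to a forward one. The distributional
formulation is linked to the integrated one by the lemma of du Bois-Reymond (`isWeakSolution_iff`,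
`isAdjointState_iff`).

For the necessary conditions, convexity of the admissible set yields F'(ū)(u - ū) ≥ 0. Replacing a
single component of ū by that of a bound on an arbitrary measurable set of times localizes this to
pointwise sign conditions (`ae_complementarity_of_pairing_nonneg`). -/

theorem intervalIntegrable_iff_timeMeasure {E : Type*} [NormedAddCommGroup E] {T : ℝ} (hT : 0 ≤ T) {f : ℝ → E} :
    IntervalIntegrable f volume 0 T ↔ Integrable f (timeMeasure T) := by
  rw [intervalIntegrable_iff_integrableOn_Ioo_of_le hT]
  rfl

variable {E F G : Type*} [NormedAddCommGroup E] [NormedSpace ℝ E]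
  [NormedAddCommGroup F] [NormedSpace ℝ F] [NormedAddCommGroup G] [NormedSpace ℝ G]
  {T : ℝ}

theorem intervalIntegral_eq_timeMeasure (hT : 0 ≤ T) (f : ℝ → E) :
    ∫ t in (0 : ℝ)..T, f t = ∫ t, f t ∂(timeMeasure T) := by
  rw [intervalIntegral.integral_of_le hT, integral_Ioc_eq_integral_Ioo]

/-- `X` is a primitive on `[0,T]` of the integrable function `x`. -/
structure IsAntideriv (T : ℝ) (X x : ℝ → E) : Prop where
  integrable : Integrable x (timeMeasure T)
  eq_integral : ∀ t ∈ Icc 0 T, X t = X 0 + ∫ s in (0 : ℝ)..t, x s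

theorem intervalIntegrable_of_mem {x : ℝ → E} (h : Integrable x (timeMeasure T)) {s t : ℝ}
    (hs : s ∈ Icc 0 T) (ht : t ∈ Icc 0 T) : IntervalIntegrable x volume s t :=
  ((intervalIntegrable_iff_timeMeasure (hs.1.trans hs.2)).2 h).mono_set (by
    rw [uIcc_of_le (hs.1.trans hs.2)]
    exact uIcc_subset_Icc hs ht)

theorem isAntideriv_integral {x : ℝ → E} (h : Integrable x (timeMeasure T)) (k : E) :
    IsAntideriv T (fun t => k + ∫ s in (0 : ℝ)..t, x s) x :=
  ⟨h, fun t _ => by simp⟩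

namespace IsAntideriv

variable {X x X' x' : ℝ → E} {Y y : ℝ → F}

theorem intervalIntegrable (h : IsAntideriv T X x) {s t : ℝ} (hs : s ∈ Icc 0 T)
    (ht : t ∈ Icc 0 T) : IntervalIntegrable x volume s t :=
  intervalIntegrable_of_mem h.integrable hs ht

theorem sub_eq (h : IsAntideriv T X x) {s t : ℝ} (hs : s ∈ Icc 0 T) (ht : t ∈ Icc 0 T) :
    X t - X s = ∫ r in s..t, x r := by
  have h0 : (0 : ℝ) ∈ Icc 0 T := ⟨le_rfl, hs.1.trans hs.2⟩
  rw [h.eq_integral t ht, h.eq_integral s hs, add_sub_add_left_eq_sub,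
    intervalIntegral.integral_interval_sub_left (h.intervalIntegrable h0 ht)
      (h.intervalIntegrable h0 hs)]

theorem continuousOn (h : IsAntideriv T X x) : ContinuousOn X (Icc 0 T) := by
  rcases le_or_gt 0 T with hT | hT
  · have := intervalIntegral.continuousOn_primitive_interval' (a := 0)
      ((intervalIntegrable_iff_timeMeasure hT).2 h.integrable) (by simp)
    rw [uIcc_of_le hT] at this
    exact (continuousOn_const.add this).congr h.eq_integral
  · simp [Icc_eq_empty hT.not_ge]

theorem clm_apply [CompleteSpace E] [CompleteSpace F] (L : E →L[ℝ] F) (h : IsAntideriv T X x) :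
    IsAntideriv T (fun t => L (X t)) (fun t => L (x t)) :=
  ⟨L.integrable_comp h.integrable, fun t ht => by
    have h0 : (0 : ℝ) ∈ Icc 0 T := ⟨le_rfl, ht.1.trans ht.2⟩
    rw [h.eq_integral t ht, L.intervalIntegral_comp_comm (h.intervalIntegrable h0 ht), map_add]⟩

theorem norm_sub_le (h : IsAntideriv T X x) {s t : ℝ} (hs : s ∈ Icc 0 T) (ht : t ∈ Icc 0 T)
    (hst : s ≤ t) : ‖X t - X s‖ ≤ ∫ r in s..t, ‖x r‖ := by
  rw [h.sub_eq hs ht]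
  exact intervalIntegral.norm_integral_le_integral_norm hst

theorem ae_hasDerivAt [CompleteSpace E] (h : IsAntideriv T X x) :
    ∀ᵐ t, t ∈ Ioo 0 T → HasDerivAt X (x t) t := by
  rcases le_or_gt 0 T with hT | hT
  · filter_upwards [((intervalIntegrable_iff_timeMeasure hT).2
      h.integrable).ae_hasDerivAt_integral] with t ht htT
    rw [uIcc_of_le hT] at ht
    refine ((ht (Ioo_subset_Icc_self htT) 0 ⟨le_rfl, hT⟩).const_add (X 0)).congr_of_eventuallyEq ?_
    filter_upwards [Ioo_mem_nhds htT.1 htT.2] with s hs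
    exact h.eq_integral s (Ioo_subset_Icc_self hs)
  · exact Eventually.of_forall fun t ht => absurd (ht.1.trans ht.2) hT.not_gt

theorem exists_bound (h : IsAntideriv T X x) : ∃ C, 0 ≤ C ∧ ∀ t ∈ Icc 0 T, ‖X t‖ ≤ C := by
  obtain ⟨C, hC⟩ := isCompact_Icc.exists_bound_of_continuousOn h.continuousOn
  exact ⟨max C 0, le_max_right _ _, fun t ht => (hC t ht).trans (le_max_left _ _)⟩

end IsAntideriv

/-- A real function whose increments are bounded by the integral of an integrable function is the
integral of its derivative. -/
theorem isAntideriv_of_norm_sub_le {f f' m : ℝ → ℝ} (hm : Integrable m (timeMeasure T))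
    (hfm : ∀ s ∈ Icc 0 T, ∀ t ∈ Icc 0 T, s ≤ t → ‖f t - f s‖ ≤ ∫ r in s..t, m r)
    (hf' : Integrable f' (timeMeasure T))
    (hd : ∀ᵐ t, t ∈ Ioo 0 T → HasDerivAt f (f' t) t) : IsAntideriv T f f' := by
  refine ⟨hf', fun t ht => ?_⟩
  have h0 : (0 : ℝ) ∈ Icc 0 T := ⟨le_rfl, ht.1.trans ht.2⟩
  -- Increments of `f` are dominated by those of the primitive of `m`, so the δ that works for that
  -- primitive works for `f`.
  have hac : AbsolutelyContinuousOnInterval f 0 t := by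
    have hN := (intervalIntegrable_of_mem hm h0 ht).absolutelyContinuousOnInterval_intervalIntegral
      (c := 0) (by simp)
    rw [absolutelyContinuousOnInterval_iff] at hN ⊢
    intro ε hε
    obtain ⟨δ, hδ, H⟩ := hN ε hε
    refine ⟨δ, hδ, fun E hE hlen => lt_of_le_of_lt (Finset.sum_le_sum fun i hi => ?_) (H E hE hlen)⟩
    have h1 : ∀ p ∈ uIcc 0 t, p ∈ Icc 0 T := fun p hp => by
      rw [uIcc_of_le ht.1] at hp
      exact ⟨hp.1, hp.2.trans ht.2⟩
    have hab := hE.1 i hi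
    have key : ∀ p q : ℝ, p ∈ Icc 0 T → q ∈ Icc 0 T → p ≤ q →
        dist (f p) (f q) ≤ dist (∫ r in (0 : ℝ)..p, m r) (∫ r in (0 : ℝ)..q, m r) := by
      intro p q hp hq hpq
      rw [dist_comm, dist_comm (∫ r in (0 : ℝ)..p, m r), dist_eq_norm, dist_eq_norm,
        intervalIntegral.integral_interval_sub_left (intervalIntegrable_of_mem hm h0 hq)
          (intervalIntegrable_of_mem hm h0 hp)]
      exact (hfm p hp q hq hpq).trans (le_abs_self _)
    -- The endpoint pairs of the family come in no prescribed order.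
    rcases le_total (E.2 i).1 (E.2 i).2 with h | h
    · exact key _ _ (h1 _ hab.1) (h1 _ hab.2) h
    · rw [dist_comm, dist_comm (∫ r in (0 : ℝ)..(E.2 i).1, m r)]
      exact key _ _ (h1 _ hab.2) (h1 _ hab.1) h
  have h2 := hac.integral_deriv_eq_sub
  have h3 : ∫ s in (0 : ℝ)..t, deriv f s = ∫ s in (0 : ℝ)..t, f' s := by
    rw [intervalIntegral.integral_of_le ht.1, intervalIntegral.integral_of_le ht.1,
      integral_Ioc_eq_integral_Ioo, integral_Ioc_eq_integral_Ioo]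
    refine setIntegral_congr_ae measurableSet_Ioo ?_
    filter_upwards [hd] with s hs hst
    exact (hs ⟨hst.1, hst.2.trans_le ht.2⟩).deriv
  rw [← h3, h2]
  ring

theorem isAntideriv_of_hasDerivAt {f f' : ℝ → ℝ} (hd : ∀ t, HasDerivAt f (f' t) t)
    (hc : Continuous f') : IsAntideriv T f f' := by
  refine ⟨(hc.integrableOn_Icc (a := 0) (b := T)).mono_set Ioo_subset_Icc_self, fun t ht => ?_⟩
  rw [intervalIntegral.integral_eq_sub_of_hasDerivAt (fun s _ => hd s)
    (hc.intervalIntegrable _ _)]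
  ring

theorem IsAntideriv.aestronglyMeasurable {X x : ℝ → E} (h : IsAntideriv T X x) :
    AEStronglyMeasurable X (timeMeasure T) :=
  (h.continuousOn.mono Ioo_subset_Icc_self).aestronglyMeasurable measurableSet_Ioo

theorem IsAntideriv.memLp {X x : ℝ → E} (h : IsAntideriv T X x) (p : ℝ≥0∞) :
    MemLp X p (timeMeasure T) := by
  obtain ⟨C, -, hC⟩ := h.exists_bound
  exact MemLp.of_bound h.aestronglyMeasurable C <|
    (ae_restrict_iff' measurableSet_Ioo).2 <| Eventually.of_forall fun t ht =>
      hC t (Ioo_subset_Icc_self ht)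

/-- The product rule for primitives. -/
theorem IsAntideriv.bilin [CompleteSpace E] [CompleteSpace F] (B : E →L[ℝ] F →L[ℝ] ℝ)
    {X x : ℝ → E} {Y y : ℝ → F} (hX : IsAntideriv T X x) (hY : IsAntideriv T Y y) :
    IsAntideriv T (fun t => B (X t) (Y t)) (fun t => B (x t) (Y t) + B (X t) (y t)) := by
  obtain ⟨C, hC0, hC⟩ := hX.exists_bound
  obtain ⟨D, hD0, hD⟩ := hY.exists_bound
  have hbd : ∀ (Z : ℝ → E) (K : ℝ), (∀ t ∈ Icc 0 T, ‖Z t‖ ≤ K) → ∀ᵐ t ∂(timeMeasure T), ‖Z t‖ ≤ K :=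
    fun Z K h => (ae_restrict_iff' measurableSet_Ioo).2 <| Eventually.of_forall fun t ht =>
      h t (Ioo_subset_Icc_self ht)
  have hbd' : ∀ᵐ t ∂(timeMeasure T), ‖Y t‖ ≤ D :=
    (ae_restrict_iff' measurableSet_Ioo).2 <| Eventually.of_forall fun t ht =>
      hD t (Ioo_subset_Icc_self ht)
  have i1 : Integrable (fun t => B (x t) (Y t)) (timeMeasure T) :=
    B.integrable_of_bilin_of_bdd_right D hX.integrable hY.aestronglyMeasurable hbd'
  have i2 : Integrable (fun t => B (X t) (y t)) (timeMeasure T) :=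
    B.integrable_of_bilin_of_bdd_left C hX.aestronglyMeasurable (hbd X C hC) hY.integrable
  refine isAntideriv_of_norm_sub_le (m := fun t => ‖B‖ * D * ‖x t‖ + ‖B‖ * C * ‖y t‖)
    ((hX.integrable.norm.const_mul _).add (hY.integrable.norm.const_mul _)) ?_ (i1.add i2) ?_
  · intro s hs t ht hst
    -- This splitting dictates the dominating function: each factor is bounded on `[0,T]`, and its
    -- partner moves by at most the integral of the norm of its derivative.
    have e : B (X t) (Y t) - B (X s) (Y s) = B (X t - X s) (Y t) + B (X s) (Y t - Y s) := by
      simp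
    rw [e, intervalIntegral.integral_add
      ((intervalIntegrable_of_mem hX.integrable.norm hs ht).const_mul _)
      ((intervalIntegrable_of_mem hY.integrable.norm hs ht).const_mul _),
      intervalIntegral.integral_const_mul, intervalIntegral.integral_const_mul]
    refine (norm_add_le _ _).trans (add_le_add ?_ ?_)
    · calc ‖B (X t - X s) (Y t)‖ ≤ ‖B‖ * ‖X t - X s‖ * ‖Y t‖ := B.le_opNorm₂ _ _
        _ ≤ ‖B‖ * (∫ r in s..t, ‖x r‖) * D := by
          have := hX.norm_sub_le hs ht hst
          have := hD t ht
          gcongr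
          exact mul_nonneg (norm_nonneg B) ((norm_nonneg _).trans ‹_›)
        _ = _ := by ring
    · calc ‖B (X s) (Y t - Y s)‖ ≤ ‖B‖ * ‖X s‖ * ‖Y t - Y s‖ := B.le_opNorm₂ _ _
        _ ≤ ‖B‖ * C * (∫ r in s..t, ‖y r‖) := by
          have := hY.norm_sub_le hs ht hst
          have := hC s hs
          gcongr
  · filter_upwards [hX.ae_hasDerivAt, hY.ae_hasDerivAt] with t h1 h2 ht
    have := B.hasFDerivAt_of_bilinear (h1 ht).hasFDerivAt (h2 ht).hasFDerivAt
    have h3 := this.hasDerivAt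
    refine h3.congr_deriv ?_
    simp [add_comm]

theorem IsAntideriv.inner {E : Type*} [NormedAddCommGroup E] [InnerProductSpace ℝ E]
    [CompleteSpace E] {X x Y y : ℝ → E} (hX : IsAntideriv T X x) (hY : IsAntideriv T Y y) :
    IsAntideriv T (fun t => ⟪X t, Y t⟫_ℝ) (fun t => ⟪x t, Y t⟫_ℝ + ⟪X t, y t⟫_ℝ) :=
  hX.bilin (innerSL ℝ) hY

theorem IsAntideriv.mul {X x Y y : ℝ → ℝ} (hX : IsAntideriv T X x) (hY : IsAntideriv T Y y) :
    IsAntideriv T (fun t => X t * Y t) (fun t => x t * Y t + X t * y t) :=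
  hX.bilin (ContinuousLinearMap.mul ℝ ℝ) hY

theorem IsAntideriv.integral_eq {X x : ℝ → E} (hT : 0 ≤ T) (h : IsAntideriv T X x) :
    ∫ t, x t ∂(timeMeasure T) = X T - X 0 := by
  rw [← intervalIntegral_eq_timeMeasure hT, h.sub_eq ⟨le_rfl, hT⟩ ⟨hT, le_rfl⟩]

end Antideriv

end FokkerPlanck

namespace FokkerPlanck

/-! ### Regularization in a Gelfand triple -/

section Gelfand

theorem integrable_inner_of_memLp {V : Type*} [NormedAddCommGroup V] [InnerProductSpace ℝ V]
    {T : ℝ} {f g : ℝ → V} (hf : MemLp f 2 (timeMeasure T))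
    (hg : MemLp g 2 (timeMeasure T)) : Integrable (fun t => ⟪f t, g t⟫_ℝ) (timeMeasure T) :=
  memLp_one_iff_integrable.1 ((innerSL ℝ).memLp_of_bilin 1 hf hg)

/-- An ε/3 argument: contractivity controls the error made by replacing `x` with a nearby point of
the dense set. -/
theorem tendsto_of_tendsto_of_dense {E : Type*} [NormedAddCommGroup E] [NormedSpace ℝ E]
    {L : ℕ → E →L[ℝ] E} (hL : ∀ k x, ‖L k x‖ ≤ ‖x‖) {s : Set E} (hs : Dense s)
    (h : ∀ x ∈ s, Tendsto (fun k => L k x) atTop (𝓝 x)) (x : E) :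
    Tendsto (fun k => L k x) atTop (𝓝 x) := by
  rw [Metric.tendsto_atTop]
  intro ε hε
  obtain ⟨z, hz, hxz⟩ := hs.exists_dist_lt x (by positivity : 0 < ε / 3)
  obtain ⟨N, hN⟩ := Metric.tendsto_atTop.1 (h z hz) (ε / 3) (by positivity)
  refine ⟨N, fun k hk => ?_⟩
  have h1 : dist (L k x) (L k z) ≤ dist x z := by
    rw [dist_eq_norm, dist_eq_norm, ← map_sub]
    exact hL k _
  have h2 := dist_triangle4 (L k x) (L k z) z x
  rw [dist_comm z x] at h2
  linarith [hN k hk]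

variable {V H : Type*} [NormedAddCommGroup V] [InnerProductSpace ℝ V] [CompleteSpace V]
  [NormedAddCommGroup H] [InnerProductSpace ℝ H] [CompleteSpace H] {ι : V →L[ℝ] H}

/-- The orthogonal complement of the range of the adjoint is the kernel of `ι`. -/
theorem dense_range_adjoint (h : Function.Injective ι) : DenseRange (ι†) := by
  have h1 : (LinearMap.range ((ι†).toLinearMap))ᗮ = ⊥ := by
    have := ContinuousLinearMap.orthogonal_range (ι†)
    rw [ContinuousLinearMap.adjoint_adjoint] at this
    rw [show LinearMap.range ((ι†).toLinearMap) = (ι†).range from rfl, this]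
    exact LinearMap.ker_eq_bot.2 h
  have h2 := (Submodule.topologicalClosure_eq_top_iff (K := LinearMap.range ((ι†).toLinearMap))).2 h1
  have h3 := (Submodule.dense_iff_topologicalClosure_eq_top).2 h2
  exact h3

theorem dense_range_of_injective_adjoint (h : Function.Injective (ι†)) : DenseRange ι := by
  have := dense_range_adjoint h
  rwa [ContinuousLinearMap.adjoint_adjoint] at this

theorem inner_adjoint_comp_self (x y : V) : ⟪(ι†) (ι x), y⟫_ℝ = ⟪ι x, ι y⟫_ℝ :=
  ContinuousLinearMap.adjoint_inner_left ι y (ι x)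

/-- The operator `ι† ι + ε` is bounded below by `ε` as a quadratic form, hence invertible by the
Lax-Milgram argument. -/
theorem exists_resolvent (ι : V →L[ℝ] H) {ε : ℝ} (hε : 0 < ε) :
    ∃ R : V →L[ℝ] V, (∀ x, (ι†) (ι (R x)) + ε • R x = x) ∧ ∀ x, R ((ι†) (ι x) + ε • x) = x := by
  set A : V →L[ℝ] V := (ι†) ∘L ι + ε • ContinuousLinearMap.id ℝ V with hA
  have hA' : ∀ x, A x = (ι†) (ι x) + ε • x := fun x => by simp [hA]
  have hu : IsUnit A := by
    refine ContinuousLinearMap.isUnit_of_forall_le_norm_inner_map A (c := ε.toNNReal) (by simpa) fun x => ?_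
    rw [hA', inner_add_left, inner_adjoint_comp_self, inner_smul_left, real_inner_self_eq_norm_sq,
      real_inner_self_eq_norm_sq]
    refine le_trans ?_ (le_abs_self _)
    rw [Real.coe_toNNReal _ hε.le, conj_trivial]
    nlinarith [sq_nonneg ‖ι x‖]
  obtain ⟨⟨A', R, h1, h2⟩, h3⟩ := hu
  simp only at h3
  subst h3
  refine ⟨R, fun x => ?_, fun x => ?_⟩
  · rw [← hA']
    exact congrArg (fun L : V →L[ℝ] V => L x) h1
  · rw [← hA']
    exact congrArg (fun L : V →L[ℝ] V => L x) h2

/-- For the embedding `ι : V → H` of a Gelfand triple there are self-adjoint operators `R k`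
approximating the inverse of `(ι†) ι`. -/
theorem exists_regularization (hι : Function.Injective ι) (hι' : Function.Injective (ι†)) :
    ∃ R : ℕ → V →L[ℝ] V, (∀ k x y, ⟪R k x, y⟫_ℝ = ⟪x, R k y⟫_ℝ) ∧
      (∀ k x, ‖R k ((ι†) (ι x))‖ ≤ ‖x‖) ∧
      (∀ x, Tendsto (fun k => R k ((ι†) (ι x))) atTop (𝓝 x)) ∧
      ∀ h, Tendsto (fun k => ι (R k ((ι†) h))) atTop (𝓝 h) := by
  have hε : ∀ k : ℕ, (0 : ℝ) < 1 / ((k : ℝ) + 1) := fun k => by positivity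
  choose R hR1 hR2 using fun k => exists_resolvent ι (hε k)
  have hsym : ∀ k x y, ⟪R k x, y⟫_ℝ = ⟪x, R k y⟫_ℝ := by
    intro k x y
    conv_lhs => rw [← hR1 k y]
    conv_rhs => rw [← hR1 k x]
    rw [inner_add_right, inner_add_left, inner_smul_left, inner_smul_right,
      inner_adjoint_comp_self, ContinuousLinearMap.adjoint_inner_right]
    simp
  have hbd : ∀ k x, ‖R k ((ι†) (ι x))‖ ≤ ‖x‖ := by
    intro k x
    set y := R k ((ι†) (ι x)) with hy
    -- Pairing this identity with `y - x` gives ε⟨y, y - x⟩ ≤ 0, that is ‖y‖² ≤ ⟨y, x⟩.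
    have h1 : (ι†) (ι (y - x)) = -((1 / ((k : ℝ) + 1)) • y) := by
      have := hR1 k ((ι†) (ι x))
      rw [← hy] at this
      rw [map_sub, map_sub, ← this]
      abel
    have h2 : 0 ≤ ⟪ι (y - x), ι (y - x)⟫_ℝ := real_inner_self_nonneg
    rw [← inner_adjoint_comp_self, h1, inner_neg_left, inner_smul_left, inner_sub_right,
      real_inner_self_eq_norm_sq] at h2
    have h3 : ‖y‖ ^ 2 ≤ ⟪y, x⟫_ℝ := by
      simp only [conj_trivial] at h2
      nlinarith [hε k]
    have h4 := real_inner_le_norm y x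
    rcases (norm_nonneg y).eq_or_lt with h0 | h0
    · rw [← h0]
      exact norm_nonneg x
    · nlinarith
  have hbd' : ∀ k h, ‖ι (R k ((ι†) h))‖ ≤ ‖h‖ := by
    intro k h
    set y := R k ((ι†) h) with hy
    -- Testing the resolvent equation with `y` itself and dropping ε‖y‖² leaves ‖ι y‖² ≤ ⟨h, ι y⟩.
    have h1 : ⟪(ι†) (ι y) + (1 / ((k : ℝ) + 1)) • y, y⟫_ℝ = ⟪h, ι y⟫_ℝ := by
      rw [hR1 k ((ι†) h), ContinuousLinearMap.adjoint_inner_left]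
    rw [inner_add_left, inner_smul_left, inner_adjoint_comp_self, real_inner_self_eq_norm_sq,
      real_inner_self_eq_norm_sq] at h1
    have h3 : ‖ι y‖ ^ 2 ≤ ⟪h, ι y⟫_ℝ := by
      have := mul_nonneg (hε k).le (sq_nonneg ‖y‖)
      simp only [conj_trivial] at h1
      linarith
    have h4 := real_inner_le_norm h (ι y)
    rcases (norm_nonneg (ι y)).eq_or_lt with h0 | h0
    · rw [← h0]
      exact norm_nonneg h
    · nlinarith
  have hlim : ∀ x, Tendsto (fun k => R k ((ι†) (ι x))) atTop (𝓝 x) := by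
    have hd : DenseRange (fun x => (ι†) (ι x)) :=
      (dense_range_adjoint hι).comp (dense_range_of_injective_adjoint hι') (ι†).continuous
    -- By contractivity it is enough to treat x = ι† ι z. There the error is ε R ι† ι z, of norm at
    -- most ε‖z‖.
    refine tendsto_of_tendsto_of_dense (L := fun k => R k ∘L (ι†) ∘L ι) hbd hd ?_
    rintro - ⟨z, rfl⟩
    have h1 : ∀ k, (ι†) (ι z) - R k ((ι†) (ι ((ι†) (ι z)))) = (1 / ((k : ℝ) + 1)) • R k ((ι†) (ι z)) := by
      intro k
      have := hR2 k ((ι†) (ι z))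
      rw [map_add, map_smul] at this
      rw [sub_eq_iff_eq_add]
      rw [add_comm]
      exact this.symm
    rw [tendsto_iff_norm_sub_tendsto_zero]
    refine squeeze_zero (fun _ => norm_nonneg _) (g := fun k : ℕ => 1 / ((k : ℝ) + 1) * ‖z‖)
      (fun k => ?_) ?_
    · rw [norm_sub_rev]
      simp only [ContinuousLinearMap.comp_apply]
      rw [h1, norm_smul, Real.norm_of_nonneg (hε k).le]
      exact mul_le_mul_of_nonneg_left (hbd k z) (hε k).le
    · simpa using tendsto_one_div_add_atTop_nhds_zero_nat.mul_const ‖z‖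
  refine ⟨R, hsym, hbd, hlim, ?_⟩
  refine tendsto_of_tendsto_of_dense (L := fun k => ι ∘L R k ∘L (ι†)) hbd'
    (dense_range_of_injective_adjoint hι') ?_
  rintro - ⟨x, rfl⟩
  exact (ι.continuous.tendsto x).comp (hlim x)

/-- `w` solves `(ι† ι w)' = g` on `(0,T)` with initial value `h`, in integrated form. -/
structure IsEvolution (ι : V →L[ℝ] H) (T : ℝ) (h : H) (w g : ℝ → V) : Prop where
  memLp : MemLp w 2 (timeMeasure T)
  memLp_deriv : MemLp g 2 (timeMeasure T)
  eq_integral : ∀ᵐ t ∂(timeMeasure T), (ι†) (ι (w t)) = (ι†) h + ∫ s in (0 : ℝ)..t, g s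

variable {T : ℝ} {h : H} {w g : ℝ → V}

theorem integrable_norm_mul_norm {E F : Type*} [NormedAddCommGroup E] [NormedAddCommGroup F]
    {f : ℝ → E} {g : ℝ → F} (hf : MemLp f 2 (timeMeasure T))
    (hg : MemLp g 2 (timeMeasure T)) : Integrable (fun t => ‖f t‖ * ‖g t‖) (timeMeasure T) :=
  hf.norm.integrable_mul hg.norm

theorem integrable_of_memLp_two {E : Type*} [NormedAddCommGroup E] {f : ℝ → E}
    (hf : MemLp f 2 (timeMeasure T)) : Integrable f (timeMeasure T) :=
  hf.integrable (by norm_num)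

theorem intervalIntegral_le_timeMeasure {f : ℝ → ℝ} (hf : Integrable f (timeMeasure T))
    (h0 : ∀ t, 0 ≤ f t) {t : ℝ} (ht : t ∈ Icc 0 T) :
    ∫ s in (0 : ℝ)..t, f s ≤ ∫ s, f s ∂(timeMeasure T) := by
  rw [intervalIntegral.integral_of_le ht.1, integral_Ioc_eq_integral_Ioo]
  exact setIntegral_mono_set hf (Eventually.of_forall h0)
    (Ioo_subset_Ioo_right ht.2).eventuallyLE

/-- The Lions-Magenes lemma: a solution has a representative that is continuous with values in
`H`, and satisfies the energy identity. -/
theorem IsEvolution.exists_continuousOn (hι : Function.Injective ι)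
    (hι' : Function.Injective (ι†)) (hT : 0 ≤ T) (hw : IsEvolution ι T h w g) :
    ∃ c : ℝ → H, ContinuousOn c (Icc 0 T) ∧ (∀ᵐ t ∂(timeMeasure T), c t = ι (w t)) ∧ c 0 = h ∧
      IsAntideriv T (fun t => ‖c t‖ ^ 2) (fun t => 2 * ⟪g t, w t⟫_ℝ) := by
  obtain ⟨R, hsym, hbd, hlim, hlim'⟩ := exists_regularization hι hι'
  have hgi : Integrable g (timeMeasure T) := integrable_of_memLp_two hw.memLp_deriv
  have h0T : (0 : ℝ) ∈ Icc 0 T := ⟨le_rfl, hT⟩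
  set G : ℝ → V := fun t => (ι†) h + ∫ s in (0 : ℝ)..t, g s with hG
  have hGa : IsAntideriv T G g := isAntideriv_integral hgi _
  have hG0 : G 0 = (ι†) h := by simp [hG]
  have hGw : ∀ᵐ t ∂(timeMeasure T), G t = (ι†) (ι (w t)) := by
    filter_upwards [hw.eq_integral] with t ht using ht.symm
  -- `a k` will bound the energy error accumulated over `(0,T)`, and `b k` is the regularization
  -- error of the initial value.
  set a : ℕ → ℝ := fun k => ∫ t, ‖g t‖ * ‖R k ((ι†) (ι (w t))) - w t‖ ∂(timeMeasure T) with ha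
  set b : ℕ → ℝ := fun k => ‖ι (R k ((ι†) h)) - h‖ with hb
  have hRw : ∀ k, MemLp (fun t => R k ((ι†) (ι (w t)))) 2 (timeMeasure T) := fun k =>
    (R k ∘L (ι†) ∘L ι).comp_memLp' hw.memLp
  have hRRw : ∀ k, MemLp (fun t => R k ((ι†) (ι (R k ((ι†) (ι (w t))))))) 2 (timeMeasure T) := fun k =>
    (R k ∘L (ι†) ∘L ι).comp_memLp' (hRw k)
  have hai : ∀ k, Integrable (fun t => ‖g t‖ * ‖R k ((ι†) (ι (w t))) - w t‖) (timeMeasure T) :=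
    fun k => integrable_norm_mul_norm hw.memLp_deriv ((hRw k).sub hw.memLp)
  have ha0 : ∀ k, 0 ≤ a k := fun k => integral_nonneg fun t => by positivity
  have halim : Tendsto a atTop (𝓝 0) := by
    have : Tendsto a atTop (𝓝 (∫ t, (0 : ℝ) ∂(timeMeasure T))) := by
      refine tendsto_integral_of_dominated_convergence (fun t => ‖g t‖ * ‖w t‖ * 2)
        (fun k => (hai k).aestronglyMeasurable)
        ((integrable_norm_mul_norm hw.memLp_deriv hw.memLp).mul_const 2)
        (fun k => Eventually.of_forall fun t => ?_) (Eventually.of_forall fun t => ?_)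
      · rw [Real.norm_of_nonneg (by positivity), mul_assoc]
        refine mul_le_mul_of_nonneg_left ?_ (norm_nonneg _)
        have := norm_sub_le (R k ((ι†) (ι (w t)))) (w t)
        linarith [hbd k (w t)]
      · have := (tendsto_iff_norm_sub_tendsto_zero.1 (hlim (w t))).const_mul ‖g t‖
        simpa using this
    simpa using this
  have hblim : Tendsto b atTop (𝓝 0) := tendsto_iff_norm_sub_tendsto_zero.1 (hlim' h)
  have hcauchy : ∀ k l, ∀ t ∈ Icc 0 T, ‖ι (R k (G t)) - ι (R l (G t))‖ ^ 2
      ≤ (b k + b l) ^ 2 + 4 * (a k + a l) := by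
    intro k l t ht
    -- The curve ι (R_k - R_l) G is an H-valued primitive, so its squared norm can be differentiated
    -- by the product rule.
    have hX := hGa.clm_apply (ι ∘L (R k - R l))
    have h1 := (hX.inner hX).eq_integral t ht
    simp only [ContinuousLinearMap.comp_apply, sub_apply, map_sub] at h1
    rw [real_inner_self_eq_norm_sq, real_inner_self_eq_norm_sq] at h1
    rw [h1]
    refine add_le_add ?_ ?_
    · have : ‖ι (R k (G 0)) - ι (R l (G 0))‖ ≤ b k + b l := by
        rw [hG0, hb]
        calc _ = ‖(ι (R k ((ι†) h)) - h) - (ι (R l ((ι†) h)) - h)‖ := by congr 1; abel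
          _ ≤ _ := norm_sub_le _ _
      gcongr
    · have h2 : ∀ᵐ s ∂(timeMeasure T), ⟪ι (R k (g s)) - ι (R l (g s)), ι (R k (G s)) - ι (R l (G s))⟫_ℝ
          + ⟪ι (R k (G s)) - ι (R l (G s)), ι (R k (g s)) - ι (R l (g s))⟫_ℝ
          ≤ 4 * (‖g s‖ * ‖R k ((ι†) (ι (w s))) - w s‖ + ‖g s‖ * ‖R l ((ι†) (ι (w s))) - w s‖) := by
        filter_upwards [hGw] with s hs
        rw [real_inner_comm, ← two_mul, hs]
        set y := R k ((ι†) (ι (w s))) - R l ((ι†) (ι (w s))) with hy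
        have e1 : ι (R k ((ι†) (ι (w s)))) - ι (R l ((ι†) (ι (w s)))) = ι y := by rw [hy, map_sub]
        -- Self-adjointness moves `R k` and `R l` off `g`, whose regularizations need not be bounded
        -- uniformly in `k`. They now act after ι† ι, where they are contractions.
        have e2 : ⟪ι (R k (g s)) - ι (R l (g s)), ι y⟫_ℝ
            = ⟪g s, R k ((ι†) (ι y)) - R l ((ι†) (ι y))⟫_ℝ := by
          rw [← map_sub, ← ContinuousLinearMap.adjoint_inner_right, inner_sub_left, hsym, hsym,
            inner_sub_right]
        rw [e1, real_inner_comm, e2]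
        have e3 : ‖R k ((ι†) (ι y)) - R l ((ι†) (ι y))‖ ≤ 2 * ‖y‖ := by
          refine (norm_sub_le _ _).trans ?_
          linarith [hbd k y, hbd l y]
        have e4 : ‖y‖ ≤ ‖R k ((ι†) (ι (w s))) - w s‖ + ‖R l ((ι†) (ι (w s))) - w s‖ := by
          calc ‖y‖ = ‖(R k ((ι†) (ι (w s))) - w s) - (R l ((ι†) (ι (w s))) - w s)‖ := by
                rw [hy]; congr 1; abel
            _ ≤ _ := norm_sub_le _ _
        have e5 := real_inner_le_norm (g s) (R k ((ι†) (ι y)) - R l ((ι†) (ι y)))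
        have e6 := mul_le_mul_of_nonneg_left (e3.trans (mul_le_mul_of_nonneg_left e4 two_pos.le))
          (norm_nonneg (g s))
        linarith
      have hI : Integrable (fun s => 4 * (‖g s‖ * ‖R k ((ι†) (ι (w s))) - w s‖
          + ‖g s‖ * ‖R l ((ι†) (ι (w s))) - w s‖)) (timeMeasure T) :=
        ((hai k).add (hai l)).const_mul 4
      have hI' := (hX.inner hX).integrable
      simp only [ContinuousLinearMap.comp_apply, sub_apply, map_sub] at hI'
      calc _ ≤ ∫ s in (0 : ℝ)..t, 4 * (‖g s‖ * ‖R k ((ι†) (ι (w s))) - w s‖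
          + ‖g s‖ * ‖R l ((ι†) (ι (w s))) - w s‖) := by
            rw [intervalIntegral.integral_of_le ht.1, intervalIntegral.integral_of_le ht.1,
              integral_Ioc_eq_integral_Ioo, integral_Ioc_eq_integral_Ioo]
            have hsub : volume.restrict (Ioo 0 t) ≤ timeMeasure T :=
              Measure.restrict_mono_set _ (Ioo_subset_Ioo_right ht.2)
            exact integral_mono_ae (hI'.mono_measure hsub) (hI.mono_measure hsub)
              (ae_mono hsub h2)
        _ ≤ _ := intervalIntegral_le_timeMeasure hI (fun s => by positivity) ht
        _ = _ := by rw [integral_const_mul, integral_add (hai k) (hai l)]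
  have hC : UniformCauchySeqOn (fun k t => ι (R k (G t))) atTop (Icc 0 T) := by
    rw [Metric.uniformCauchySeqOn_iff]
    intro ε hε
    have hlim0 : Tendsto (fun k => (2 * b k) ^ 2 + 4 * (2 * a k)) atTop (𝓝 0) := by
      simpa using ((hblim.const_mul 2).pow 2).add ((halim.const_mul 2).const_mul 4)
    have h1 : Tendsto (fun k => b k) atTop (𝓝 0) := hblim
    -- The thresholds ε/4 and ε²/16 make the two parts of the bound in `hcauchy` smaller than ε²/4
    -- and ε²/2.
    obtain ⟨N1, hN1⟩ := eventually_atTop.1 (hblim.eventually_lt_const (by positivity : 0 < ε / 4))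
    obtain ⟨N2, hN2⟩ := eventually_atTop.1
      (halim.eventually_lt_const (by positivity : 0 < ε ^ 2 / 16))
    refine ⟨max N1 N2, fun k hk l hl t ht => ?_⟩
    rw [dist_eq_norm]
    have h2 := hcauchy k l t ht
    have hk1 := hN1 k (le_trans (le_max_left _ _) hk)
    have hk2 := hN2 k (le_trans (le_max_right _ _) hk)
    have hl1 := hN1 l (le_trans (le_max_left _ _) hl)
    have hl2 := hN2 l (le_trans (le_max_right _ _) hl)
    have hb0 : 0 ≤ b k + b l := add_nonneg (norm_nonneg _) (norm_nonneg _)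
    have h3 : (b k + b l) ^ 2 < (ε / 2) ^ 2 := by
      apply pow_lt_pow_left₀ _ hb0 (by norm_num)
      linarith
    refine lt_of_pow_lt_pow_left₀ 2 hε.le (h2.trans_lt ?_)
    nlinarith
  have hex : ∀ t ∈ Icc 0 T, ∃ y, Tendsto (fun k => ι (R k (G t))) atTop (𝓝 y) := fun t ht =>
    cauchySeq_tendsto_of_complete (hC.cauchySeq ht)
  classical
  -- The uniform limit of the regularized curves; outside `[0,T]` the value 0 is a mere convention.
  set c : ℝ → H := fun t => if ht : t ∈ Icc 0 T then (hex t ht).choose else 0 with hc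
  have hclim : ∀ t ∈ Icc 0 T, Tendsto (fun k => ι (R k (G t))) atTop (𝓝 (c t)) := by
    intro t ht
    simp only [hc, dif_pos ht]
    exact (hex t ht).choose_spec
  have hc0 : c 0 = h := by
    refine tendsto_nhds_unique (hclim 0 h0T) ?_
    rw [hG0]
    exact hlim' h
  refine ⟨c, ?_, ?_, hc0, ?_, ?_⟩
  · refine (hC.tendstoUniformlyOn_of_tendsto hclim).continuousOn (Frequently.of_forall fun k => ?_)
    exact (hGa.clm_apply (ι ∘L R k)).continuousOn
  · filter_upwards [hGw, ae_restrict_mem measurableSet_Ioo] with t ht htT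
    refine tendsto_nhds_unique (hclim t (Ioo_subset_Icc_self htT)) ?_
    rw [ht]
    exact (ι.continuous.tendsto _).comp (hlim (w t))
  · exact (integrable_inner_of_memLp hw.memLp_deriv hw.memLp).const_mul 2
  · intro t ht
    have hsub : volume.restrict (Ioc 0 t) ≤ timeMeasure T := by
      rw [← restrict_Ioo_eq_restrict_Ioc]
      exact Measure.restrict_mono_set _ (Ioo_subset_Ioo_right ht.2)
    -- The energy identity of the regularized curve. The limit is taken under the integral,
    -- dominated by 2‖g‖‖w‖.
    have hk : ∀ k, ‖ι (R k (G t))‖ ^ 2 = ‖ι (R k (G 0))‖ ^ 2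
        + ∫ s in (0 : ℝ)..t, 2 * ⟪g s, R k ((ι†) (ι (R k ((ι†) (ι (w s))))))⟫_ℝ := by
      intro k
      have hX := hGa.clm_apply (ι ∘L R k)
      have h1 := (hX.inner hX).eq_integral t ht
      simp only [ContinuousLinearMap.comp_apply] at h1
      rw [real_inner_self_eq_norm_sq, real_inner_self_eq_norm_sq] at h1
      rw [h1]
      congr 1
      rw [intervalIntegral.integral_of_le ht.1, intervalIntegral.integral_of_le ht.1]
      refine integral_congr_ae (ae_mono hsub ?_)
      filter_upwards [hGw] with s hs
      rw [real_inner_comm, ← two_mul, real_inner_comm, ← ContinuousLinearMap.adjoint_inner_right,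
        hsym, hs]
    have hR1 : Tendsto (fun k => ‖ι (R k (G t))‖ ^ 2) atTop (𝓝 (‖c t‖ ^ 2)) :=
      ((hclim t ht).norm).pow 2
    have hR0 : Tendsto (fun k => ‖ι (R k (G 0))‖ ^ 2) atTop (𝓝 (‖c 0‖ ^ 2)) :=
      ((hclim 0 h0T).norm).pow 2
    have hbb : ∀ k s, ‖R k ((ι†) (ι (R k ((ι†) (ι (w s))))))‖ ≤ ‖w s‖ := fun k s =>
      (hbd k _).trans (hbd k _)
    have hR2 : Tendsto (fun k => ∫ s in (0 : ℝ)..t, 2 * ⟪g s, R k ((ι†) (ι (R k ((ι†) (ι (w s))))))⟫_ℝ)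
        atTop (𝓝 (∫ s in (0 : ℝ)..t, 2 * ⟪g s, w s⟫_ℝ)) := by
      simp only [intervalIntegral.integral_of_le ht.1]
      refine tendsto_integral_of_dominated_convergence (fun s => 2 * (‖g s‖ * ‖w s‖))
        (fun k => ?_) ?_ (fun k => Eventually.of_forall fun s => ?_)
        (Eventually.of_forall fun s => ?_)
      · exact (((integrable_inner_of_memLp hw.memLp_deriv (hRRw k)).const_mul 2).mono_measure
          hsub).aestronglyMeasurable
      · exact ((integrable_norm_mul_norm hw.memLp_deriv hw.memLp).const_mul 2).mono_measure hsub
      · rw [norm_mul, Real.norm_of_nonneg two_pos.le]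
        refine mul_le_mul_of_nonneg_left ?_ two_pos.le
        exact (norm_inner_le_norm _ _).trans (mul_le_mul_of_nonneg_left (hbb k s) (norm_nonneg _))
      · refine Tendsto.const_mul 2 (Tendsto.inner tendsto_const_nhds ?_)
        have h2 := (hlim (w s)).sub (hlim (w s))
        -- The operator R_k ι† ι is applied twice. Contractivity of the outer copy absorbs the error
        -- of the inner one.
        have h3 : Tendsto (fun k => R k ((ι†) (ι (R k ((ι†) (ι (w s))) - w s)))) atTop (𝓝 0) := by
          refine squeeze_zero_norm (fun k => hbd k _) ?_
          exact tendsto_iff_norm_sub_tendsto_zero.1 (hlim (w s))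
        have h4 := h3.add (hlim (w s))
        rw [zero_add] at h4
        refine h4.congr fun k => ?_
        rw [← map_add, ← map_add, ← map_add, sub_add_cancel]
    exact tendsto_nhds_unique hR1 ((hR0.add hR2).congr fun k => (hk k).symm)

end Gelfand

end FokkerPlanck

namespace FokkerPlanck

/-! ### Linear evolution equations with coercive coefficients -/

section SquareIntegrable

variable {α : Type*} [MeasurableSpace α] {μ : Measure α} {E F : Type*} [NormedAddCommGroup E]
  [NormedAddCommGroup F]

theorem integrable_norm_sq {f : α → E} (hf : MemLp f 2 μ) : Integrable (fun t => ‖f t‖ ^ 2) μ :=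
  (memLp_two_iff_integrable_sq_norm hf.1).1 hf

theorem integral_norm_mul_norm_le {f : α → E} {g : α → F} (hf : MemLp f 2 μ) (hg : MemLp g 2 μ) :
    ∫ t, ‖f t‖ * ‖g t‖ ∂μ ≤ √(∫ t, ‖f t‖ ^ 2 ∂μ) * √(∫ t, ‖g t‖ ^ 2 ∂μ) := by
  have h := integral_mul_le_Lp_mul_Lq_of_nonneg (μ := μ) (p := 2) (q := 2)
    (f := fun t => ‖f t‖) (g := fun t => ‖g t‖) Real.HolderConjugate.two_two
    (Eventually.of_forall fun _ => norm_nonneg _) (Eventually.of_forall fun _ => norm_nonneg _)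
    (by simpa using hf.norm) (by simpa using hg.norm)
  simpa [Real.sqrt_eq_rpow] using h

theorem norm_toLp_two [InnerProductSpace ℝ E] {f : α → E} (hf : MemLp f 2 μ) :
    ‖hf.toLp f‖ = √(∫ t, ‖f t‖ ^ 2 ∂μ) := by
  rw [norm_eq_sqrt_real_inner, L2.inner_def]
  congr 1
  refine integral_congr_ae ?_
  filter_upwards [hf.coeFn_toLp] with t ht
  rw [ht, real_inner_self_eq_norm_sq]

end SquareIntegrable

/-- Lions' projection lemma. -/
theorem exists_inner_eq_of_abs_le {Φ E : Type*} [AddCommGroup Φ] [Module ℝ Φ]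
    [NormedAddCommGroup E] [InnerProductSpace ℝ E] [CompleteSpace E]
    (M : Φ →ₗ[ℝ] E) (L : Φ →ₗ[ℝ] ℝ) {C : ℝ} (h : ∀ θ, |L θ| ≤ C * ‖M θ‖) :
    ∃ w : E, ∀ θ, ⟪M θ, w⟫_ℝ = L θ := by
  -- The bound forces `L` to vanish on the kernel of `M`. Hence `L` descends to a functional on the
  -- range of `M`, bounded by `C` there, to which Hahn-Banach and Riesz apply.
  have hker : LinearMap.ker M ≤ LinearMap.ker L := by
    intro θ hθ
    have := h θ
    rw [LinearMap.mem_ker.1 hθ, norm_zero, mul_zero] at this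
    exact LinearMap.mem_ker.2 (abs_nonpos_iff.1 this)
  let f₀ : LinearMap.range M →ₗ[ℝ] ℝ :=
    ((LinearMap.ker M).liftQ L hker) ∘ₗ M.quotKerEquivRange.symm.toLinearMap
  have hf₀ : ∀ θ, f₀ ⟨M θ, LinearMap.mem_range_self M θ⟩ = L θ := by
    intro θ
    have : M.quotKerEquivRange.symm ⟨M θ, LinearMap.mem_range_self M θ⟩
        = Submodule.Quotient.mk θ := by
      rw [LinearEquiv.symm_apply_eq]
      rfl
    simp only [f₀, LinearMap.comp_apply, LinearEquiv.coe_coe, this]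
    exact Submodule.liftQ_apply _ _ _
  let f : StrongDual ℝ (LinearMap.range M) := f₀.mkContinuous C (by
    rintro ⟨-, θ, rfl⟩
    rw [hf₀]
    exact h θ)
  obtain ⟨g, hg, -⟩ := exists_extension_norm_eq (LinearMap.range M) f
  refine ⟨(InnerProductSpace.toDual ℝ E).symm g, fun θ => ?_⟩
  rw [real_inner_comm, InnerProductSpace.toDual_symm_apply, ← hf₀]
  exact hg ⟨M θ, LinearMap.mem_range_self M θ⟩

section Evolution

variable {V H : Type*} [NormedAddCommGroup V] [InnerProductSpace ℝ V] [CompleteSpace V]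
  [NormedAddCommGroup H] [InnerProductSpace ℝ H] [CompleteSpace H] {ι : V →L[ℝ] H}
  {T : ℝ} {h : H} {w f : ℝ → V} {A : ℝ → V →L[ℝ] V} {M α l : ℝ}

/-- Bounded measurable operator coefficients on `(0,T)` satisfying a Gårding inequality. -/
structure IsCoercive (ι : V →L[ℝ] H) (T : ℝ) (A : ℝ → V →L[ℝ] V) (M α l : ℝ) : Prop where
  aestronglyMeasurable : AEStronglyMeasurable A (timeMeasure T)
  bound : ∀ᵐ t ∂(timeMeasure T), ‖A t‖ ≤ M
  coercive : ∀ᵐ t ∂(timeMeasure T), ∀ v, α * ‖v‖ ^ 2 ≤ ⟪A t v, v⟫_ℝ + l * ‖ι v‖ ^ 2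
  pos : 0 < α
  nonneg : 0 ≤ l

theorem memLp_clm_apply {E F : Type*} [NormedAddCommGroup E] [NormedSpace ℝ E]
    [NormedAddCommGroup F] [NormedSpace ℝ F] {A : ℝ → E →L[ℝ] F} {M : ℝ} {w : ℝ → E}
    (hA : AEStronglyMeasurable A (timeMeasure T)) (hM : ∀ᵐ t ∂(timeMeasure T), ‖A t‖ ≤ M)
    (hw : MemLp w 2 (timeMeasure T)) : MemLp (fun t => A t (w t)) 2 (timeMeasure T) :=
  (ContinuousLinearMap.id ℝ (E →L[ℝ] F)).memLp_of_bilin 2 (memLp_top_of_bound hA M hM) hw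

namespace IsCoercive

theorem memLp_apply (hA : IsCoercive ι T A M α l) (hw : MemLp w 2 (timeMeasure T)) :
    MemLp (fun t => A t (w t)) 2 (timeMeasure T) :=
  memLp_clm_apply hA.aestronglyMeasurable hA.bound hw

theorem adjoint (hA : IsCoercive ι T A M α l) : IsCoercive ι T (fun t => (A t)†) M α l where
  aestronglyMeasurable :=
    (ContinuousLinearMap.adjoint (𝕜 := ℝ) (E := V) (F := V)).continuous.comp_aestronglyMeasurable
      hA.aestronglyMeasurable
  bound := by
    filter_upwards [hA.bound] with t ht
    rwa [LinearIsometryEquiv.norm_map]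
  coercive := by
    filter_upwards [hA.coercive] with t ht v
    rw [ContinuousLinearMap.adjoint_inner_left, real_inner_comm]
    exact ht v
  pos := hA.pos
  nonneg := hA.nonneg

end IsCoercive

theorem setIntegral_Ioc_mono_of_ae {f g : ℝ → ℝ} (hf : Integrable f (timeMeasure T))
    (hg : Integrable g (timeMeasure T)) (h : ∀ᵐ t ∂(timeMeasure T), f t ≤ g t) {t : ℝ}
    (ht : t ∈ Icc 0 T) : ∫ s in (0 : ℝ)..t, f s ≤ ∫ s in (0 : ℝ)..t, g s := by
  have hsub : volume.restrict (Ioo 0 t) ≤ timeMeasure T :=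
    Measure.restrict_mono_set _ (Ioo_subset_Ioo_right ht.2)
  rw [intervalIntegral.integral_of_le ht.1, intervalIntegral.integral_of_le ht.1,
    integral_Ioc_eq_integral_Ioo, integral_Ioc_eq_integral_Ioo]
  exact integral_mono_ae (hf.mono_measure hsub) (hg.mono_measure hsub) (ae_mono hsub h)

theorem isAntideriv_exp (k : ℝ) :
    IsAntideriv T (fun t => Real.exp (k * t)) (fun t => k * Real.exp (k * t)) := by
  refine isAntideriv_of_hasDerivAt (fun t => ?_) (by fun_prop)
  have := ((hasDerivAt_id t).const_mul k).exp
  simpa [mul_comm] using this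

/-- The energy estimate. -/
theorem energy_estimate (hT : 0 ≤ T) (hA : IsCoercive ι T A M α l)
    (hf : MemLp f 2 (timeMeasure T)) (hw : MemLp w 2 (timeMeasure T)) {c : ℝ → H}
    (hcw : ∀ᵐ t ∂(timeMeasure T), c t = ι (w t))
    (hc : IsAntideriv T (fun t => ‖c t‖ ^ 2) (fun t => 2 * ⟪f t - A t (w t), w t⟫_ℝ)) :
    (∀ t ∈ Icc 0 T, ‖c t‖ ^ 2 ≤
      Real.exp (2 * l * T) * (‖c 0‖ ^ 2 + α⁻¹ * ∫ s, ‖f s‖ ^ 2 ∂(timeMeasure T))) ∧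
    α * (∫ s, ‖w s‖ ^ 2 ∂(timeMeasure T)) ≤
      Real.exp (2 * l * T) * (‖c 0‖ ^ 2 + α⁻¹ * ∫ s, ‖f s‖ ^ 2 ∂(timeMeasure T)) := by
  have hα := hA.pos
  have hl := hA.nonneg
  -- Differentiating the weight exp(-2lt) produces exactly the term that cancels the Gårding defect
  -- l‖ι w‖².
  set e : ℝ → ℝ := fun t => Real.exp (-(2 * l) * t) with he
  have he0 : ∀ t, 0 < e t := fun t => Real.exp_pos _
  have he1 : ∀ t, 0 ≤ t → e t ≤ 1 := fun t ht => Real.exp_le_one_iff.2 (by nlinarith)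
  have heT : ∀ t, t ≤ T → e T ≤ e t := fun t ht => Real.exp_le_exp.2 (by nlinarith)
  have hP := (isAntideriv_exp (T := T) (-(2 * l))).mul hc
  have key : ∀ t ∈ Icc 0 T, e T * ‖c t‖ ^ 2 + α * e T * (∫ s in (0 : ℝ)..t, ‖w s‖ ^ 2)
      ≤ ‖c 0‖ ^ 2 + α⁻¹ * ∫ s, ‖f s‖ ^ 2 ∂(timeMeasure T) := by
    intro t ht
    have h1 := hP.eq_integral t ht
    simp only [mul_zero, Real.exp_zero, one_mul] at h1
    have h0T : (0 : ℝ) ∈ Icc 0 T := ⟨le_rfl, hT⟩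
    have i1 := (integrable_norm_sq hf).const_mul α⁻¹
    have i2 := (integrable_norm_sq hw).const_mul (α * e T)
    have h2 := setIntegral_Ioc_mono_of_ae hP.integrable (i1.sub i2) (by
      filter_upwards [hcw, hA.coercive, ae_restrict_mem measurableSet_Ioo] with s hs hco hsT
      have q1 := hco (w s)
      rw [hs, inner_sub_left]
      have q2 : ⟪f s, w s⟫_ℝ ≤ ‖f s‖ * ‖w s‖ := real_inner_le_norm _ _
      -- Young's inequality spends half of the coercivity term 2α‖w‖² on the source; the other half
      -- survives in the estimate.
      have q3 : 2 * (‖f s‖ * ‖w s‖) ≤ α⁻¹ * ‖f s‖ ^ 2 + α * ‖w s‖ ^ 2 := by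
        have := mul_nonneg (inv_nonneg.2 hα.le) (sq_nonneg (‖f s‖ - α * ‖w s‖))
        have e1 : α⁻¹ * (‖f s‖ - α * ‖w s‖) ^ 2
            = α⁻¹ * ‖f s‖ ^ 2 + α * ‖w s‖ ^ 2 - 2 * (‖f s‖ * ‖w s‖) := by field_simp; ring
        linarith
      have p1 := he0 s
      have p2 := he1 s hsT.1.le
      have p3 := heT s hsT.2.le
      have q4 : -(2 * l) * ‖ι (w s)‖ ^ 2 + 2 * (⟪f s, w s⟫_ℝ - ⟪(A s) (w s), w s⟫_ℝ)
          ≤ α⁻¹ * ‖f s‖ ^ 2 - α * ‖w s‖ ^ 2 := by linarith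
      have q5 : e s * (α⁻¹ * ‖f s‖ ^ 2) ≤ α⁻¹ * ‖f s‖ ^ 2 :=
        mul_le_of_le_one_left (by positivity) p2
      have q6 : e T * (α * ‖w s‖ ^ 2) ≤ e s * (α * ‖w s‖ ^ 2) :=
        mul_le_mul_of_nonneg_right p3 (by positivity)
      have q7 := mul_le_mul_of_nonneg_left q4 p1.le
      simp only [Pi.sub_apply]
      change -(2 * l) * e s * ‖ι (w s)‖ ^ 2 + e s * _ ≤ _
      nlinarith) ht
    simp only [Pi.sub_apply] at h2
    rw [intervalIntegral.integral_sub (intervalIntegrable_of_mem i1 h0T ht)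
      (intervalIntegrable_of_mem i2 h0T ht), intervalIntegral.integral_const_mul,
      intervalIntegral.integral_const_mul] at h2
    have h3 := intervalIntegral_le_timeMeasure (integrable_norm_sq hf) (fun t => sq_nonneg _) ht
    have h4 := mul_le_mul_of_nonneg_left h3 (inv_nonneg.2 hα.le)
    have h5 : e T * ‖c t‖ ^ 2 ≤ e t * ‖c t‖ ^ 2 :=
      mul_le_mul_of_nonneg_right (heT t ht.2) (sq_nonneg _)
    change e t * ‖c t‖ ^ 2 = _ at h1
    linarith
  have hE : ∀ x K : ℝ, e T * x ≤ K → x ≤ Real.exp (2 * l * T) * K := by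
    intro x K hx
    have h1 := mul_le_mul_of_nonneg_left hx (Real.exp_pos (2 * l * T)).le
    have h2 : Real.exp (2 * l * T) * (e T * x) = x := by
      rw [← mul_assoc, he, ← Real.exp_add]
      ring_nf
      simp
    linarith
  refine ⟨fun t ht => hE _ _ ?_, hE _ _ ?_⟩
  · have h1 : 0 ≤ ∫ s in (0 : ℝ)..t, ‖w s‖ ^ 2 :=
      intervalIntegral.integral_nonneg ht.1 fun _ _ => sq_nonneg _
    have h2 := mul_nonneg (mul_nonneg hα.le (he0 T).le) h1
    linarith [key t ht]
  · have h1 := key T ⟨hT, le_rfl⟩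
    rw [intervalIntegral_eq_timeMeasure hT] at h1
    have h2 := mul_nonneg (he0 T).le (sq_nonneg ‖c T‖)
    linarith

/-- Dropping `b²` bounds `a`, and inserting that bound on the right bounds `b`. It will be used with
`a` the norm of a test primitive, `b` its initial value in H and `m` the norm of the test operator.
-/
theorem le_of_quadratic_le {a b m E α : ℝ} (hα : 0 < α) (ha : 0 ≤ a) (hm : 0 ≤ m)
    (hE : 0 ≤ E) (h : b ^ 2 / 2 + α * a ^ 2 ≤ E * (m * a)) :
    a ≤ E / α * m ∧ b ≤ E * √(2 / α) * m := by
  have h1 : a ≤ E / α * m := by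
    rcases ha.eq_or_lt with h0 | h0
    · rw [← h0]
      positivity
    · rw [div_mul_eq_mul_div, le_div_iff₀ hα]
      nlinarith [sq_nonneg b]
  refine ⟨h1, ?_⟩
  have h2 : b ^ 2 ≤ (E * √(2 / α) * m) ^ 2 := by
    rw [mul_pow, mul_pow, Real.sq_sqrt (by positivity)]
    have h3 : E * (m * a) ≤ E * (m * (E / α * m)) := by gcongr
    have h4 : 0 ≤ α * a ^ 2 := by positivity
    calc b ^ 2 ≤ 2 * (E * (m * (E / α * m))) := by linarith
      _ = _ := by ring
  exact abs_le_of_sq_le_sq' h2 (by positivity) |>.2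

/-- The primitive of `θ` that vanishes at `T`. -/
def backPrimitive (T : ℝ) (θ : ℝ → V) (t : ℝ) : V :=
  (∫ s in (0 : ℝ)..t, θ s) - ∫ s in (0 : ℝ)..T, θ s

theorem isAntideriv_backPrimitive {θ : ℝ → V} (hθ : Integrable θ (timeMeasure T)) :
    IsAntideriv T (backPrimitive T θ) θ := by
  have := isAntideriv_integral hθ (-∫ s in (0 : ℝ)..T, θ s)
  convert this using 2 with t
  rw [backPrimitive, sub_eq_neg_add]

theorem backPrimitive_self (θ : ℝ → V) : backPrimitive T θ T = 0 := sub_self _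

theorem backPrimitive_zero (θ : ℝ → V) : backPrimitive T θ 0 = -∫ s in (0 : ℝ)..T, θ s := by
  simp [backPrimitive]

theorem intervalIntegral_congr_of_ae {E : Type*} [NormedAddCommGroup E] [NormedSpace ℝ E]
    {f g : ℝ → E} (h : f =ᵐ[timeMeasure T] g) {t : ℝ}
    (ht : t ∈ Icc 0 T) : ∫ s in (0 : ℝ)..t, f s = ∫ s in (0 : ℝ)..t, g s := by
  rw [intervalIntegral.integral_of_le ht.1, intervalIntegral.integral_of_le ht.1,
    integral_Ioc_eq_integral_Ioo, integral_Ioc_eq_integral_Ioo]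
  exact integral_congr_ae (ae_mono (Measure.restrict_mono_set _ (Ioo_subset_Ioo_right ht.2)) h)

theorem backPrimitive_add (hT : 0 ≤ T) (θ θ' : Lp V 2 (timeMeasure T)) {t : ℝ} (ht : t ∈ Icc 0 T) :
    backPrimitive T (θ + θ' : Lp V 2 (timeMeasure T)) t
      = backPrimitive T θ t + backPrimitive T θ' t := by
  have hT' : T ∈ Icc 0 T := ⟨hT, le_rfl⟩
  have h0 : (0 : ℝ) ∈ Icc 0 T := ⟨le_rfl, hT⟩
  have hi : ∀ θ : Lp V 2 (timeMeasure T), Integrable θ (timeMeasure T) := fun θ =>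
    integrable_of_memLp_two (Lp.memLp θ)
  simp only [backPrimitive]
  rw [intervalIntegral_congr_of_ae (Lp.coeFn_add θ θ') ht,
    intervalIntegral_congr_of_ae (Lp.coeFn_add θ θ') hT']
  simp only [Pi.add_apply]
  rw [intervalIntegral.integral_add (intervalIntegrable_of_mem (hi θ) h0 ht)
    (intervalIntegrable_of_mem (hi θ') h0 ht), intervalIntegral.integral_add
    (intervalIntegrable_of_mem (hi θ) h0 hT') (intervalIntegrable_of_mem (hi θ') h0 hT')]
  abel

theorem backPrimitive_smul (hT : 0 ≤ T) (a : ℝ) (θ : Lp V 2 (timeMeasure T)) {t : ℝ}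
    (ht : t ∈ Icc 0 T) :
    backPrimitive T (a • θ : Lp V 2 (timeMeasure T)) t = a • backPrimitive T θ t := by
  have hT' : T ∈ Icc 0 T := ⟨hT, le_rfl⟩
  simp only [backPrimitive]
  rw [intervalIntegral_congr_of_ae (Lp.coeFn_smul a θ) ht,
    intervalIntegral_congr_of_ae (Lp.coeFn_smul a θ) hT']
  simp only [Pi.smul_apply, intervalIntegral.integral_smul, smul_sub]

/-! ### Existence by Lions' projection method -/

section Existence

variable (ι A T) in
/-- The test operator `θ ↦ A† φ - ι† ι θ`, where `φ' = θ`, `φ(T) = 0`. -/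
def lionsTest (θ : ℝ → V) (t : ℝ) : V := ((A t)†) (backPrimitive T θ t) - (ι†) (ι (θ t))

theorem memLp_lionsTest (hA : IsCoercive ι T A M α l) {θ : ℝ → V} (hθ : MemLp θ 2 (timeMeasure T)) :
    MemLp (lionsTest ι T A θ) 2 (timeMeasure T) :=
  (hA.adjoint.memLp_apply ((isAntideriv_backPrimitive (integrable_of_memLp_two hθ)).memLp 2)).sub
    (((ι†) ∘L ι).comp_memLp' hθ)

variable (h f) in
/-- The right-hand side of Lions' variational problem. -/
def lionsRhs (hT : 0 ≤ T) (hf : MemLp f 2 (timeMeasure T)) : Lp V 2 (timeMeasure T) →ₗ[ℝ] ℝ where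
  toFun θ := (∫ t, ⟪f t, backPrimitive T θ t⟫_ℝ ∂(timeMeasure T))
    + ⟪(ι†) h, backPrimitive T θ 0⟫_ℝ
  map_add' θ θ' := by
    have hi : ∀ θ : Lp V 2 (timeMeasure T),
        Integrable (fun t => ⟪f t, backPrimitive T θ t⟫_ℝ) (timeMeasure T) := fun θ =>
      integrable_inner_of_memLp hf
        ((isAntideriv_backPrimitive (integrable_of_memLp_two (Lp.memLp θ))).memLp 2)
    rw [backPrimitive_add hT θ θ' ⟨le_rfl, hT⟩, inner_add_right]
    have e : ∫ t, ⟪f t, backPrimitive T (θ + θ' : Lp V 2 (timeMeasure T)) t⟫_ℝ ∂(timeMeasure T)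
        = ∫ t, ⟪f t, backPrimitive T θ t⟫_ℝ + ⟪f t, backPrimitive T θ' t⟫_ℝ ∂(timeMeasure T) := by
      refine setIntegral_congr_fun measurableSet_Ioo fun t ht => ?_
      rw [backPrimitive_add hT θ θ' (Ioo_subset_Icc_self ht), inner_add_right]
    rw [e, integral_add (hi θ) (hi θ')]
    ring
  map_smul' a θ := by
    rw [backPrimitive_smul hT a θ ⟨le_rfl, hT⟩, inner_smul_right]
    have e : ∫ t, ⟪f t, backPrimitive T (a • θ : Lp V 2 (timeMeasure T)) t⟫_ℝ ∂(timeMeasure T)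
        = ∫ t, a * ⟪f t, backPrimitive T θ t⟫_ℝ ∂(timeMeasure T) := by
      refine setIntegral_congr_fun measurableSet_Ioo fun t ht => ?_
      rw [backPrimitive_smul hT a θ (Ioo_subset_Icc_self ht), inner_smul_right]
    rw [e, integral_const_mul, RingHom.id_apply, smul_eq_mul]
    ring

/-- The test operator as a linear map on `L²(0,T;V)`. -/
def lionsTestₗ (hT : 0 ≤ T) (hA : IsCoercive ι T A M α l) :
    Lp V 2 (timeMeasure T) →ₗ[ℝ] Lp V 2 (timeMeasure T) where
  toFun θ := (memLp_lionsTest hA (Lp.memLp θ)).toLp _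
  map_add' θ θ' := by
    rw [← MemLp.toLp_add]
    refine MemLp.toLp_congr _ _ ?_
    filter_upwards [Lp.coeFn_add θ θ', ae_restrict_mem measurableSet_Ioo] with t ht htT
    simp only [lionsTest, Pi.add_apply, ht]
    rw [backPrimitive_add hT θ θ' (Ioo_subset_Icc_self htT)]
    simp only [map_add]
    abel
  map_smul' a θ := by
    rw [RingHom.id_apply, ← MemLp.toLp_const_smul]
    refine MemLp.toLp_congr _ _ ?_
    filter_upwards [Lp.coeFn_smul a θ, ae_restrict_mem measurableSet_Ioo] with t ht htT
    simp only [lionsTest, Pi.smul_apply, ht]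
    rw [backPrimitive_smul hT a θ (Ioo_subset_Icc_self htT)]
    simp only [map_smul, smul_sub]

/-- With φ' = θ and φ(T) = 0, pairing the test operator with φ gives ⟨Aφ, φ⟩ - ½(‖ι φ‖²)'. By the
Gårding inequality, after multiplication by exp(2lt), the defect l‖ι φ‖² and the derivative combine
into ½(exp(2lt)‖ι φ‖²)', which integrates to -½‖ι φ(0)‖². Controlling φ(0) is what lets an initial
value enter the right-hand side. -/
theorem lions_coercive (hT : 0 ≤ T) (hA : IsCoercive ι T A M α l) {θ : ℝ → V}
    (hθ : MemLp θ 2 (timeMeasure T)) :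
    ‖ι (backPrimitive T θ 0)‖ ^ 2 / 2 + α * ∫ t, ‖backPrimitive T θ t‖ ^ 2 ∂(timeMeasure T)
      ≤ Real.exp (2 * l * T) *
        ∫ t, ‖lionsTest ι T A θ t‖ * ‖backPrimitive T θ t‖ ∂(timeMeasure T) := by
  have hl := hA.nonneg
  have hα := hA.pos
  have hφ := isAntideriv_backPrimitive (integrable_of_memLp_two hθ)
  set φ := backPrimitive T θ with hφd
  have hφ2 : MemLp φ 2 (timeMeasure T) := hφ.memLp 2
  have hZ := memLp_lionsTest hA hθ
  have hP := (isAntideriv_exp (T := T) (2 * l)).mul ((hφ.clm_apply ι).inner (hφ.clm_apply ι))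
  have h1 := hP.integral_eq hT
  simp only [hφd, backPrimitive_self] at h1
  simp only [← hφd, map_zero, inner_zero_left, mul_zero, Real.exp_zero, one_mul, zero_sub] at h1
  have hZφ := (integrable_norm_mul_norm hZ hφ2).const_mul (Real.exp (2 * l * T))
  have hφi := (integrable_norm_sq hφ2).const_mul α
  have h2 : ∫ t, α * ‖φ t‖ ^ 2 ∂(timeMeasure T)
      ≤ ∫ t, (Real.exp (2 * l * T) * (‖lionsTest ι T A θ t‖ * ‖φ t‖)
        + 1 / 2 * (2 * l * Real.exp (2 * l * t) * ⟪ι (φ t), ι (φ t)⟫_ℝ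
          + Real.exp (2 * l * t) * (⟪ι (θ t), ι (φ t)⟫_ℝ + ⟪ι (φ t), ι (θ t)⟫_ℝ)))
          ∂(timeMeasure T) := by
    refine integral_mono_ae hφi (hZφ.add (hP.integrable.const_mul _)) ?_
    filter_upwards [hA.coercive, ae_restrict_mem measurableSet_Ioo] with t hco ht
    have q1 := hco (φ t)
    have q2 : ⟪lionsTest ι T A θ t, φ t⟫_ℝ = ⟪A t (φ t), φ t⟫_ℝ - ⟪ι (θ t), ι (φ t)⟫_ℝ := by
      rw [lionsTest, inner_sub_left, inner_adjoint_comp_self, ContinuousLinearMap.adjoint_inner_left,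
        real_inner_comm]
    have q3 := real_inner_le_norm (lionsTest ι T A θ t) (φ t)
    have q4 : 1 ≤ Real.exp (2 * l * t) := Real.one_le_exp (by have := ht.1; positivity)
    have q5 : Real.exp (2 * l * t) ≤ Real.exp (2 * l * T) :=
      Real.exp_le_exp.2 (by have := ht.2.le; gcongr)
    have q6 : Real.exp (2 * l * t) * (‖lionsTest ι T A θ t‖ * ‖φ t‖)
        ≤ Real.exp (2 * l * T) * (‖lionsTest ι T A θ t‖ * ‖φ t‖) := by gcongr
    rw [real_inner_comm (ι (φ t)) (ι (θ t)), real_inner_self_eq_norm_sq]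
    have q7 : α * ‖φ t‖ ^ 2 ≤ Real.exp (2 * l * t) * (α * ‖φ t‖ ^ 2) :=
      le_mul_of_one_le_left (by positivity) q4
    have q8 : α * ‖φ t‖ ^ 2 ≤ ‖lionsTest ι T A θ t‖ * ‖φ t‖ + ⟪ι (θ t), ι (φ t)⟫_ℝ
        + l * ‖ι (φ t)‖ ^ 2 := by linarith
    have q9 := mul_le_mul_of_nonneg_left q8 (Real.exp_pos (2 * l * t)).le
    rw [real_inner_comm] at q9 ⊢
    simp only [hφd] at *
    nlinarith
  rw [integral_add hZφ (hP.integrable.const_mul _), integral_const_mul, integral_const_mul,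
    integral_const_mul, h1, real_inner_self_eq_norm_sq] at h2
  linarith

/-- Existence for the abstract evolution equation. -/
theorem exists_isEvolution (hT : 0 ≤ T) (hA : IsCoercive ι T A M α l)
    (hf : MemLp f 2 (timeMeasure T)) (h : H) :
    ∃ w : ℝ → V, IsEvolution ι T h w (fun t => f t - A t (w t)) := by
  have hα := hA.pos
  set F := √(∫ t, ‖f t‖ ^ 2 ∂(timeMeasure T)) with hF
  set E := Real.exp (2 * l * T) with hE
  -- The right-hand side involves only the L² norm of φ and the value ι φ(0), both controlled by the
  -- test operator through coercivity.
  have hbound : ∀ θ, |lionsRhs (ι := ι) h f hT hf θ|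
      ≤ (F * (E / α) + ‖h‖ * (E * √(2 / α))) * ‖lionsTestₗ hT hA θ‖ := by
    intro θ
    have hφ2 : MemLp (backPrimitive T θ) 2 (timeMeasure T) :=
      (isAntideriv_backPrimitive (integrable_of_memLp_two (Lp.memLp θ))).memLp 2
    have hZ := memLp_lionsTest hA (Lp.memLp θ)
    have hn : ‖lionsTestₗ hT hA θ‖ = √(∫ t, ‖lionsTest ι T A θ t‖ ^ 2 ∂(timeMeasure T)) :=
      norm_toLp_two hZ
    rw [hn]
    set m := √(∫ t, ‖lionsTest ι T A θ t‖ ^ 2 ∂(timeMeasure T))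
    set a := √(∫ t, ‖backPrimitive T θ t‖ ^ 2 ∂(timeMeasure T)) with ha
    have h1 := lions_coercive hT hA (Lp.memLp θ)
    have h2 := integral_norm_mul_norm_le hZ hφ2
    have h3 : a ^ 2 = ∫ t, ‖backPrimitive T θ t‖ ^ 2 ∂(timeMeasure T) :=
      Real.sq_sqrt (integral_nonneg fun _ => sq_nonneg _)
    rw [← h3] at h1
    obtain ⟨h4, h5⟩ := le_of_quadratic_le hα (Real.sqrt_nonneg _)
      (Real.sqrt_nonneg _) (Real.exp_pos _).le
      (h1.trans (mul_le_mul_of_nonneg_left h2 (Real.exp_pos _).le))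
    have h6 : |∫ t, ⟪f t, backPrimitive T θ t⟫_ℝ ∂(timeMeasure T)| ≤ F * a := by
      refine (abs_integral_le_integral_abs).trans (le_trans ?_ (integral_norm_mul_norm_le hf hφ2))
      exact integral_mono (integrable_inner_of_memLp hf hφ2).abs (integrable_norm_mul_norm hf hφ2)
        fun t => abs_real_inner_le_norm _ _
    have h7 : |⟪(ι†) h, backPrimitive T θ 0⟫_ℝ| ≤ ‖h‖ * ‖ι (backPrimitive T θ 0)‖ := by
      rw [ContinuousLinearMap.adjoint_inner_left]
      exact abs_real_inner_le_norm _ _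
    calc |lionsRhs (ι := ι) h f hT hf θ| ≤ F * a + ‖h‖ * ‖ι (backPrimitive T θ 0)‖ :=
          (abs_add_le _ _).trans (add_le_add h6 h7)
      _ ≤ F * (E / α * m) + ‖h‖ * (E * √(2 / α) * m) :=
          add_le_add (mul_le_mul_of_nonneg_left h4 (Real.sqrt_nonneg _))
            (mul_le_mul_of_nonneg_left h5 (norm_nonneg _))
      _ = _ := by ring
  obtain ⟨w, hw⟩ := exists_inner_eq_of_abs_le _ _ hbound
  have hw2 : MemLp w 2 (timeMeasure T) := Lp.memLp w
  have hg2 : MemLp (fun t => f t - A t (w t)) 2 (timeMeasure T) := hf.sub (hA.memLp_apply hw2)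
  refine ⟨w, hw2, hg2, ?_⟩
  set g : ℝ → V := fun t => f t - A t (w t) with hg
  have hGa := isAntideriv_integral (integrable_of_memLp_two hg2) 0
  set G : ℝ → V := fun t => 0 + ∫ s in (0 : ℝ)..t, g s with hG
  have hG2 : MemLp G 2 (timeMeasure T) := hGa.memLp 2
  have hS2 : MemLp (fun t => (ι†) (ι (w t))) 2 (timeMeasure T) := ((ι†) ∘L ι).comp_memLp' hw2
  have hfin : IsFiniteMeasure (timeMeasure T) := inferInstance
  have hh2 : MemLp (fun _ => (ι†) h) 2 (timeMeasure T) := memLp_const _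
  have hD2 : MemLp (fun t => (ι†) (ι (w t)) - (ι†) h - G t) 2 (timeMeasure T) :=
    (hS2.sub hh2).sub hG2
  -- The variational identity, integrated by parts against the primitive `G` of the right-hand side,
  -- says that the defect of the integrated equation is orthogonal to all of L²(0,T;V).
  have hmain : ∀ θ : Lp V 2 (timeMeasure T),
      ∫ t, ⟪(ι†) (ι (w t)) - (ι†) h - G t, θ t⟫_ℝ ∂(timeMeasure T) = 0 := by
    intro θ
    have hθ2 := Lp.memLp θ
    have hφ := isAntideriv_backPrimitive (integrable_of_memLp_two hθ2)
    have hφ2 := hφ.memLp 2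
    have hZ := memLp_lionsTest hA hθ2
    have e1 := hw θ
    have e2 : ⟪lionsTestₗ hT hA θ, w⟫_ℝ = ∫ t, (⟪A t (w t), backPrimitive T θ t⟫_ℝ
        - ⟪(ι†) (ι (w t)), θ t⟫_ℝ) ∂(timeMeasure T) := by
      rw [L2.inner_def]
      refine integral_congr_ae ?_
      filter_upwards [hZ.coeFn_toLp] with t ht
      have : lionsTestₗ hT hA θ t = lionsTest ι T A θ t := ht
      rw [this, lionsTest, inner_sub_left, ContinuousLinearMap.adjoint_inner_left,
        inner_adjoint_comp_self, inner_adjoint_comp_self, real_inner_comm, real_inner_comm (ι (θ t))]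
    have e3 : lionsRhs (ι := ι) h f hT hf θ = (∫ t, ⟪f t, backPrimitive T θ t⟫_ℝ ∂(timeMeasure T))
        - ∫ t, ⟪(ι†) h, θ t⟫_ℝ ∂(timeMeasure T) := by
      change (∫ t, ⟪f t, backPrimitive T θ t⟫_ℝ ∂(timeMeasure T)) + ⟪(ι†) h, backPrimitive T θ 0⟫_ℝ = _
      -- The value of the test primitive at 0 is minus the integral of θ, so the initial datum
      -- becomes a time integral against θ.
      rw [backPrimitive_zero, inner_neg_right, intervalIntegral_eq_timeMeasure hT,
        integral_inner (integrable_of_memLp_two hθ2)]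
      ring
    have iA := integrable_inner_of_memLp (hA.memLp_apply hw2) hφ2
    have iS := integrable_inner_of_memLp hS2 hθ2
    have ih := integrable_inner_of_memLp hh2 hθ2
    have iG := integrable_inner_of_memLp hG2 hθ2
    have if' := integrable_inner_of_memLp hf hφ2
    have e4 : ∫ t, (⟪g t, backPrimitive T θ t⟫_ℝ + ⟪G t, θ t⟫_ℝ) ∂(timeMeasure T) = 0 := by
      refine ((hGa.inner hφ).integral_eq hT).trans ?_
      have hG0 : G 0 = 0 := by simp [hG]
      simp [backPrimitive_self, hG0]
    have e5 : ∫ t, (⟪f t, backPrimitive T θ t⟫_ℝ - ⟪A t (w t), backPrimitive T θ t⟫_ℝ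
        + ⟪G t, θ t⟫_ℝ) ∂(timeMeasure T) = 0 := by
      rw [← e4]
      refine integral_congr_ae (Eventually.of_forall fun t => ?_)
      simp only [hg, inner_sub_left]
    have iD : Integrable (fun t => ⟪f t, backPrimitive T θ t⟫_ℝ
        - ⟪A t (w t), backPrimitive T θ t⟫_ℝ) (timeMeasure T) := if'.sub iA
    have iD' : Integrable (fun t => ⟪(ι†) (ι (w t)), θ t⟫_ℝ - ⟪(ι†) h, θ t⟫_ℝ) (timeMeasure T) :=
      iS.sub ih
    rw [integral_add iD iG, integral_sub if' iA] at e5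
    rw [e2, e3, integral_sub iA iS] at e1
    have e6 : ∫ t, ⟪(ι†) (ι (w t)) - (ι†) h - G t, θ t⟫_ℝ ∂(timeMeasure T)
        = ∫ t, (⟪(ι†) (ι (w t)), θ t⟫_ℝ - ⟪(ι†) h, θ t⟫_ℝ - ⟪G t, θ t⟫_ℝ) ∂(timeMeasure T) := by
      simp only [inner_sub_left]
    rw [e6, integral_sub iD' iG, integral_sub iS ih]
    linarith
  -- The defect itself is an admissible θ.
  have hD := hmain (hD2.toLp _)
  have hD' : ∫ t, ‖(ι†) (ι (w t)) - (ι†) h - G t‖ ^ 2 ∂(timeMeasure T) = 0 := by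
    rw [← hD]
    refine integral_congr_ae ?_
    filter_upwards [hD2.coeFn_toLp] with t ht
    rw [ht, real_inner_self_eq_norm_sq]
  rw [integral_eq_zero_iff_of_nonneg (fun _ => sq_nonneg _) (integrable_norm_sq hD2)] at hD'
  filter_upwards [hD'] with t ht
  simp only [Pi.zero_apply, ne_eq, OfNat.ofNat_ne_zero, not_false_eq_true, pow_eq_zero_iff,
    norm_eq_zero] at ht
  rw [sub_sub, sub_eq_zero] at ht
  rw [ht]
  simp only [hG, zero_add]

end Existence

end Evolution

end FokkerPlanck

namespace FokkerPlanck

/-! ### Weak time derivatives -/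

section WeakDerivative

variable {T : ℝ}

theorem IsTestFunction.isAntideriv {ψ : ℝ → ℝ} (hψ : IsTestFunction (Ioo 0 T) ψ) :
    IsAntideriv T ψ (deriv ψ) :=
  isAntideriv_of_hasDerivAt
    (fun t => (hψ.1.differentiable (by simp)).differentiableAt.hasDerivAt)
    (hψ.1.continuous_deriv (by simp))

theorem IsTestFunction.apply_eq_zero {V : Type*} [NormedAddCommGroup V] [NormedSpace ℝ V] {U : Set V}
    {φ : V → ℝ} (hφ : IsTestFunction U φ) {x : V} (hx : x ∉ U) : φ x = 0 :=
  image_eq_zero_of_notMem_tsupport fun h => hx (hφ.2.2 h)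

theorem IsTestFunction.add {V : Type*} [NormedAddCommGroup V] [NormedSpace ℝ V] {U : Set V}
    {φ φ' : V → ℝ} (hφ : IsTestFunction U φ) (hφ' : IsTestFunction U φ') :
    IsTestFunction U (φ + φ') :=
  ⟨hφ.1.add hφ'.1, hφ.2.1.add hφ'.2.1,
    (tsupport_add φ φ').trans (union_subset hφ.2.2 hφ'.2.2)⟩

theorem IsTestFunction.const_mul {V : Type*} [NormedAddCommGroup V] [NormedSpace ℝ V] {U : Set V}
    {φ : V → ℝ} (hφ : IsTestFunction U φ) (a : ℝ) : IsTestFunction U (fun x => a * φ x) :=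
  ⟨contDiff_const.mul hφ.1, hφ.2.1.mul_left, (tsupport_mul_subset_right).trans hφ.2.2⟩

/-- A test function on `(0,T)` with vanishing integral is the derivative of a test function. -/
theorem exists_deriv_eq_of_integral_eq_zero (hT : 0 < T) {f : ℝ → ℝ}
    (hf : IsTestFunction (Ioo 0 T) f) (h0 : ∫ t, f t = 0) :
    ∃ ψ, IsTestFunction (Ioo 0 T) ψ ∧ deriv ψ = f := by
  -- Adding the midpoint keeps the compact set nonempty even when `f` is zero, so that it has least
  -- and greatest elements.
  have hK : IsCompact (insert (T / 2) (tsupport f)) := hf.2.1.isCompact.insert _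
  have hKsub : insert (T / 2) (tsupport f) ⊆ Ioo 0 T :=
    insert_subset ⟨by linarith, by linarith⟩ hf.2.2
  obtain ⟨a, ha, ha'⟩ := hK.exists_isLeast (insert_nonempty _ _)
  obtain ⟨b, hb, hb'⟩ := hK.exists_isGreatest (insert_nonempty _ _)
  have hsupp : ∀ t, f t ≠ 0 → t ∈ Icc a b := fun t ht =>
    have : t ∈ insert (T / 2) (tsupport f) := mem_insert_of_mem _ (subset_tsupport f ht)
    ⟨ha' this, hb' this⟩
  have ha0 := hKsub ha
  have hb0 := hKsub hb
  set ψ : ℝ → ℝ := fun t => ∫ s in (0 : ℝ)..t, f s with hψ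
  have hd : ∀ t, HasDerivAt ψ (f t) t := fun t =>
    intervalIntegral.integral_hasDerivAt_right (hf.1.continuous.intervalIntegrable _ _)
      (hf.1.continuous.stronglyMeasurableAtFilter _ _) hf.1.continuous.continuousAt
  have hderiv : deriv ψ = f := funext fun t => (hd t).deriv
  -- Left of `a` the integrand has not started; right of `b` the integral is already the full one,
  -- which vanishes.
  have hz : ∀ t, t ∉ Icc a b → ψ t = 0 := by
    intro t ht
    rcases lt_or_ge t a with hta | hta
    · refine (intervalIntegral.integral_congr (g := fun _ => (0 : ℝ)) fun s hs => ?_).trans (by simp)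
      by_contra h
      have h1 := (hsupp s h).1
      rcases mem_uIcc.1 hs with h2 | h2
      · linarith [h2.2]
      · linarith [h2.2, ha0.1]
    · have hbt : b < t := not_le.1 fun h => ht ⟨hta, h⟩
      refine (intervalIntegral.integral_eq_integral_of_support_subset fun s hs => ?_).trans h0
      have h1 := hsupp s hs
      exact ⟨ha0.1.trans_le h1.1, h1.2.trans hbt.le⟩
  refine ⟨ψ, ⟨?_, HasCompactSupport.intro isCompact_Icc hz, ?_⟩, hderiv⟩
  · rw [contDiff_infty_iff_deriv, hderiv]
    exact ⟨fun t => (hd t).differentiableAt, hf.1⟩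
  · refine (closure_minimal (fun t ht => ?_) isClosed_Icc).trans
      (Icc_subset_Ioo ha0.1 hb0.2)
    by_contra h
    exact ht (hz t h)

theorem exists_isTestFunction_integral_eq_one (hT : 0 < T) :
    ∃ η : ℝ → ℝ, IsTestFunction (Ioo 0 T) η ∧ ∫ t, η t = 1 := by
  let B : ContDiffBump (T / 2) := ⟨T / 8, T / 4, by positivity, by linarith⟩
  refine ⟨B.normed volume, ⟨B.contDiff_normed, B.hasCompactSupport_normed, ?_⟩, B.integral_normed⟩
  rw [B.tsupport_normed_eq, Real.closedBall_eq_Icc]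
  refine Icc_subset_Ioo ?_ ?_
  · change 0 < T / 2 - T / 4
    linarith
  · change T / 2 + T / 4 < T
    linarith

theorem IsTestFunction.setIntegral_eq {E : Type*} [NormedAddCommGroup E] [NormedSpace ℝ E]
    {V : Type*} [NormedAddCommGroup V] [NormedSpace ℝ V] [MeasurableSpace V] {μ : Measure V}
    {U : Set V} {φ : V → ℝ} (hφ : IsTestFunction U φ) (X : V → E) :
    ∫ x in U, φ x • X x ∂μ = ∫ x, φ x • X x ∂μ :=
  setIntegral_eq_integral_of_forall_compl_eq_zero fun x hx => by
    rw [hφ.apply_eq_zero hx, zero_smul]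

theorem IsTestFunction.integrable_smul {E : Type*} [NormedAddCommGroup E] [NormedSpace ℝ E]
    {X : ℝ → E} (hX : Integrable X (timeMeasure T)) {ψ : ℝ → ℝ} (hψ : Continuous ψ)
    (hψ' : HasCompactSupport ψ) : Integrable (fun t => ψ t • X t) (timeMeasure T) := by
  obtain ⟨C, hC⟩ := hψ.bounded_above_of_compact_support hψ'
  exact hX.bdd_smul C hψ.aestronglyMeasurable (Eventually.of_forall hC)

/-- The lemma of du Bois-Reymond. -/
theorem exists_ae_eq_const_of_integral_deriv_smul_eq_zero {E : Type*} [NormedAddCommGroup E]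
    [NormedSpace ℝ E] [CompleteSpace E] (hT : 0 < T) {X : ℝ → E}
    (hX : Integrable X (timeMeasure T))
    (h : ∀ ψ, IsTestFunction (Ioo 0 T) ψ → ∫ t, deriv ψ t • X t ∂(timeMeasure T) = 0) :
    ∃ k, ∀ᵐ t ∂(timeMeasure T), X t = k := by
  obtain ⟨η, hη, hη1⟩ := exists_isTestFunction_integral_eq_one hT
  set k := ∫ t, η t • X t ∂(timeMeasure T) with hk
  have key : ∀ θ : ℝ → ℝ, IsTestFunction (Ioo 0 T) θ →
      ∫ t, θ t • (X t - k) ∂(timeMeasure T) = 0 := by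
    intro θ hθ
    -- Subtracting (∫θ)η leaves integral zero, so the result is the derivative of a test function.
    -- The subtracted part contributes (∫θ)k, which identifies the constant.
    have hm : IsTestFunction (Ioo 0 T) (θ + fun t => (-∫ s, θ s) * η t) :=
      hθ.add (hη.const_mul _)
    have hθi : Integrable θ volume := hθ.1.continuous.integrable_of_hasCompactSupport hθ.2.1
    have hηi : Integrable η volume := hη.1.continuous.integrable_of_hasCompactSupport hη.2.1
    obtain ⟨ψ, hψ, hψ'⟩ := exists_deriv_eq_of_integral_eq_zero hT hm (by
      simp only [Pi.add_apply]
      rw [integral_add hθi (hηi.const_mul _), integral_const_mul, hη1]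
      ring)
    have h1 := h ψ hψ
    rw [hψ'] at h1
    have i1 := IsTestFunction.integrable_smul hX hθ.1.continuous hθ.2.1
    have i2 := IsTestFunction.integrable_smul hX hη.1.continuous hη.2.1
    have i3 : Integrable (fun t => θ t • k) (timeMeasure T) :=
      (hθi.mono_measure Measure.restrict_le_self).smul_const k
    simp only [Pi.add_apply, add_smul, mul_smul] at h1
    have i2' : Integrable (fun t => (-∫ s, θ s) • η t • X t) (timeMeasure T) := i2.smul _
    rw [integral_add i1 i2', integral_smul, ← hk] at h1
    simp only [smul_sub]
    have e : ∫ t, θ t ∂(timeMeasure T) = ∫ t, θ t := by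
      have := hθ.setIntegral_eq (μ := volume) (fun _ => (1 : ℝ))
      simpa using this
    rw [integral_sub i1 i3, integral_smul_const, e]
    rw [neg_smul, ← sub_eq_add_neg] at h1
    exact h1
  refine ⟨k, ?_⟩
  have hXk : IntegrableOn (fun t => X t - k) (Ioo 0 T) :=
    hX.sub (integrable_const (μ := timeMeasure T) k)
  have := isOpen_Ioo.ae_eq_zero_of_integral_contDiff_smul_eq_zero (U := Ioo 0 T)
    hXk.locallyIntegrableOn fun θ h1 h2 h3 => by
      have hθ : IsTestFunction (Ioo 0 T) θ := ⟨h1, h2, h3⟩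
      rw [← hθ.setIntegral_eq]
      exact key θ hθ
  refine (ae_restrict_iff' measurableSet_Ioo).2 ?_
  filter_upwards [this] with t ht htT
  exact sub_eq_zero.1 (ht htT)

end WeakDerivative

/-! ### Weak and integrated forms of the evolution equation -/

section Evolution

variable {V H : Type*} [NormedAddCommGroup V] [InnerProductSpace ℝ V] [CompleteSpace V]
  [NormedAddCommGroup H] [InnerProductSpace ℝ H] [CompleteSpace H] {ι : V →L[ℝ] H}
  {T : ℝ} {h : H} {w g : ℝ → V}

theorem IsAntideriv.integral_inner_mul_deriv {X x : ℝ → V} (hT : 0 < T) (hX : IsAntideriv T X x)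
    (v : V) {ψ : ℝ → ℝ} (hψ : IsTestFunction (Ioo 0 T) ψ) :
    ∫ t, ⟪X t, v⟫_ℝ * deriv ψ t ∂(timeMeasure T)
      = -∫ t, ⟪x t, v⟫_ℝ * ψ t ∂(timeMeasure T) := by
  have hXv := hX.clm_apply ((innerSL ℝ).flip v)
  have h1 := (hXv.mul hψ.isAntideriv).integral_eq hT.le
  rw [hψ.apply_eq_zero (x := T) (by simp), hψ.apply_eq_zero (x := 0) (by simp), mul_zero, mul_zero,
    sub_zero] at h1
  have i1 : Integrable (fun t => ⟪x t, v⟫_ℝ * ψ t) (timeMeasure T) := by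
    refine (IsTestFunction.integrable_smul hXv.integrable hψ.1.continuous hψ.2.1).congr
      (Eventually.of_forall fun t => ?_)
    exact mul_comm (ψ t) ⟪x t, v⟫_ℝ
  have i2 : Integrable (fun t => ⟪X t, v⟫_ℝ * deriv ψ t) (timeMeasure T) := by
    refine (IsTestFunction.integrable_smul (memLp_one_iff_integrable.1 (hXv.memLp 1))
      (hψ.1.continuous_deriv (by simp)) hψ.2.1.deriv).congr (Eventually.of_forall fun t => ?_)
    exact mul_comm (deriv ψ t) ⟪X t, v⟫_ℝ
  have h2 : ∫ t, (⟪x t, v⟫_ℝ * ψ t + ⟪X t, v⟫_ℝ * deriv ψ t) ∂(timeMeasure T) = 0 := h1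
  rw [integral_add i1 i2] at h2
  linarith

/-- `(ι w)' = g` on `(0,T)` in the sense of distributions. -/
def HasWeakDeriv (ι : V →L[ℝ] H) (T : ℝ) (w g : ℝ → V) : Prop :=
  ∀ v : V, ∀ ψ : ℝ → ℝ, IsTestFunction (Ioo 0 T) ψ →
    ∫ t, ⟪ι (w t), ι v⟫_ℝ * deriv ψ t ∂(timeMeasure T) = -∫ t, ⟪g t, v⟫_ℝ * ψ t ∂(timeMeasure T)

theorem hasWeakDeriv_of_ae_eq {k : V} (hT : 0 < T) (hg : Integrable g (timeMeasure T))
    (hw : ∀ᵐ t ∂(timeMeasure T), (ι†) (ι (w t)) = k + ∫ s in (0 : ℝ)..t, g s) :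
    HasWeakDeriv ι T w g := by
  intro v ψ hψ
  rw [← (isAntideriv_integral hg k).integral_inner_mul_deriv hT v hψ]
  refine integral_congr_ae ?_
  filter_upwards [hw] with t ht
  rw [← ht, inner_adjoint_comp_self]

theorem IsEvolution.hasWeakDeriv (hT : 0 < T) (hw : IsEvolution ι T h w g) :
    HasWeakDeriv ι T w g :=
  hasWeakDeriv_of_ae_eq hT (integrable_of_memLp_two hw.memLp_deriv) hw.eq_integral

/-- The function ι† ι w minus the primitive of `g` has vanishing distributional derivative, so it is
constant by du Bois-Reymond. Pairing with each `v` reduces the vector-valued statement to the scalar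
weak equation. -/
theorem HasWeakDeriv.exists_ae_eq (hT : 0 < T) (hw : MemLp w 2 (timeMeasure T))
    (hg : Integrable g (timeMeasure T)) (hwg : HasWeakDeriv ι T w g) :
    ∃ k, ∀ᵐ t ∂(timeMeasure T), (ι†) (ι (w t)) = k + ∫ s in (0 : ℝ)..t, g s := by
  have hG := isAntideriv_integral hg 0
  have hSi : Integrable (fun t => (ι†) (ι (w t))) (timeMeasure T) :=
    integrable_of_memLp_two (((ι†) ∘L ι).comp_memLp' hw)
  have hGi := memLp_one_iff_integrable.1 (hG.memLp 1)
  obtain ⟨k, hk⟩ := exists_ae_eq_const_of_integral_deriv_smul_eq_zero hT (hSi.sub hGi) (by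
    intro ψ hψ
    have hc : Continuous (deriv ψ) := hψ.1.continuous_deriv (by simp)
    have hi := IsTestFunction.integrable_smul (hSi.sub hGi) hc hψ.2.1.deriv
    refine ext_inner_right ℝ fun v => ?_
    rw [inner_zero_left, real_inner_comm, ← integral_inner hi]
    have h1 := hwg v ψ hψ
    rw [← hG.integral_inner_mul_deriv hT v hψ] at h1
    have i1 : Integrable (fun t => ⟪ι (w t), ι v⟫_ℝ * deriv ψ t) (timeMeasure T) := by
      have := (IsTestFunction.integrable_smul hSi hc hψ.2.1.deriv).inner_const (𝕜 := ℝ) v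
      simpa [inner_smul_left, mul_comm, ContinuousLinearMap.adjoint_inner_left] using this
    have i2 : Integrable (fun t => ⟪(0 : V) + ∫ s in (0 : ℝ)..t, g s, v⟫_ℝ * deriv ψ t)
        (timeMeasure T) := by
      have := (IsTestFunction.integrable_smul hGi hc hψ.2.1.deriv).inner_const (𝕜 := ℝ) v
      refine this.congr (Eventually.of_forall fun t => ?_)
      simp [inner_smul_left, mul_comm]
    rw [← sub_eq_zero, ← integral_sub i1 i2] at h1
    refine (integral_congr_ae (Eventually.of_forall fun t => ?_)).trans h1
    simp only [Pi.sub_apply]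
    rw [real_inner_comm, inner_smul_left, inner_sub_left, inner_adjoint_comp_self, conj_trivial]
    ring)
  refine ⟨k, ?_⟩
  filter_upwards [hk] with t ht
  rw [← ht]
  simp

theorem eqOn_Icc_of_ae_eq {E : Type*} [TopologicalSpace E] [T2Space E] (hT : 0 < T) {X Y : ℝ → E}
    (hX : ContinuousOn X (Icc 0 T)) (hY : ContinuousOn Y (Icc 0 T))
    (h : X =ᵐ[timeMeasure T] Y) : EqOn X Y (Icc 0 T) := by
  have h1 : EqOn X Y (Ioo 0 T) :=
    Measure.eqOn_open_of_ae_eq h isOpen_Ioo (hX.mono Ioo_subset_Icc_self)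
      (hY.mono Ioo_subset_Icc_self)
  rw [← closure_Ioo hT.ne] at hX hY ⊢
  exact h1.of_subset_closure hX hY subset_closure subset_rfl

/-- `c` is a continuous `H`-valued representative of `ι w` on `[0,T]`. -/
structure IsContRepr (ι : V →L[ℝ] H) (T : ℝ) (w : ℝ → V) (c : ℝ → H) : Prop where
  continuousOn : ContinuousOn c (Icc 0 T)
  ae_eq : ∀ᵐ t ∂(timeMeasure T), c t = ι (w t)

theorem IsContRepr.eqOn (hT : 0 < T) {c c' : ℝ → H} (hc : IsContRepr ι T w c)
    (hc' : IsContRepr ι T w c') : EqOn c c' (Icc 0 T) :=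
  eqOn_Icc_of_ae_eq hT hc.continuousOn hc'.continuousOn (by
    filter_upwards [hc.ae_eq, hc'.ae_eq] with t h1 h2
    rw [h1, h2])

/-- Both sides are continuous on `[0,T]`, so the identity holds everywhere, in particular at the
endpoints where initial and terminal values are read off. -/
theorem adjoint_apply_eq (hT : 0 < T) {k : V} (hg : Integrable g (timeMeasure T)) {c : ℝ → H}
    (hc : IsContRepr ι T w c)
    (hw : ∀ᵐ t ∂(timeMeasure T), (ι†) (ι (w t)) = k + ∫ s in (0 : ℝ)..t, g s) :
    ∀ t ∈ Icc 0 T, (ι†) (c t) = k + ∫ s in (0 : ℝ)..t, g s :=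
  eqOn_Icc_of_ae_eq hT ((ι†).continuous.comp_continuousOn hc.continuousOn)
    (isAntideriv_integral hg k).continuousOn (by
      filter_upwards [hw, hc.ae_eq] with t h1 h2
      rw [← h1, ← h2])

/-- The weak form of the evolution equation determines the integrated form. -/
theorem HasWeakDeriv.isEvolution (hT : 0 < T) (hw : MemLp w 2 (timeMeasure T))
    (hg : MemLp g 2 (timeMeasure T)) (hwg : HasWeakDeriv ι T w g) {c : ℝ → H}
    (hc : IsContRepr ι T w c) : IsEvolution ι T (c 0) w g := by
  obtain ⟨k, hk⟩ := hwg.exists_ae_eq hT hw (integrable_of_memLp_two hg)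
  -- Evaluation at 0 identifies the constant of integration with ι† applied to the initial value.
  have h1 := adjoint_apply_eq hT (integrable_of_memLp_two hg) hc hk 0 ⟨le_rfl, hT.le⟩
  rw [intervalIntegral.integral_same, add_zero] at h1
  rw [← h1] at hk
  exact ⟨hw, hg, hk⟩

namespace IsEvolution

theorem congr {w' g' : ℝ → V} (hw : IsEvolution ι T h w g) (h1 : w =ᵐ[timeMeasure T] w')
    (h2 : g =ᵐ[timeMeasure T] g') : IsEvolution ι T h w' g' where
  memLp := hw.memLp.ae_eq h1
  memLp_deriv := hw.memLp_deriv.ae_eq h2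
  eq_integral := by
    filter_upwards [hw.eq_integral, h1, ae_restrict_mem measurableSet_Ioo] with t q1 q2 q3
    rw [← q2, q1, intervalIntegral_congr_of_ae h2 (Ioo_subset_Icc_self q3)]

theorem add {h' : H} {w' g' : ℝ → V} (hw : IsEvolution ι T h w g)
    (hw' : IsEvolution ι T h' w' g') :
    IsEvolution ι T (h + h') (fun t => w t + w' t) (fun t => g t + g' t) where
  memLp := hw.memLp.add hw'.memLp
  memLp_deriv := hw.memLp_deriv.add hw'.memLp_deriv
  eq_integral := by
    filter_upwards [hw.eq_integral, hw'.eq_integral, ae_restrict_mem measurableSet_Ioo]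
      with t q1 q2 q3
    have h0 : (0 : ℝ) ∈ Icc 0 T := ⟨le_rfl, (q3.1.trans q3.2).le⟩
    rw [intervalIntegral.integral_add
      (intervalIntegrable_of_mem (integrable_of_memLp_two hw.memLp_deriv) h0
        (Ioo_subset_Icc_self q3))
      (intervalIntegrable_of_mem (integrable_of_memLp_two hw'.memLp_deriv) h0
        (Ioo_subset_Icc_self q3)), map_add, map_add, map_add, q1, q2]
    abel

theorem neg (hw : IsEvolution ι T h w g) :
    IsEvolution ι T (-h) (fun t => -w t) (fun t => -g t) where
  memLp := hw.memLp.neg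
  memLp_deriv := hw.memLp_deriv.neg
  eq_integral := by
    filter_upwards [hw.eq_integral] with t q1
    rw [intervalIntegral.integral_neg, map_neg, map_neg, map_neg, q1]
    abel

theorem sub {h' : H} {w' g' : ℝ → V} (hw : IsEvolution ι T h w g)
    (hw' : IsEvolution ι T h' w' g') :
    IsEvolution ι T (h - h') (fun t => w t - w' t) (fun t => g t - g' t) := by
  simpa only [sub_eq_add_neg] using hw.add hw'.neg

theorem exists_isContRepr (hι : Function.Injective ι) (hι' : Function.Injective (ι†))
    (hT : 0 ≤ T) (hw : IsEvolution ι T h w g) : ∃ c, IsContRepr ι T w c ∧ c 0 = h := by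
  obtain ⟨c, h1, h2, h3, -⟩ := hw.exists_continuousOn hι hι' hT
  exact ⟨c, ⟨h1, h2⟩, h3⟩

/-- The integrated equation determines the initial value only after ι†; injectivity of ι† recovers
it. -/
theorem apply_zero_eq (hι' : Function.Injective (ι†)) (hT : 0 < T) (hw : IsEvolution ι T h w g)
    {c : ℝ → H} (hc : IsContRepr ι T w c) : c 0 = h := by
  have h1 := adjoint_apply_eq hT (integrable_of_memLp_two hw.memLp_deriv) hc hw.eq_integral 0
    ⟨le_rfl, hT.le⟩
  rw [intervalIntegral.integral_same, add_zero] at h1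
  exact hι' h1

theorem isAntideriv_norm_sq (hι : Function.Injective ι) (hι' : Function.Injective (ι†))
    (hT : 0 < T) (hw : IsEvolution ι T h w g) {c : ℝ → H} (hc : IsContRepr ι T w c) :
    IsAntideriv T (fun t => ‖c t‖ ^ 2) (fun t => 2 * ⟪g t, w t⟫_ℝ) := by
  obtain ⟨c', h1, h2, h3, h4⟩ := hw.exists_continuousOn hι hι' hT.le
  have heq := hc.eqOn hT ⟨h1, h2⟩
  refine ⟨h4.integrable, fun t ht => ?_⟩
  rw [heq ht, heq ⟨le_rfl, hT.le⟩]
  exact h4.eq_integral t ht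

/-- Integration by parts for two elements of `W(0,T)`. -/
theorem integral_inner_add_inner (hι : Function.Injective ι) (hι' : Function.Injective (ι†))
    (hT : 0 < T) {h' : H} {w' g' : ℝ → V} {c c' : ℝ → H} (hw : IsEvolution ι T h w g)
    (hw' : IsEvolution ι T h' w' g') (hc : IsContRepr ι T w c) (hc' : IsContRepr ι T w' c') :
    (∫ t, ⟪g t, w' t⟫_ℝ ∂(timeMeasure T)) + ∫ t, ⟪g' t, w t⟫_ℝ ∂(timeMeasure T)
      = ⟪c T, c' T⟫_ℝ - ⟪c 0, c' 0⟫_ℝ := by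
  have hcc : IsContRepr ι T (fun t => w t + w' t) (fun t => c t + c' t) :=
    ⟨hc.continuousOn.add hc'.continuousOn, by
      filter_upwards [hc.ae_eq, hc'.ae_eq] with t q1 q2
      rw [q1, q2, map_add]⟩
  -- Polarization: the energy identities of `w`, `w'` and `w + w'` are combined.
  have e1 := (hw.isAntideriv_norm_sq hι hι' hT hc).integral_eq hT.le
  have e2 := (hw'.isAntideriv_norm_sq hι hι' hT hc').integral_eq hT.le
  have e3 := ((hw.add hw').isAntideriv_norm_sq hι hι' hT hcc).integral_eq hT.le
  simp only [norm_add_sq_real] at e3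
  have i1 := integrable_inner_of_memLp hw.memLp_deriv hw.memLp
  have i2 := integrable_inner_of_memLp hw.memLp_deriv hw'.memLp
  have i3 := integrable_inner_of_memLp hw'.memLp_deriv hw.memLp
  have i4 := integrable_inner_of_memLp hw'.memLp_deriv hw'.memLp
  have e4 : ∫ t, 2 * ⟪g t + g' t, w t + w' t⟫_ℝ ∂(timeMeasure T)
      = 2 * (((∫ t, ⟪g t, w t⟫_ℝ ∂(timeMeasure T)) + ∫ t, ⟪g t, w' t⟫_ℝ ∂(timeMeasure T))
        + ((∫ t, ⟪g' t, w t⟫_ℝ ∂(timeMeasure T)) + ∫ t, ⟪g' t, w' t⟫_ℝ ∂(timeMeasure T))) := by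
    have i5 : Integrable (fun t => ⟪g t, w t⟫_ℝ + ⟪g t, w' t⟫_ℝ) (timeMeasure T) := i1.add i2
    have i6 : Integrable (fun t => ⟪g' t, w t⟫_ℝ + ⟪g' t, w' t⟫_ℝ) (timeMeasure T) := i3.add i4
    rw [integral_const_mul, ← integral_add i1 i2, ← integral_add i3 i4, ← integral_add i5 i6]
    simp only [inner_add_left, inner_add_right]
    congr 1
    refine integral_congr_ae (Eventually.of_forall fun t => ?_)
    simp only
    ring
  rw [integral_const_mul] at e1 e2
  rw [e4] at e3
  linarith

end IsEvolution

theorem measurePreserving_sub_left_timeMeasure (T : ℝ) :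
    MeasurePreserving (fun t => T - t) (timeMeasure T) (timeMeasure T) := by
  have h := (volume.measurePreserving_sub_left T).restrict_preimage
    (measurableSet_Ioo (a := (0 : ℝ)) (b := T))
  have e : (fun t => T - t) ⁻¹' Ioo 0 T = Ioo 0 T := by
    ext t
    simp only [mem_preimage, mem_Ioo]
    constructor <;> rintro ⟨h1, h2⟩ <;> constructor <;> linarith
  rwa [e] at h

theorem IsContRepr.reverse {c : ℝ → H} (hc : IsContRepr ι T w c) :
    IsContRepr ι T (fun t => w (T - t)) (fun t => c (T - t)) where
  continuousOn := hc.continuousOn.comp (by fun_prop) fun t ht =>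
    ⟨by linarith [ht.2], by linarith [ht.1]⟩
  ae_eq := (measurePreserving_sub_left_timeMeasure T).quasiMeasurePreserving.ae hc.ae_eq

/-- Time reversal of an evolution equation. -/
theorem IsEvolution.reverse (hT : 0 < T) (hw : IsEvolution ι T h w g) {c : ℝ → H}
    (hc : IsContRepr ι T w c) :
    IsEvolution ι T (c T) (fun t => w (T - t)) (fun t => -g (T - t)) where
  memLp := hw.memLp.comp_measurePreserving (measurePreserving_sub_left_timeMeasure T)
  memLp_deriv := (hw.memLp_deriv.comp_measurePreserving
    (measurePreserving_sub_left_timeMeasure T)).neg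
  eq_integral := by
    have hgi := integrable_of_memLp_two hw.memLp_deriv
    have hTT : T ∈ Icc 0 T := ⟨hT.le, le_rfl⟩
    have h0T : (0 : ℝ) ∈ Icc 0 T := ⟨le_rfl, hT.le⟩
    have h1 := adjoint_apply_eq hT hgi hc hw.eq_integral T hTT
    filter_upwards [(measurePreserving_sub_left_timeMeasure T).quasiMeasurePreserving.ae
      hw.eq_integral, ae_restrict_mem measurableSet_Ioo] with t ht htT
    have htT' : T - t ∈ Icc 0 T := ⟨by linarith [htT.2], by linarith [htT.1]⟩
    rw [ht, h1, intervalIntegral.integral_neg, intervalIntegral.integral_comp_sub_left, sub_zero,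
      ← intervalIntegral.integral_add_adjacent_intervals (intervalIntegrable_of_mem hgi h0T htT')
        (intervalIntegrable_of_mem hgi htT' hTT)]
    abel

section Coercive

variable {A : ℝ → V →L[ℝ] V} {M α l : ℝ} {f : ℝ → V}

theorem IsCoercive.reverse (hA : IsCoercive ι T A M α l) :
    IsCoercive ι T (fun t => A (T - t)) M α l where
  aestronglyMeasurable :=
    hA.aestronglyMeasurable.comp_measurePreserving (measurePreserving_sub_left_timeMeasure T)
  bound := (measurePreserving_sub_left_timeMeasure T).quasiMeasurePreserving.ae hA.bound
  coercive := (measurePreserving_sub_left_timeMeasure T).quasiMeasurePreserving.ae hA.coercive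
  pos := hA.pos
  nonneg := hA.nonneg

/-- Solutions with the same data coincide. -/
theorem IsEvolution.ae_eq (hι : Function.Injective ι) (hι' : Function.Injective (ι†))
    (hT : 0 < T) (hA : IsCoercive ι T A M α l) {w' : ℝ → V}
    (hw : IsEvolution ι T h w (fun t => f t - A t (w t)))
    (hw' : IsEvolution ι T h w' (fun t => f t - A t (w' t))) : w =ᵐ[timeMeasure T] w' := by
  have hd := (hw.sub hw').congr (EventuallyEq.refl _ _) (g' := fun t => 0 - A t (w t - w' t))
    (Eventually.of_forall fun t => by simp only [map_sub]; abel)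
  obtain ⟨c, hc, hc0⟩ := hd.exists_isContRepr hι hι' hT.le
  -- The difference has zero source and zero initial value, so its L² norm vanishes.
  have h1 := (energy_estimate hT.le hA (MemLp.zero' (ε := V)) hd.memLp hc.ae_eq
    (hd.isAntideriv_norm_sq hι hι' hT hc)).2
  rw [hc0] at h1
  simp only [sub_self, norm_zero, ne_eq, OfNat.ofNat_ne_zero, not_false_eq_true, zero_pow,
    integral_zero, mul_zero, add_zero] at h1
  have h2 : ∫ t, ‖w t - w' t‖ ^ 2 ∂(timeMeasure T) = 0 :=
    le_antisymm (by nlinarith [hA.pos]) (integral_nonneg fun _ => sq_nonneg _)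
  rw [integral_eq_zero_iff_of_nonneg (fun _ => sq_nonneg _) (integrable_norm_sq hd.memLp)] at h2
  filter_upwards [h2] with t ht
  simpa [sub_eq_zero] using ht

end Coercive

end Evolution

end FokkerPlanck

namespace FokkerPlanck

/-! ### The Sobolev space `H¹(Ω)` -/

section Sobolev

variable {n : ℕ} {Ω : Set (Vec n)}

/-- For each test function and coordinate the defining condition is an equality of two continuous
functionals. Closedness makes H¹ complete, as the Hilbert space arguments require. -/
theorem isClosed_h1Submodule (Ω : Set (Vec n)) :
    IsClosed (h1Submodule Ω : Set (WithLp 2 (L2 Ω × L2Vec Ω))) := by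
  have e : (h1Submodule Ω : Set (WithLp 2 (L2 Ω × L2Vec Ω))) =
      ⋂ (φ : Vec n → ℝ) (hφ : IsTestFunction Ω φ) (i : Fin n),
        {w | ⟪(memLp_fderiv_test hφ (EuclideanSpace.single i 1)).toLp _, w.fst⟫_ℝ
          = -⟪(memLp_test hφ).toLp _, (EuclideanSpace.proj i : Vec n →L[ℝ] ℝ).compLp w.snd⟫_ℝ} := by
    ext w
    simp only [mem_iInter, mem_ofPred_eq, SetLike.mem_coe]
    change IsWeakGradient Ω w.fst w.snd ↔ _
    refine forall_congr' fun φ => forall_congr' fun hφ => forall_congr' fun i => ?_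
    have e1 : ⟪(memLp_fderiv_test hφ (EuclideanSpace.single i 1)).toLp _, w.fst⟫_ℝ
        = ∫ x in Ω, w.fst x * fderiv ℝ φ x (EuclideanSpace.single i 1) := by
      rw [L2.inner_def]
      refine integral_congr_ae ?_
      filter_upwards [(memLp_fderiv_test hφ (EuclideanSpace.single i 1)).coeFn_toLp] with x hx
      rw [hx]
      rfl
    have e2 : ⟪(memLp_test hφ).toLp _, (EuclideanSpace.proj i : Vec n →L[ℝ] ℝ).compLp w.snd⟫_ℝ
        = ∫ x in Ω, w.snd x i * φ x := by
      rw [L2.inner_def]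
      refine integral_congr_ae ?_
      filter_upwards [(memLp_test hφ).coeFn_toLp,
        (EuclideanSpace.proj i : Vec n →L[ℝ] ℝ).coeFn_compLp w.snd] with x hx hx'
      rw [hx, hx']
      rfl
    rw [e1, e2]
  rw [e]
  refine isClosed_iInter fun φ => isClosed_iInter fun hφ => isClosed_iInter fun i =>
    isClosed_eq ?_ ?_
  · exact continuous_const.inner (WithLp.fstL 2 ℝ (L2 Ω) (L2Vec Ω)).continuous
  · exact (continuous_const.inner (((EuclideanSpace.proj i : Vec n →L[ℝ] ℝ).compLpL 2
      (volume.restrict Ω)).continuous.comp (WithLp.sndL 2 ℝ (L2 Ω) (L2Vec Ω)).continuous)).neg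

instance : CompleteSpace (H1 Ω) := (isClosed_h1Submodule Ω).completeSpace_coe

/-- The embedding `H¹(Ω) → L²(Ω)` as a continuous linear map. -/
def H1.toL2L (Ω : Set (Vec n)) : H1 Ω →L[ℝ] L2 Ω :=
  WithLp.fstL 2 ℝ (L2 Ω) (L2Vec Ω) ∘L (h1Submodule Ω).subtypeL

/-- The weak gradient as a continuous linear map. -/
def H1.gradL (Ω : Set (Vec n)) : H1 Ω →L[ℝ] L2Vec Ω :=
  WithLp.sndL 2 ℝ (L2 Ω) (L2Vec Ω) ∘L (h1Submodule Ω).subtypeL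

theorem H1.toL2L_apply (f : H1 Ω) : H1.toL2L Ω f = f.toL2 := rfl

theorem H1.gradL_apply (f : H1 Ω) : H1.gradL Ω f = f.grad := rfl

theorem H1.norm_sq_eq (f : H1 Ω) : ‖f‖ ^ 2 = ‖H1.toL2L Ω f‖ ^ 2 + ‖H1.gradL Ω f‖ ^ 2 :=
  WithLp.prod_norm_sq_eq_of_L2 (f : WithLp 2 (L2 Ω × L2Vec Ω))

theorem isFiniteMeasure_restrict (hb : Bornology.IsBounded Ω) :
    IsFiniteMeasure (volume.restrict Ω) :=
  ⟨by rw [Measure.restrict_apply_univ]; exact hb.measure_lt_top⟩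

theorem ae_eq_zero_of_forall_test (hΩ : IsOpen Ω) (hb : Bornology.IsBounded Ω) {f : Vec n → ℝ}
    (hf : MemLp f 2 (volume.restrict Ω))
    (h : ∀ φ : Vec n → ℝ, IsTestFunction Ω φ → ∫ x in Ω, f x * φ x = 0) :
    f =ᵐ[volume.restrict Ω] 0 := by
  have := isFiniteMeasure_restrict hb
  have hfi : IntegrableOn f Ω := hf.integrable (by norm_num)
  refine (ae_restrict_iff' hΩ.measurableSet).2 ?_
  refine hΩ.ae_eq_zero_of_integral_contDiff_smul_eq_zero hfi.locallyIntegrableOn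
    fun φ h1 h2 h3 => ?_
  have hφ : IsTestFunction Ω φ := ⟨h1, h2, h3⟩
  rw [← hφ.setIntegral_eq, ← h φ hφ]
  simp only [smul_eq_mul, mul_comm]

/-- An element carries its gradient as separate data, so the gradient must be shown to vanish with
the function. This is the uniqueness of weak gradients, a consequence of the fundamental lemma of
the calculus of variations. -/
theorem H1.toL2L_injective (hΩ : IsOpen Ω) (hb : Bornology.IsBounded Ω) :
    Function.Injective (H1.toL2L Ω) := by
  refine (injective_iff_map_eq_zero _).2 fun f hf => ?_
  have h0 : ∀ᵐ x ∂(volume.restrict Ω), f.toL2 x = 0 := by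
    rw [H1.toL2L_apply] at hf
    rw [hf]
    exact Lp.coeFn_zero _ _ _
  have hg : H1.gradL Ω f = 0 := by
    have hi : ∀ i, (fun x => f.grad x i) =ᵐ[volume.restrict Ω] 0 := fun i =>
      ae_eq_zero_of_forall_test hΩ hb (memLp_coord f.grad i) fun φ hφ => by
        have h1 := f.2 φ hφ i
        have h2 : ∫ x in Ω, f.toL2 x * fderiv ℝ φ x (EuclideanSpace.single i 1) = 0 :=
          integral_eq_zero_of_ae (by
            filter_upwards [h0] with x hx
            rw [hx, zero_mul]
            rfl)
        have h3 : ∫ x in Ω, f.toL2 x * fderiv ℝ φ x (EuclideanSpace.single i 1)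
          = -∫ x in Ω, f.grad x i * φ x := h1
        linarith
    refine Lp.ext ?_
    filter_upwards [eventually_all.2 hi, Lp.coeFn_zero (Vec n) 2 (volume.restrict Ω)] with x hx hx'
    rw [hx', H1.gradL_apply]
    ext i
    exact hx i
  have := H1.norm_sq_eq f
  rw [hf, hg] at this
  simpa using this

/-- The classical gradient. -/
def classicalGrad (φ : Vec n → ℝ) (x : Vec n) : Vec n :=
  WithLp.toLp 2 fun i => fderiv ℝ φ x (EuclideanSpace.single i 1)

theorem memLp_classicalGrad {φ : Vec n → ℝ} (hφ : IsTestFunction Ω φ) :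
    MemLp (classicalGrad φ) 2 (volume.restrict Ω) := by
  refine (MemLp.of_eval_piLp fun i => ?_)
  exact memLp_fderiv_test hφ (EuclideanSpace.single i 1)

/-- A test function as an element of `H¹(Ω)`. -/
def H1.ofTest {φ : Vec n → ℝ} (hφ : IsTestFunction Ω φ) : H1 Ω :=
  ⟨WithLp.toLp 2 ((memLp_test hφ).toLp φ, (memLp_classicalGrad hφ).toLp _), by
    intro ψ hψ i
    have hd : ∀ {χ : Vec n → ℝ}, IsTestFunction Ω χ → Continuous fun x =>
        fderiv ℝ χ x (EuclideanSpace.single i 1) := fun hχ =>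
      (hχ.1.continuous_fderiv (by simp)).clm_apply continuous_const
    have hd' : ∀ {χ : Vec n → ℝ}, IsTestFunction Ω χ → HasCompactSupport fun x =>
        fderiv ℝ χ x (EuclideanSpace.single i 1) := fun hχ => hχ.2.1.fderiv_apply (𝕜 := ℝ) _
    -- Compact support allows integration by parts over the whole space, with no boundary term.
    have h1 := integral_mul_fderiv_eq_neg_fderiv_mul_of_integrable (μ := volume) (f := φ) (g := ψ)
      (v := EuclideanSpace.single i (1 : ℝ))
      (((hd hφ).mul hψ.1.continuous).integrable_of_hasCompactSupport hψ.2.1.mul_left)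
      ((hφ.1.continuous.mul (hd hψ)).integrable_of_hasCompactSupport hφ.2.1.mul_right)
      ((hφ.1.continuous.mul hψ.1.continuous).integrable_of_hasCompactSupport hφ.2.1.mul_right)
      (fun x _ => (hφ.1.differentiable (by simp)).differentiableAt)
      (fun x _ => (hψ.1.differentiable (by simp)).differentiableAt)
    have e1 : ∫ x in Ω, ((memLp_test hφ).toLp φ : L2 Ω) x
          * fderiv ℝ ψ x (EuclideanSpace.single i 1)
        = ∫ x, φ x * fderiv ℝ ψ x (EuclideanSpace.single i 1) := by
      refine Eq.trans ?_ (hφ.setIntegral_eq (μ := volume)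
        (fun x => fderiv ℝ ψ x (EuclideanSpace.single i 1)))
      refine integral_congr_ae ?_
      filter_upwards [(memLp_test hφ).coeFn_toLp] with x hx
      rw [hx]
      rfl
    have e2 : ∫ x in Ω, ((memLp_classicalGrad hφ).toLp (classicalGrad φ) : L2Vec Ω) x i * ψ x
        = ∫ x, fderiv ℝ φ x (EuclideanSpace.single i 1) * ψ x := by
      have := hψ.setIntegral_eq (μ := volume) (fun x => fderiv ℝ φ x (EuclideanSpace.single i 1))
      simp only [smul_eq_mul, mul_comm (ψ _)] at this
      rw [← this]
      refine integral_congr_ae ?_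
      filter_upwards [(memLp_classicalGrad hφ).coeFn_toLp] with x hx
      rw [hx]
      rfl
    change ∫ x in Ω, ((memLp_test hφ).toLp φ : L2 Ω) x * fderiv ℝ ψ x (EuclideanSpace.single i 1)
      = -∫ x in Ω, ((memLp_classicalGrad hφ).toLp (classicalGrad φ) : L2Vec Ω) x i * ψ x
    rw [e1, e2, h1]⟩

/-- A function annihilated by the adjoint is orthogonal to the image of H¹, hence to every test
function, hence zero. -/
theorem H1.toL2L_adjoint_injective (hΩ : IsOpen Ω) (hb : Bornology.IsBounded Ω) :
    Function.Injective ((H1.toL2L Ω)†) := by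
  refine (injective_iff_map_eq_zero _).2 fun f hf => ?_
  rw [Lp.eq_zero_iff_ae_eq_zero]
  refine ae_eq_zero_of_forall_test hΩ hb (Lp.memLp f) fun φ hφ => ?_
  have h1 : ⟪f, H1.toL2L Ω (H1.ofTest hφ)⟫_ℝ = 0 := by
    rw [← ContinuousLinearMap.adjoint_inner_left, hf, inner_zero_left]
  have h2 : H1.toL2L Ω (H1.ofTest hφ) = (memLp_test hφ).toLp φ := rfl
  rw [h2, L2.inner_def] at h1
  rw [← h1]
  refine integral_congr_ae ?_
  filter_upwards [(memLp_test hφ).coeFn_toLp] with x hx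
  rw [hx]
  exact mul_comm _ _

/-- Multiplication of functions in `L²(Ω)` by a bounded vector field. -/
def mulField (m : Lp (Vec n) ∞ (volume.restrict Ω)) : L2 Ω →L[ℝ] L2Vec Ω :=
  ((ContinuousLinearMap.lsmul ℝ ℝ : ℝ →L[ℝ] Vec n →L[ℝ] Vec n).holderL
    (volume.restrict Ω) 2 ∞ 2).flip m

theorem coeFn_mulField (m : Lp (Vec n) ∞ (volume.restrict Ω)) (f : L2 Ω) :
    mulField m f =ᵐ[volume.restrict Ω] fun x => f x • m x :=
  (ContinuousLinearMap.lsmul ℝ ℝ : ℝ →L[ℝ] Vec n →L[ℝ] Vec n).coeFn_holder f m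

/-- The vector field `bᵢ eᵢ`. -/
def componentField (b : Lp (Vec n) ∞ (volume.restrict Ω)) (i : Fin n) :
    Lp (Vec n) ∞ (volume.restrict Ω) :=
  ((EuclideanSpace.proj i : Vec n →L[ℝ] ℝ).smulRight (EuclideanSpace.single i (1 : ℝ))).compLp b

theorem coeFn_componentField (b : Lp (Vec n) ∞ (volume.restrict Ω)) (i : Fin n) :
    componentField b i =ᵐ[volume.restrict Ω] fun x => b x i • EuclideanSpace.single i (1 : ℝ) :=
  ContinuousLinearMap.coeFn_compLp _ _

end Sobolev

/-! ### Operators affine in the control -/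

section AffineOp

variable {V : Type*} [NormedAddCommGroup V] [NormedSpace ℝ V] {n : ℕ}

/-- Operators depending affinely on a vector. -/
def affineOp (A₀ : V →L[ℝ] V) (A : Fin n → V →L[ℝ] V) (u : Vec n) : V →L[ℝ] V :=
  A₀ + ∑ i, u i • A i

variable (A₀ : V →L[ℝ] V) (A : Fin n → V →L[ℝ] V)

theorem affineOp_apply (u : Vec n) (v : V) : affineOp A₀ A u v = A₀ v + ∑ i, u i • A i v := by
  simp [affineOp]

theorem affineOp_add_apply (u u' : Vec n) (v : V) :
    affineOp A₀ A (u + u') v = affineOp A₀ A u v + ∑ i, u' i • A i v := by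
  simp [affineOp_apply, add_smul, Finset.sum_add_distrib, add_assoc]

theorem norm_affineOp_le {R : ℝ} (u : Vec n) (hu : ‖u‖ ≤ R) :
    ‖affineOp A₀ A u‖ ≤ ‖A₀‖ + ∑ i, R * ‖A i‖ := by
  refine (norm_add_le _ _).trans ?_
  gcongr
  refine (norm_sum_le _ _).trans (Finset.sum_le_sum fun i _ => ?_)
  rw [norm_smul]
  exact mul_le_mul_of_nonneg_right ((PiLp.norm_apply_le u i).trans hu) (norm_nonneg _)

theorem continuous_affineOp : Continuous (affineOp A₀ A) := by
  unfold affineOp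
  fun_prop

end AffineOp

/-! ### The operators of the Fokker-Planck equation -/

namespace Data

variable {n : ℕ} (D : Data n)

/-- The operator `φ ↦ ∫_Ω (ν ∇ψ + ψ c) · ∇φ`. -/
def opDrift : H1 D.Ω →L[ℝ] H1 D.Ω :=
  (H1.gradL D.Ω)† ∘L (D.ν • H1.gradL D.Ω + mulField D.c ∘L H1.toL2L D.Ω)

/-- The operator `φ ↦ ∫_Ω ψ bᵢ ∂ᵢφ`. -/
def opControl (i : Fin n) : H1 D.Ω →L[ℝ] H1 D.Ω :=
  (H1.gradL D.Ω)† ∘L mulField (componentField D.b i) ∘L H1.toL2L D.Ω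

/-- The operator belonging to the bilinear form `a[u]`. -/
def op (u : Vec n) : H1 D.Ω →L[ℝ] H1 D.Ω := affineOp D.opDrift D.opControl u

theorem inner_opDrift (ψ φ : H1 D.Ω) : ⟪D.opDrift ψ, φ⟫_ℝ
    = D.ν * ⟪H1.gradL D.Ω ψ, H1.gradL D.Ω φ⟫_ℝ
      + ⟪mulField D.c (H1.toL2L D.Ω ψ), H1.gradL D.Ω φ⟫_ℝ := by
  simp only [opDrift, ContinuousLinearMap.comp_apply, ContinuousLinearMap.adjoint_inner_left,
    add_apply, smul_apply, inner_add_left, inner_smul_left, conj_trivial]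

theorem inner_opControl (i : Fin n) (ψ φ : H1 D.Ω) : ⟪D.opControl i ψ, φ⟫_ℝ
    = ⟪mulField (componentField D.b i) (H1.toL2L D.Ω ψ), H1.gradL D.Ω φ⟫_ℝ := by
  simp only [opControl, ContinuousLinearMap.comp_apply, ContinuousLinearMap.adjoint_inner_left]

theorem op_apply (u : Vec n) (ψ : H1 D.Ω) :
    D.op u ψ = D.opDrift ψ + ∑ i, u i • D.opControl i ψ :=
  affineOp_apply _ _ _ _

theorem inner_op (u : Vec n) (ψ φ : H1 D.Ω) : ⟪D.op u ψ, φ⟫_ℝ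
    = D.ν * ⟪H1.gradL D.Ω ψ, H1.gradL D.Ω φ⟫_ℝ
      + (⟪mulField D.c (H1.toL2L D.Ω ψ), H1.gradL D.Ω φ⟫_ℝ
        + ∑ i, u i * ⟪mulField (componentField D.b i) (H1.toL2L D.Ω ψ), H1.gradL D.Ω φ⟫_ℝ) := by
  have e : ∀ i, ⟪u i • D.opControl i ψ, φ⟫_ℝ
      = u i * ⟪mulField (componentField D.b i) (H1.toL2L D.Ω ψ), H1.gradL D.Ω φ⟫_ℝ := fun i =>
    (real_inner_smul_left (D.opControl i ψ) φ (u i)).trans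
      (congrArg (u i * ·) (D.inner_opControl i ψ φ))
  rw [op_apply, inner_add_left, inner_opDrift, sum_inner, add_assoc,
    Finset.sum_congr rfl fun i _ => e i]

theorem inner_opControl_eq_integral (i : Fin n) (ψ φ : H1 D.Ω) : ⟪D.opControl i ψ, φ⟫_ℝ
    = ∫ x in D.Ω, ψ.toL2 x * D.b x i * φ.grad x i := by
  rw [inner_opControl, L2.inner_def]
  refine integral_congr_ae ?_
  filter_upwards [coeFn_mulField (componentField D.b i) (H1.toL2L D.Ω ψ),
    coeFn_componentField D.b i] with x h1 h2
  rw [h1, h2, H1.toL2L_apply, H1.gradL_apply, inner_smul_left, inner_smul_left,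
    EuclideanSpace.inner_single_left]
  simp [mul_assoc]

theorem cwMul_eq_sum (b u : Vec n) :
    cwMul b u = ∑ i, u i • (b i • EuclideanSpace.single i (1 : ℝ)) := by
  ext j
  simp [cwMul, Finset.sum_apply, mul_comm, Pi.single_apply]

/-- Writing b ⊗ u as ∑ u_i b_i e_i exhibits the form as affine in `u` with fixed bounded operators
as coefficients. This is all the abstract theory uses of the equation. -/
theorem a_eq_inner_op (u : Vec n) (ψ φ : H1 D.Ω) : D.a u ψ φ = ⟪D.op u ψ, φ⟫_ℝ := by
  have h1 : ⟪D.op u ψ, φ⟫_ℝ = ⟪D.ν • H1.gradL D.Ω ψ + mulField D.c (H1.toL2L D.Ω ψ)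
      + ∑ i, u i • mulField (componentField D.b i) (H1.toL2L D.Ω ψ), H1.gradL D.Ω φ⟫_ℝ := by
    rw [inner_op, inner_add_left, inner_add_left, sum_inner, inner_smul_left, conj_trivial,
      add_assoc]
    simp only [real_inner_smul_left]
  rw [h1, L2.inner_def]
  refine integral_congr_ae ?_
  have h3 : (∑ i, u i • mulField (componentField D.b i) (H1.toL2L D.Ω ψ) : L2Vec D.Ω)
      =ᵐ[volume.restrict D.Ω] fun x => ∑ i, (u i • mulField (componentField D.b i)
        (H1.toL2L D.Ω ψ) : L2Vec D.Ω) x := by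
    refine (Lp.coeFn_finsetSum _ _).trans (Eventually.of_forall fun x => ?_)
    simp
  have h4 : ∀ᵐ x ∂(volume.restrict D.Ω), ∀ i, (u i • mulField (componentField D.b i)
      (H1.toL2L D.Ω ψ) : L2Vec D.Ω) x
        = u i • (ψ.toL2 x • (D.b x i • EuclideanSpace.single i (1 : ℝ))) := by
    refine eventually_all.2 fun i => ?_
    filter_upwards [Lp.coeFn_smul (u i) (mulField (componentField D.b i) (H1.toL2L D.Ω ψ)),
      coeFn_mulField (componentField D.b i) (H1.toL2L D.Ω ψ),
      coeFn_componentField D.b i] with x q1 q2 q3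
    rw [q1, Pi.smul_apply, q2, q3]
    rfl
  filter_upwards [h3, h4, coeFn_mulField D.c (H1.toL2L D.Ω ψ),
    Lp.coeFn_add (D.ν • H1.gradL D.Ω ψ + mulField D.c (H1.toL2L D.Ω ψ))
      (∑ i, u i • mulField (componentField D.b i) (H1.toL2L D.Ω ψ)),
    Lp.coeFn_add (D.ν • H1.gradL D.Ω ψ) (mulField D.c (H1.toL2L D.Ω ψ)),
    Lp.coeFn_smul D.ν (H1.gradL D.Ω ψ)] with x q3 q4 q5 q6 q7 q8
  rw [q6, Pi.add_apply, q7, Pi.add_apply, q8, Pi.smul_apply, q5, q3, Finset.sum_congr rfl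
    fun i _ => q4 i]
  have : ∑ i, u i • (ψ.toL2 x • (D.b x i • EuclideanSpace.single i (1 : ℝ)))
      = ψ.toL2 x • cwMul (D.b x) u := by
    rw [cwMul_eq_sum, Finset.smul_sum]
    exact Finset.sum_congr rfl fun i _ => smul_comm _ _ _
  rw [this, B, smul_add, add_assoc]
  rfl

/-- A bound of the drift fields for controls of norm at most `R`. -/
def driftBound (R : ℝ) : ℝ := ‖mulField D.c‖ + ∑ i, R * ‖mulField (componentField D.b i)‖

/-- The drift terms are at most `driftBound R` times ‖ψ‖‖∇ψ‖, and Young's inequality absorbs them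
into half of the diffusion. The extra ν/2 in the zero order term completes ‖∇ψ‖² to the full H¹
norm. The constants depend on `u` only through `R`. -/
theorem op_coercive {R : ℝ} (u : Vec n) (hu : ‖u‖ ≤ R) (ψ : H1 D.Ω) :
    D.ν / 2 * ‖ψ‖ ^ 2 ≤ ⟪D.op u ψ, ψ⟫_ℝ
      + (D.ν / 2 + D.driftBound R ^ 2 / (2 * D.ν)) * ‖H1.toL2L D.Ω ψ‖ ^ 2 := by
  have hν := D.ν_pos
  set N := ‖H1.gradL D.Ω ψ‖ with hN
  set K := ‖H1.toL2L D.Ω ψ‖ with hK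
  have hfield : ∀ m : Lp (Vec n) ∞ (volume.restrict D.Ω),
      |⟪mulField m (H1.toL2L D.Ω ψ), H1.gradL D.Ω ψ⟫_ℝ| ≤ ‖mulField m‖ * (K * N) := fun m => by
    refine (abs_real_inner_le_norm _ _).trans ?_
    rw [← mul_assoc]
    exact mul_le_mul_of_nonneg_right ((mulField m).le_opNorm _) (norm_nonneg _)
  have h1 : ⟪D.op u ψ, ψ⟫_ℝ = D.ν * N ^ 2 + (⟪mulField D.c (H1.toL2L D.Ω ψ), H1.gradL D.Ω ψ⟫_ℝ
      + ∑ i, u i * ⟪mulField (componentField D.b i) (H1.toL2L D.Ω ψ), H1.gradL D.Ω ψ⟫_ℝ) := by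
    rw [inner_op, real_inner_self_eq_norm_sq]
  have h2 : |⟪mulField D.c (H1.toL2L D.Ω ψ), H1.gradL D.Ω ψ⟫_ℝ
      + ∑ i, u i * ⟪mulField (componentField D.b i) (H1.toL2L D.Ω ψ), H1.gradL D.Ω ψ⟫_ℝ|
      ≤ D.driftBound R * (K * N) := by
    rw [driftBound, add_mul, Finset.sum_mul]
    refine (abs_add_le _ _).trans (add_le_add (hfield _) ?_)
    refine (Finset.abs_sum_le_sum_abs _ _).trans (Finset.sum_le_sum fun i _ => ?_)
    rw [abs_mul, mul_assoc]
    have hui : |u i| ≤ R := (PiLp.norm_apply_le u i).trans hu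
    exact mul_le_mul hui (hfield _) (abs_nonneg _) ((abs_nonneg _).trans hui)
  have h3 := (abs_le.1 h2).1
  rw [h1, H1.norm_sq_eq, ← hN, ← hK]
  have h4 : D.driftBound R * (K * N) ≤ D.ν / 2 * N ^ 2 + D.driftBound R ^ 2 / (2 * D.ν) * K ^ 2 := by
    have e : D.ν / 2 * N ^ 2 + D.driftBound R ^ 2 / (2 * D.ν) * K ^ 2 - D.driftBound R * (K * N)
        = (D.ν * N - D.driftBound R * K) ^ 2 / (2 * D.ν) := by
      field_simp
      ring
    have : 0 ≤ (D.ν * N - D.driftBound R * K) ^ 2 / (2 * D.ν) := by positivity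
    linarith
  linarith

end Data

end FokkerPlanck

namespace FokkerPlanck

/-! ### Controlled evolution equations -/

section System

variable {V H : Type*} [NormedAddCommGroup V] [InnerProductSpace ℝ V] [CompleteSpace V]
  [NormedAddCommGroup H] [InnerProductSpace ℝ H] [CompleteSpace H] {n : ℕ}

/-- The evolution equation `(ι w)' + (A₀ + ∑ᵢ uᵢ Aᵢ) w = 0` in a Gelfand triple, where a Gårding
inequality holds uniformly for bounded controls. -/
structure IsParabolicSystem (ι : V →L[ℝ] H) (T : ℝ) (A₀ : V →L[ℝ] V) (A : Fin n → V →L[ℝ] V) :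
    Prop where
  pos : 0 < T
  injective : Function.Injective ι
  injective_adjoint : Function.Injective (ι†)
  coercive : ∀ R : ℝ, ∃ α l : ℝ, 0 < α ∧ 0 ≤ l ∧ ∀ u : Vec n, ‖u‖ ≤ R → ∀ v : V,
    α * ‖v‖ ^ 2 ≤ ⟪affineOp A₀ A u v, v⟫_ℝ + l * ‖ι v‖ ^ 2

theorem ae_norm_le_norm_linfTime {T : ℝ} (u : LInfTime T n) :
    ∀ᵐ t ∂(timeMeasure T), ‖u t‖ ≤ ‖u‖ := by
  have h : eLpNormEssSup u (timeMeasure T) ≠ ⊤ := by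
    rw [← eLpNorm_exponent_top]
    exact Lp.eLpNorm_ne_top u
  filter_upwards [ae_le_eLpNormEssSup (f := u) (μ := timeMeasure T)] with t ht
  rw [Lp.norm_def, eLpNorm_exponent_top, ← toReal_enorm]
  exact ENNReal.toReal_mono h ht

variable {ι : V →L[ℝ] H} {T : ℝ} {A₀ : V →L[ℝ] V} {A : Fin n → V →L[ℝ] V} {h : H} {w f p : ℝ → V}
  {u : LInfTime T n}

namespace IsParabolicSystem

/-- One set of constants serves a whole ball of controls, so energy estimates hold uniformly under
perturbation of the control. -/
theorem exists_isCoercive (hS : IsParabolicSystem ι T A₀ A) (R : ℝ) :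
    ∃ α l M : ℝ, ∀ u : LInfTime T n, ‖u‖ ≤ R →
      IsCoercive ι T (fun t => affineOp A₀ A (u t)) M α l := by
  obtain ⟨α, l, hα, hl, hco⟩ := hS.coercive R
  refine ⟨α, l, ‖A₀‖ + ∑ i, R * ‖A i‖, fun u hu => ⟨?_, ?_, ?_, hα, hl⟩⟩
  · exact (continuous_affineOp A₀ A).comp_aestronglyMeasurable (Lp.aestronglyMeasurable u)
  · filter_upwards [ae_norm_le_norm_linfTime u] with t ht
    exact norm_affineOp_le _ _ _ (ht.trans hu)
  · filter_upwards [ae_norm_le_norm_linfTime u] with t ht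
    exact hco _ (ht.trans hu)

theorem exists_state (hS : IsParabolicSystem ι T A₀ A) (u : LInfTime T n) (h : H) :
    ∃ w : ℝ → V, IsEvolution ι T h w (fun t => 0 - affineOp A₀ A (u t) (w t)) := by
  obtain ⟨α, l, M, hA⟩ := hS.exists_isCoercive ‖u‖
  exact exists_isEvolution hS.pos.le (hA u le_rfl) MemLp.zero' h

theorem state_ae_eq (hS : IsParabolicSystem ι T A₀ A) {w' : ℝ → V}
    (hw : IsEvolution ι T h w (fun t => 0 - affineOp A₀ A (u t) (w t)))
    (hw' : IsEvolution ι T h w' (fun t => 0 - affineOp A₀ A (u t) (w' t))) :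
    w =ᵐ[timeMeasure T] w' := by
  obtain ⟨α, l, M, hA⟩ := hS.exists_isCoercive ‖u‖
  exact hw.ae_eq (f := fun _ => 0) hS.injective hS.injective_adjoint hS.pos (hA u le_rfl) hw'

theorem memLp_affineOp (hS : IsParabolicSystem ι T A₀ A) (u : LInfTime T n)
    (hw : MemLp w 2 (timeMeasure T)) :
    MemLp (fun t => affineOp A₀ A (u t) (w t)) 2 (timeMeasure T) := by
  obtain ⟨α, l, M, hA⟩ := hS.exists_isCoercive ‖u‖
  exact (hA u le_rfl).memLp_apply hw

theorem memLp_affineOp_adjoint (hS : IsParabolicSystem ι T A₀ A) (u : LInfTime T n)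
    (hw : MemLp w 2 (timeMeasure T)) :
    MemLp (fun t => ((affineOp A₀ A (u t))†) (w t)) 2 (timeMeasure T) := by
  obtain ⟨α, l, M, hA⟩ := hS.exists_isCoercive ‖u‖
  exact (hA u le_rfl).adjoint.memLp_apply hw

/-- Reversing time gives a forward problem whose coefficients are the reversed adjoint operators and
whose initial value is the prescribed terminal value. -/
theorem exists_adjointState (hS : IsParabolicSystem ι T A₀ A) (u : LInfTime T n)
    (hf : MemLp f 2 (timeMeasure T)) (h : H) :
    ∃ (p : ℝ → V) (r : ℝ → H), IsContRepr ι T p r ∧ r T = h ∧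
      IsEvolution ι T (r 0) p (fun t => ((affineOp A₀ A (u t))†) (p t) - f t) := by
  obtain ⟨α, l, M, hA⟩ := hS.exists_isCoercive ‖u‖
  obtain ⟨q, hq⟩ := exists_isEvolution hS.pos.le (hA u le_rfl).adjoint.reverse
    (hf.comp_measurePreserving (measurePreserving_sub_left_timeMeasure T)) h
  obtain ⟨c, hc, hc0⟩ := hq.exists_isContRepr hS.injective hS.injective_adjoint hS.pos.le
  refine ⟨fun t => q (T - t), fun t => c (T - t), hc.reverse, by simpa using hc0, ?_⟩
  have := hq.reverse hS.pos hc
  simp only [Function.comp_apply, sub_sub_cancel, neg_sub] at this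
  simpa using this

theorem adjointState_ae_eq (hS : IsParabolicSystem ι T A₀ A) {p' : ℝ → V} {r r' : ℝ → H}
    (hr : IsContRepr ι T p r) (hr' : IsContRepr ι T p' r') (hrr : r T = r' T)
    (hp : IsEvolution ι T (r 0) p (fun t => ((affineOp A₀ A (u t))†) (p t) - f t))
    (hp' : IsEvolution ι T (r' 0) p' (fun t => ((affineOp A₀ A (u t))†) (p' t) - f t)) :
    p =ᵐ[timeMeasure T] p' := by
  obtain ⟨α, l, M, hA⟩ := hS.exists_isCoercive ‖u‖
  have h1 := hp.reverse hS.pos hr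
  have h2 := hp'.reverse hS.pos hr'
  rw [← hrr] at h2
  simp only [neg_sub] at h1 h2
  have h3 := h1.ae_eq (f := fun t => f (T - t)) hS.injective hS.injective_adjoint hS.pos
    (hA u le_rfl).adjoint.reverse h2
  have h4 := (measurePreserving_sub_left_timeMeasure T).quasiMeasurePreserving.ae h3
  filter_upwards [h4] with t ht
  simpa using ht

theorem norm_sum_smul_le (u : Vec n) (v : V) :
    ‖∑ i, u i • A i v‖ ≤ ‖u‖ * ((∑ i, ‖A i‖) * ‖v‖) := by
  rw [Finset.sum_mul, Finset.mul_sum]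
  refine (norm_sum_le _ _).trans (Finset.sum_le_sum fun i _ => ?_)
  rw [norm_smul]
  exact mul_le_mul (PiLp.norm_apply_le u i) ((A i).le_opNorm v) (norm_nonneg _) (norm_nonneg _)

theorem memLp_sum_smul (v : LInfTime T n) (hw : MemLp w 2 (timeMeasure T)) :
    MemLp (fun t => ∑ i, v t i • A i (w t)) 2 (timeMeasure T) := by
  refine memLp_finsetSum _ fun i _ => ?_
  have hv : MemLp (fun t => v t i) ∞ (timeMeasure T) :=
    (EuclideanSpace.proj i : Vec n →L[ℝ] ℝ).comp_memLp' (Lp.memLp v)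
  exact (((A i).comp_memLp' hw)).smul hv

/-- The state depends Lipschitz continuously on the control. -/
theorem exists_norm_sub_state_le (hS : IsParabolicSystem ι T A₀ A) {c : ℝ → H}
    (hw : IsEvolution ι T h w (fun t => 0 - affineOp A₀ A (u t) (w t)))
    (hc : IsContRepr ι T w c) :
    ∃ K, 0 ≤ K ∧ ∀ v : LInfTime T n, ‖v‖ ≤ 1 → ∀ (w' : ℝ → V) (c' : ℝ → H),
      IsEvolution ι T h w' (fun t => 0 - affineOp A₀ A ((u + v : LInfTime T n) t) (w' t)) →
      IsContRepr ι T w' c' →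
      ‖c' T - c T‖ ^ 2 ≤ K * ‖v‖ ^ 2 ∧ ∫ t, ‖w' t - w t‖ ^ 2 ∂(timeMeasure T) ≤ K * ‖v‖ ^ 2 := by
  -- The radius ‖u‖ + 1 covers every `u + v` with ‖v‖ ≤ 1.
  obtain ⟨α, l, M, hA⟩ := hS.exists_isCoercive (‖u‖ + 1)
  have hα : 0 < α := (hA u (by linarith)).pos
  set E := Real.exp (2 * l * T) with hE
  set B := ∑ i, ‖A i‖ with hB
  set W := ∫ t, ‖w t‖ ^ 2 ∂(timeMeasure T) with hW
  have hW0 : 0 ≤ W := integral_nonneg fun _ => sq_nonneg _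
  have hE0 : 0 < E := Real.exp_pos _
  -- The sum of the two constants from the energy estimate, so that a single `K` serves both bounds.
  refine ⟨E * α⁻¹ * B ^ 2 * W + α⁻¹ * (E * α⁻¹ * B ^ 2 * W), by positivity,
    fun v hv w' c' hw' hc' => ?_⟩
  have hcoer := hA (u + v) ((norm_add_le _ _).trans (by linarith))
  have hv2 := memLp_sum_smul (A := A) v hw.memLp
  -- The perturbed operator is kept on the difference of states, which leaves the known state `w`
  -- alone in the source and makes the source linear in `v`.
  have hd : IsEvolution ι T (h - h) (fun t => w' t - w t) (fun t => -(∑ i, v t i • A i (w t))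
      - affineOp A₀ A ((u + v : LInfTime T n) t) (w' t - w t)) := by
    refine (hw'.sub hw).congr (EventuallyEq.refl _ _) ?_
    filter_upwards [Lp.coeFn_add u v] with t ht
    rw [ht, Pi.add_apply, map_sub, affineOp_add_apply A₀ A (u t) (v t) (w t)]
    abel
  have hcc : IsContRepr ι T (fun t => w' t - w t) (fun t => c' t - c t) :=
    ⟨hc'.continuousOn.sub hc.continuousOn, by
      filter_upwards [hc'.ae_eq, hc.ae_eq] with t q1 q2
      rw [q1, q2, map_sub]⟩
  have h0 : c' 0 - c 0 = 0 := by
    rw [hd.apply_zero_eq hS.injective_adjoint hS.pos hcc, sub_self]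
  obtain ⟨e1, e2⟩ := energy_estimate hS.pos.le hcoer hv2.neg hd.memLp hcc.ae_eq
    (hd.isAntideriv_norm_sq hS.injective hS.injective_adjoint hS.pos hcc)
  have e3 := e1 T ⟨hS.pos.le, le_rfl⟩
  simp only [h0, norm_zero, ne_eq, OfNat.ofNat_ne_zero, not_false_eq_true, zero_pow, zero_add,
    Pi.neg_apply, norm_neg] at e2 e3
  have e4 : ∫ t, ‖∑ i, v t i • A i (w t)‖ ^ 2 ∂(timeMeasure T) ≤ ‖v‖ ^ 2 * (B ^ 2 * W) := by
    rw [← mul_assoc, hW, ← integral_const_mul]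
    refine integral_mono_ae (integrable_norm_sq hv2) ((integrable_norm_sq hw.memLp).const_mul _) ?_
    filter_upwards [ae_norm_le_norm_linfTime v] with t ht
    calc ‖∑ i, v t i • A i (w t)‖ ^ 2 ≤ (‖v‖ * (B * ‖w t‖)) ^ 2 := by
          gcongr
          refine (norm_sum_smul_le (A := A) (v t) (w t)).trans ?_
          gcongr
      _ = _ := by ring
  have e5 : E * (α⁻¹ * ∫ t, ‖∑ i, v t i • A i (w t)‖ ^ 2 ∂(timeMeasure T))
      ≤ E * α⁻¹ * B ^ 2 * W * ‖v‖ ^ 2 := by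
    calc _ ≤ E * (α⁻¹ * (‖v‖ ^ 2 * (B ^ 2 * W))) := by gcongr
      _ = _ := by ring
  have e6 := e2.trans e5
  have e7 : ∫ t, ‖w' t - w t‖ ^ 2 ∂(timeMeasure T) ≤ α⁻¹ * (E * α⁻¹ * B ^ 2 * W) * ‖v‖ ^ 2 := by
    rw [mul_assoc, inv_mul_eq_div, le_div_iff₀ hα, mul_comm]
    exact e6
  have e8 : 0 ≤ E * α⁻¹ * B ^ 2 * W * ‖v‖ ^ 2 := by positivity
  have e9 : 0 ≤ α⁻¹ * (E * α⁻¹ * B ^ 2 * W) * ‖v‖ ^ 2 := by positivity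
  exact ⟨by linarith [e3.trans e5], by linarith⟩

/-- The tracking cost. -/
def trackingCost (ι : V →L[ℝ] H) (T aQ aT : ℝ) (zQ : ℝ → H) (zT : H) (w : ℝ → V) (c : ℝ → H) : ℝ :=
  aQ / 2 * (∫ t, ‖ι (w t) - zQ t‖ ^ 2 ∂(timeMeasure T)) + aT / 2 * ‖c T - zT‖ ^ 2

/-- The difference of tracking costs, expressed by the adjoint state. -/
theorem trackingCost_sub (hS : IsParabolicSystem ι T A₀ A) {aQ aT : ℝ} {zQ : ℝ → H} {zT : H}
    (hz : MemLp zQ 2 (timeMeasure T)) {c r : ℝ → H}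
    (hw : IsEvolution ι T h w (fun t => 0 - affineOp A₀ A (u t) (w t)))
    (hc : IsContRepr ι T w c) (hr : IsContRepr ι T p r) (hrT : r T = aT • (c T - zT))
    (hp : IsEvolution ι T (r 0) p (fun t => ((affineOp A₀ A (u t))†) (p t)
      - aQ • (ι†) (ι (w t) - zQ t)))
    (v : LInfTime T n) {w' : ℝ → V} {c' : ℝ → H}
    (hw' : IsEvolution ι T h w' (fun t => 0 - affineOp A₀ A ((u + v : LInfTime T n) t) (w' t)))
    (hc' : IsContRepr ι T w' c') :
    trackingCost ι T aQ aT zQ zT w' c' - trackingCost ι T aQ aT zQ zT w c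
      = aQ / 2 * (∫ t, ‖ι (w' t - w t)‖ ^ 2 ∂(timeMeasure T)) + aT / 2 * ‖c' T - c T‖ ^ 2
        - (∫ t, ⟪∑ i, v t i • A i (w' t - w t), p t⟫_ℝ ∂(timeMeasure T))
        - ∫ t, ⟪∑ i, v t i • A i (w t), p t⟫_ℝ ∂(timeMeasure T) := by
  have hd := hw'.sub hw
  have hcc : IsContRepr ι T (fun t => w' t - w t) (fun t => c' t - c t) :=
    ⟨hc'.continuousOn.sub hc.continuousOn, by
      filter_upwards [hc'.ae_eq, hc.ae_eq] with t q1 q2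
      rw [q1, q2, map_sub]⟩
  have h0 : c' 0 - c 0 = 0 := by
    rw [hd.apply_zero_eq hS.injective_adjoint hS.pos hcc, sub_self]
  -- Only the boundary term at T survives, because the difference vanishes at 0. The terminal
  -- condition for the adjoint state makes it the linear part of the terminal cost.
  have e1 := hd.integral_inner_add_inner hS.injective hS.injective_adjoint hS.pos hp hcc hr
  rw [h0, inner_zero_left, sub_zero, hrT, inner_smul_right] at e1
  have hδ := hd.memLp
  have m1 := memLp_sum_smul (A := A) v hw.memLp
  have m2 := memLp_sum_smul (A := A) v hδ
  have m3 : MemLp (fun t => ι (w t) - zQ t) 2 (timeMeasure T) := (ι.comp_memLp' hw.memLp).sub hz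
  have m4 : MemLp (fun t => ι (w' t - w t)) 2 (timeMeasure T) := ι.comp_memLp' hδ
  have i1 := integrable_inner_of_memLp m1 hp.memLp
  have i2 := integrable_inner_of_memLp m2 hp.memLp
  have i3 := integrable_inner_of_memLp hd.memLp_deriv hp.memLp
  have i4 := integrable_inner_of_memLp hp.memLp_deriv hδ
  have i5 := integrable_inner_of_memLp m3 m4
  -- The operators with control `u` cancel against their adjoints, leaving the control perturbation
  -- and the linear part of the distributed cost.
  have e2 : (∫ t, ⟪0 - affineOp A₀ A ((u + v : LInfTime T n) t) (w' t)
        - (0 - affineOp A₀ A (u t) (w t)), p t⟫_ℝ ∂(timeMeasure T))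
      + (∫ t, ⟪((affineOp A₀ A (u t))†) (p t) - aQ • (ι†) (ι (w t) - zQ t), w' t - w t⟫_ℝ
        ∂(timeMeasure T))
      = -(∫ t, ⟪∑ i, v t i • A i (w t), p t⟫_ℝ ∂(timeMeasure T))
        - (∫ t, ⟪∑ i, v t i • A i (w' t - w t), p t⟫_ℝ ∂(timeMeasure T))
        - aQ * ∫ t, ⟪ι (w t) - zQ t, ι (w' t - w t)⟫_ℝ ∂(timeMeasure T) := by
    have i12 : Integrable (fun t => -⟪∑ i, v t i • A i (w t), p t⟫_ℝ
        - ⟪∑ i, v t i • A i (w' t - w t), p t⟫_ℝ) (timeMeasure T) := i1.neg.sub i2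
    have i1' : Integrable (fun t => -⟪∑ i, v t i • A i (w t), p t⟫_ℝ) (timeMeasure T) := i1.neg
    rw [← integral_add i3 i4, ← integral_neg, ← integral_const_mul, ← integral_sub i1' i2,
      ← integral_sub i12 (i5.const_mul aQ)]
    refine integral_congr_ae ?_
    filter_upwards [Lp.coeFn_add u v] with t ht
    rw [ht, Pi.add_apply, affineOp_add_apply]
    have q1 : affineOp A₀ A (u t) (w' t) = affineOp A₀ A (u t) (w t)
        + affineOp A₀ A (u t) (w' t - w t) := by rw [map_sub]; abel
    have q2 : ∑ i, v t i • A i (w' t) = ∑ i, v t i • A i (w t)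
        + ∑ i, v t i • A i (w' t - w t) := by
      rw [← Finset.sum_add_distrib]
      refine Finset.sum_congr rfl fun i _ => ?_
      rw [← smul_add, ← map_add, add_sub_cancel]
    rw [q1, q2, inner_sub_left (((affineOp A₀ A (u t))†) (p t)), inner_smul_left,
      ContinuousLinearMap.adjoint_inner_left, ContinuousLinearMap.adjoint_inner_left,
      real_inner_comm (affineOp A₀ A (u t) (w' t - w t)) (p t)]
    simp only [inner_sub_left, inner_add_left, inner_zero_left, conj_trivial]
    ring
  rw [e2] at e1
  have e3 : ∫ t, ‖ι (w' t) - zQ t‖ ^ 2 ∂(timeMeasure T)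
      = (∫ t, ‖ι (w t) - zQ t‖ ^ 2 ∂(timeMeasure T))
        + 2 * (∫ t, ⟪ι (w t) - zQ t, ι (w' t - w t)⟫_ℝ ∂(timeMeasure T))
        + ∫ t, ‖ι (w' t - w t)‖ ^ 2 ∂(timeMeasure T) := by
    have j1 : Integrable (fun t => ‖ι (w t) - zQ t‖ ^ 2 + 2 * ⟪ι (w t) - zQ t, ι (w' t - w t)⟫_ℝ)
        (timeMeasure T) := (integrable_norm_sq m3).add (i5.const_mul 2)
    rw [← integral_const_mul, ← integral_add (integrable_norm_sq m3) (i5.const_mul 2),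
      ← integral_add j1 (integrable_norm_sq m4)]
    refine integral_congr_ae (Eventually.of_forall fun t => ?_)
    simp only
    rw [← norm_add_sq_real, map_sub]
    congr 2
    abel
  have e4 : ‖c' T - zT‖ ^ 2 = ‖c T - zT‖ ^ 2 + 2 * ⟪c' T - c T, c T - zT⟫_ℝ
      + ‖c' T - c T‖ ^ 2 := by
    rw [real_inner_comm, ← norm_add_sq_real]
    congr 2
    abel
  rw [trackingCost, trackingCost, e3, e4]
  linarith

/-- The tracking cost is differentiable with respect to the control, with a quadratic remainder. -/
theorem exists_abs_trackingCost_sub_le (hS : IsParabolicSystem ι T A₀ A) {aQ aT : ℝ} {zQ : ℝ → H}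
    {zT : H} (hz : MemLp zQ 2 (timeMeasure T)) {c r : ℝ → H}
    (hw : IsEvolution ι T h w (fun t => 0 - affineOp A₀ A (u t) (w t)))
    (hc : IsContRepr ι T w c) (hr : IsContRepr ι T p r) (hrT : r T = aT • (c T - zT))
    (hp : IsEvolution ι T (r 0) p (fun t => ((affineOp A₀ A (u t))†) (p t)
      - aQ • (ι†) (ι (w t) - zQ t))) :
    ∃ C, 0 ≤ C ∧ ∀ v : LInfTime T n, ‖v‖ ≤ 1 → ∀ (w' : ℝ → V) (c' : ℝ → H),
      IsEvolution ι T h w' (fun t => 0 - affineOp A₀ A ((u + v : LInfTime T n) t) (w' t)) →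
      IsContRepr ι T w' c' →
      |trackingCost ι T aQ aT zQ zT w' c' - trackingCost ι T aQ aT zQ zT w c
        + ∫ t, ⟪∑ i, v t i • A i (w t), p t⟫_ℝ ∂(timeMeasure T)| ≤ C * ‖v‖ ^ 2 := by
  obtain ⟨K, hK, H1⟩ := hS.exists_norm_sub_state_le hw hc
  set B := ∑ i, ‖A i‖ with hB
  set P := √(∫ t, ‖p t‖ ^ 2 ∂(timeMeasure T)) with hP
  refine ⟨|aQ| / 2 * (‖ι‖ ^ 2 * K) + |aT| / 2 * K + B * (√K * P), by positivity,
    fun v hv w' c' hw' hc' => ?_⟩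
  obtain ⟨k1, k2⟩ := H1 v hv w' c' hw' hc'
  have hδ := (hw'.sub hw).memLp
  have m2 := memLp_sum_smul (A := A) v hδ
  -- The linear term cancels; the three terms left are each bounded by a multiple of ‖v‖², the mixed
  -- one because both the control perturbation and the state difference are of order ‖v‖.
  rw [hS.trackingCost_sub hz hw hc hr hrT hp v hw' hc', sub_add_cancel]
  have b1 : ∫ t, ‖ι (w' t - w t)‖ ^ 2 ∂(timeMeasure T) ≤ ‖ι‖ ^ 2 * (K * ‖v‖ ^ 2) := by
    refine le_trans ?_ (mul_le_mul_of_nonneg_left k2 (sq_nonneg _))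
    rw [← integral_const_mul]
    refine integral_mono (integrable_norm_sq (ι.comp_memLp' hδ))
      ((integrable_norm_sq hδ).const_mul _) fun t => ?_
    simp only
    rw [← mul_pow]
    gcongr
    exact ι.le_opNorm _
  have b2 : |∫ t, ⟪∑ i, v t i • A i (w' t - w t), p t⟫_ℝ ∂(timeMeasure T)|
      ≤ B * (√K * P) * ‖v‖ ^ 2 := by
    calc |∫ t, ⟪∑ i, v t i • A i (w' t - w t), p t⟫_ℝ ∂(timeMeasure T)|
        ≤ ∫ t, |⟪∑ i, v t i • A i (w' t - w t), p t⟫_ℝ| ∂(timeMeasure T) :=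
          abs_integral_le_integral_abs
      _ ≤ ∫ t, ‖v‖ * B * (‖w' t - w t‖ * ‖p t‖) ∂(timeMeasure T) := by
          refine integral_mono_ae (integrable_inner_of_memLp m2 hp.memLp).abs
            ((integrable_norm_mul_norm hδ hp.memLp).const_mul _) ?_
          filter_upwards [ae_norm_le_norm_linfTime v] with t ht
          refine (abs_real_inner_le_norm _ _).trans ?_
          rw [← mul_assoc]
          refine mul_le_mul_of_nonneg_right ?_ (norm_nonneg _)
          refine (norm_sum_smul_le (A := A) (v t) _).trans ?_
          rw [← mul_assoc]
          gcongr
      _ = ‖v‖ * B * ∫ t, ‖w' t - w t‖ * ‖p t‖ ∂(timeMeasure T) := integral_const_mul _ _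
      _ ≤ ‖v‖ * B * (√(K * ‖v‖ ^ 2) * P) := by
          refine mul_le_mul_of_nonneg_left ?_ (by positivity)
          refine (integral_norm_mul_norm_le hδ hp.memLp).trans ?_
          gcongr
      _ = _ := by
          rw [Real.sqrt_mul hK, Real.sqrt_sq (norm_nonneg _)]
          ring
  have b0 : 0 ≤ ∫ t, ‖ι (w' t - w t)‖ ^ 2 ∂(timeMeasure T) := integral_nonneg fun _ => sq_nonneg _
  have c1 : |aQ / 2 * ∫ t, ‖ι (w' t - w t)‖ ^ 2 ∂(timeMeasure T)|
      ≤ |aQ| / 2 * (‖ι‖ ^ 2 * (K * ‖v‖ ^ 2)) := by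
    rw [abs_mul, abs_div, abs_of_nonneg b0, abs_two]
    gcongr
  have c2 : |aT / 2 * ‖c' T - c T‖ ^ 2| ≤ |aT| / 2 * (K * ‖v‖ ^ 2) := by
    rw [abs_mul, abs_div, abs_of_nonneg (sq_nonneg ‖c' T - c T‖), abs_two]
    gcongr
  calc _ ≤ |aQ| / 2 * (‖ι‖ ^ 2 * (K * ‖v‖ ^ 2)) + |aT| / 2 * (K * ‖v‖ ^ 2)
        + B * (√K * P) * ‖v‖ ^ 2 :=
        (abs_sub _ _).trans (add_le_add ((abs_add_le _ _).trans (add_le_add c1 c2)) b2)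
    _ = _ := by ring

end IsParabolicSystem

end System

end FokkerPlanck

namespace FokkerPlanck

/-! ### State and adjoint state of the Fokker-Planck equation -/

/-- The Riesz isometry applied pointwise in time; it turns the V-valued time derivatives of the
abstract theory into elements of L²(0,T;V*). -/
theorem exists_dual_of_memLp {V : Type*} [NormedAddCommGroup V] [InnerProductSpace ℝ V] {T : ℝ}
    {g : ℝ → V} (hg : MemLp g 2 (timeMeasure T)) :
    ∃ G : Lp (StrongDual ℝ V) 2 (timeMeasure T), ∀ᵐ t ∂(timeMeasure T), ∀ v, G t v = ⟪g t, v⟫_ℝ := by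
  have hg' : MemLp (fun t => (innerSL ℝ (g t) : StrongDual ℝ V)) 2 (timeMeasure T) := by
    refine MemLp.of_le hg ((innerSL ℝ (E := V)).continuous.comp_aestronglyMeasurable hg.1)
      (Eventually.of_forall fun t => ?_)
    rw [innerSL_apply_norm]
  refine ⟨hg'.toLp _, ?_⟩
  filter_upwards [hg'.coeFn_toLp] with t ht v
  rw [ht, innerSL_apply_apply]

section Concrete

variable {n : ℕ} {T : ℝ} {Ω : Set (Vec n)}

theorem isContRep_iff {ρ : L2H1 T Ω} {c : ℝ → L2 Ω} :
    IsContRep ρ c ↔ IsContRepr (H1.toL2L Ω) T ρ c :=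
  ⟨fun h => ⟨h.1, h.2⟩, fun h => ⟨h.1, h.2⟩⟩

theorem isContRep_contRep {ρ : L2H1 T Ω} {c : ℝ → L2 Ω} (h : IsContRep ρ c) :
    IsContRep ρ (contRep ρ) :=
  Classical.epsilon_spec (p := IsContRep ρ) ⟨c, h⟩

theorem memW_of_hasWeakDeriv {ρ : L2H1 T Ω} {g : ℝ → H1 Ω} (hg : MemLp g 2 (timeMeasure T))
    (h : HasWeakDeriv (H1.toL2L Ω) T ρ g) : MemW ρ := by
  obtain ⟨G, hG⟩ := exists_dual_of_memLp hg
  refine ⟨G, fun φ ψ hψ => (h φ ψ hψ).trans (congrArg Neg.neg (integral_congr_ae ?_))⟩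
  filter_upwards [hG] with t ht
  exact congrArg (· * ψ t) (ht φ).symm

namespace Data

variable (D : Data n)

theorem isParabolicSystem :
    IsParabolicSystem (H1.toL2L D.Ω) D.T D.opDrift D.opControl where
  pos := D.T_pos
  injective := H1.toL2L_injective D.isOpen_Ω D.isBounded_Ω
  injective_adjoint := H1.toL2L_adjoint_injective D.isOpen_Ω D.isBounded_Ω
  coercive R := by
    have hν := D.ν_pos
    exact ⟨D.ν / 2, D.ν / 2 + D.driftBound R ^ 2 / (2 * D.ν), half_pos hν, by positivity,
      fun u hu ψ => D.op_coercive u hu ψ⟩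

/-- The time derivative of the state, up to the Riesz isomorphism. -/
def stateRhs (u : LInfTime D.T n) (ρ : ℝ → H1 D.Ω) (t : ℝ) : H1 D.Ω :=
  0 - affineOp D.opDrift D.opControl (u t) (ρ t)

/-- The right-hand side of the adjoint equation. -/
def adjointSource (ρ : L2H1 D.T D.Ω) (t : ℝ) : H1 D.Ω :=
  D.αQ • ((H1.toL2L D.Ω)†) (H1.toL2L D.Ω (ρ t) - D.ρQ t)

/-- The time derivative of the adjoint state, up to the Riesz isomorphism. -/
def adjointRhs (ρ : L2H1 D.T D.Ω) (u : LInfTime D.T n) (p : ℝ → H1 D.Ω) (t : ℝ) : H1 D.Ω :=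
  ((affineOp D.opDrift D.opControl (u t))†) (p t) - D.adjointSource ρ t

theorem memLp_adjointSource (ρ : L2H1 D.T D.Ω) :
    MemLp (D.adjointSource ρ) 2 (timeMeasure D.T) := by
  have h1 : MemLp (fun t => H1.toL2L D.Ω (ρ t) - D.ρQ t) 2 (timeMeasure D.T) :=
    ((H1.toL2L D.Ω).comp_memLp' (Lp.memLp ρ)).sub (Lp.memLp D.ρQ)
  exact (((H1.toL2L D.Ω)†).comp_memLp' h1).const_smul D.αQ

theorem memLp_stateRhs (u : LInfTime D.T n) {ρ : ℝ → H1 D.Ω} (hρ : MemLp ρ 2 (timeMeasure D.T)) :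
    MemLp (D.stateRhs u ρ) 2 (timeMeasure D.T) :=
  (MemLp.zero' (ε := H1 D.Ω)).sub (D.isParabolicSystem.memLp_affineOp u hρ)

theorem memLp_adjointRhs (ρ : L2H1 D.T D.Ω) (u : LInfTime D.T n) {p : ℝ → H1 D.Ω}
    (hp : MemLp p 2 (timeMeasure D.T)) : MemLp (D.adjointRhs ρ u p) 2 (timeMeasure D.T) :=
  (D.isParabolicSystem.memLp_affineOp_adjoint u hp).sub (D.memLp_adjointSource ρ)

theorem inner_stateRhs (u : LInfTime D.T n) (ρ : ℝ → H1 D.Ω) (t : ℝ) (φ : H1 D.Ω) :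
    ⟪D.stateRhs u ρ t, φ⟫_ℝ = -D.a (u t) (ρ t) φ := by
  rw [a_eq_inner_op, stateRhs, zero_sub, inner_neg_left]
  rfl

theorem inner_adjointRhs (ρ : L2H1 D.T D.Ω) (u : LInfTime D.T n) (p : ℝ → H1 D.Ω) (t : ℝ)
    (φ : H1 D.Ω) : ⟪D.adjointRhs ρ u p t, φ⟫_ℝ
      = D.a (u t) φ (p t) - D.αQ * ⟪(ρ t).toL2 - D.ρQ t, φ.toL2⟫_ℝ := by
  have h1 : ⟪D.adjointSource ρ t, φ⟫_ℝ = D.αQ * ⟪(ρ t).toL2 - D.ρQ t, φ.toL2⟫_ℝ :=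
    (real_inner_smul_left _ _ _).trans (congrArg (D.αQ * ·)
      (ContinuousLinearMap.adjoint_inner_left (H1.toL2L D.Ω) φ _))
  rw [adjointRhs, inner_sub_left, h1, ContinuousLinearMap.adjoint_inner_left, real_inner_comm,
    a_eq_inner_op]
  rfl

/-- Passage to the abstract problem. The weak equation identifies the time derivative with
`stateRhs`; conversely the continuous representative and membership in W(0,T) follow from the
integrated equation. -/
theorem isWeakSolution_iff (u : LInfTime D.T n) (ρ : L2H1 D.T D.Ω) :
    D.IsWeakSolution u ρ ↔ IsEvolution (H1.toL2L D.Ω) D.T D.ρ₀ ρ (D.stateRhs u ρ) := by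
  have hS := D.isParabolicSystem
  have hρ : MemLp ρ 2 (timeMeasure D.T) := Lp.memLp ρ
  have hg := D.memLp_stateRhs u hρ
  have hint : ∀ φ : H1 D.Ω, ∀ ψ : ℝ → ℝ, ∫ t, ⟪D.stateRhs u ρ t, φ⟫_ℝ * ψ t ∂(timeMeasure D.T)
      = -∫ t in Ioo 0 D.T, D.a (u t) (ρ t) φ * ψ t := by
    intro φ ψ
    rw [← integral_neg]
    refine integral_congr_ae (Eventually.of_forall fun t => ?_)
    simp only
    rw [inner_stateRhs, neg_mul]
  have hweak : HasWeakDeriv (H1.toL2L D.Ω) D.T ρ (D.stateRhs u ρ) ↔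
      ∀ φ : H1 D.Ω, ∀ ψ : ℝ → ℝ, IsTestFunction (Ioo 0 D.T) ψ →
        -(∫ t in Ioo 0 D.T, inner ℝ (ρ t).toL2 φ.toL2 * deriv ψ t)
          + ∫ t in Ioo 0 D.T, D.a (u t) (ρ t) φ * ψ t = 0 := by
    refine forall_congr' fun φ => forall_congr' fun ψ => forall_congr' fun _ => ?_
    rw [hint, neg_neg]
    change (∫ t in Ioo 0 D.T, inner ℝ (ρ t).toL2 φ.toL2 * deriv ψ t) = _ ↔ _
    constructor <;> intro h <;> linarith
  constructor
  · rintro ⟨-, hw, r, hr, hr0⟩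
    have := (hweak.2 hw).isEvolution hS.pos hρ hg (isContRep_iff.1 hr)
    rwa [hr0] at this
  · intro h
    have hw := h.hasWeakDeriv hS.pos
    obtain ⟨c, hc, hc0⟩ := h.exists_isContRepr hS.injective hS.injective_adjoint hS.pos.le
    exact ⟨memW_of_hasWeakDeriv hg hw, hweak.1 hw, c, isContRep_iff.2 hc, hc0⟩

/-- As for the state, except that the value at T is prescribed, and the integrated equation starts
from whatever value `r 0` results. -/
theorem isAdjointState_iff (ρ : L2H1 D.T D.Ω) (u : LInfTime D.T n) (p : L2H1 D.T D.Ω) :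
    D.IsAdjointState ρ u p ↔ ∃ r : ℝ → L2 D.Ω, IsContRepr (H1.toL2L D.Ω) D.T p r ∧
      r D.T = D.αΩ • (contRep ρ D.T - D.ρΩ) ∧
      IsEvolution (H1.toL2L D.Ω) D.T (r 0) p (D.adjointRhs ρ u p) := by
  have hS := D.isParabolicSystem
  have hp : MemLp p 2 (timeMeasure D.T) := Lp.memLp p
  have hg := D.memLp_adjointRhs ρ u hp
  have hint : ∀ φ : H1 D.Ω, ∀ ψ : ℝ → ℝ, IsTestFunction (Ioo 0 D.T) ψ →
      ∫ t, ⟪D.adjointRhs ρ u p t, φ⟫_ℝ * ψ t ∂(timeMeasure D.T)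
      = (∫ t in Ioo 0 D.T, D.a (u t) φ (p t) * ψ t)
        - ∫ t in Ioo 0 D.T, D.αQ * inner ℝ ((ρ t).toL2 - D.ρQ t) φ.toL2 * ψ t := by
    intro φ ψ hψ
    have hψi : ∀ X : ℝ → H1 D.Ω, MemLp X 2 (timeMeasure D.T) →
        Integrable (fun t => ⟪X t, φ⟫_ℝ * ψ t) (timeMeasure D.T) := by
      intro X hX
      have h1 : Integrable (fun t => ⟪X t, φ⟫_ℝ) (timeMeasure D.T) :=
        (integrable_of_memLp_two hX).inner_const φ
      refine (IsTestFunction.integrable_smul h1 hψ.1.continuous hψ.2.1).congr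
        (Eventually.of_forall fun t => ?_)
      exact mul_comm _ _
    have i1 := hψi _ hg
    have i2 := hψi _ (D.memLp_adjointSource ρ)
    have e1 : ∀ t, D.αQ * inner ℝ ((ρ t).toL2 - D.ρQ t) φ.toL2 = ⟪D.adjointSource ρ t, φ⟫_ℝ :=
      fun t => ((real_inner_smul_left _ _ _).trans (congrArg (D.αQ * ·)
        (ContinuousLinearMap.adjoint_inner_left (H1.toL2L D.Ω) φ _))).symm
    have e2 : ∀ t, D.a (u t) φ (p t) * ψ t
        = ⟪D.adjointRhs ρ u p t, φ⟫_ℝ * ψ t + ⟪D.adjointSource ρ t, φ⟫_ℝ * ψ t := by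
      intro t
      rw [inner_adjointRhs, ← e1]
      ring
    simp only [e1, e2]
    rw [integral_add i1 i2, add_sub_cancel_right]
  have hweak : HasWeakDeriv (H1.toL2L D.Ω) D.T p (D.adjointRhs ρ u p) ↔
      ∀ φ : H1 D.Ω, ∀ ψ : ℝ → ℝ, IsTestFunction (Ioo 0 D.T) ψ →
        (∫ t in Ioo 0 D.T, inner ℝ (p t).toL2 φ.toL2 * deriv ψ t)
          + ∫ t in Ioo 0 D.T, D.a (u t) φ (p t) * ψ t
          = ∫ t in Ioo 0 D.T, D.αQ * inner ℝ ((ρ t).toL2 - D.ρQ t) φ.toL2 * ψ t := by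
    refine forall_congr' fun φ => forall_congr' fun ψ => forall_congr' fun hψ => ?_
    rw [hint φ ψ hψ]
    change (∫ t in Ioo 0 D.T, inner ℝ (p t).toL2 φ.toL2 * deriv ψ t) = _ ↔ _
    constructor <;> intro h <;> linarith
  constructor
  · rintro ⟨-, hw, r, hr, hrT⟩
    exact ⟨r, isContRep_iff.1 hr, hrT,
      (hweak.2 hw).isEvolution hS.pos hp hg (isContRep_iff.1 hr)⟩
  · rintro ⟨r, hr, hrT, h⟩
    have hw := h.hasWeakDeriv hS.pos
    exact ⟨memW_of_hasWeakDeriv hg hw, hweak.1 hw, r, isContRep_iff.2 hr, hrT⟩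

theorem existsUnique_isWeakSolution (u : LInfTime D.T n) : ∃! ρ, D.IsWeakSolution u ρ := by
  have hS := D.isParabolicSystem
  obtain ⟨w, hw⟩ := hS.exists_state u D.ρ₀
  have hae := hw.memLp.coeFn_toLp
  refine ⟨hw.memLp.toLp w, (D.isWeakSolution_iff u _).2 (hw.congr hae.symm ?_), fun ρ hρ => ?_⟩
  · filter_upwards [hae] with t ht
    rw [stateRhs, ht]
  · refine Lp.ext (EventuallyEq.trans ?_ hae.symm)
    exact hS.state_ae_eq ((D.isWeakSolution_iff u ρ).1 hρ) hw

theorem existsUnique_isAdjointState (ρ : L2H1 D.T D.Ω) (u : LInfTime D.T n) :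
    ∃! p, D.IsAdjointState ρ u p := by
  have hS := D.isParabolicSystem
  obtain ⟨p, r, hr, hrT, hp⟩ := hS.exists_adjointState u (D.memLp_adjointSource ρ)
    (D.αΩ • (contRep ρ D.T - D.ρΩ))
  have hae := hp.memLp.coeFn_toLp
  refine ⟨hp.memLp.toLp p, (D.isAdjointState_iff ρ u _).2 ⟨r, ⟨hr.1, ?_⟩, hrT,
    hp.congr hae.symm ?_⟩, fun q hq => ?_⟩
  · filter_upwards [hr.ae_eq, hae] with t h1 h2
    rw [h1, h2]
  · filter_upwards [hae] with t ht
    rw [adjointRhs, ht]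
  · obtain ⟨r', hr', hrT', hq'⟩ := (D.isAdjointState_iff ρ u q).1 hq
    refine Lp.ext (EventuallyEq.trans ?_ hae.symm)
    exact hS.adjointState_ae_eq hr' hr (hrT'.trans hrT.symm) hq' hp

theorem isWeakSolution_G (u : LInfTime D.T n) : D.IsWeakSolution u (D.G u) :=
  Classical.epsilon_spec (D.existsUnique_isWeakSolution u).exists

theorem isAdjointState_adjoint (u : LInfTime D.T n) :
    D.IsAdjointState (D.G u) u (D.adjoint u) :=
  Classical.epsilon_spec (D.existsUnique_isAdjointState (D.G u) u).exists

theorem isContRepr_G (u : LInfTime D.T n) :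
    IsContRepr (H1.toL2L D.Ω) D.T (D.G u) (contRep (D.G u)) := by
  obtain ⟨-, -, r, hr, -⟩ := D.isWeakSolution_G u
  exact isContRep_iff.1 (isContRep_contRep hr)

theorem Φ_eq (u : LInfTime D.T n) (i : Fin n) (t : ℝ) :
    D.Φ u i t = -⟪D.opControl i (D.G u t), D.adjoint u t⟫_ℝ + D.γ i * u t i + D.β i := by
  rw [inner_opControl_eq_integral, Φ]

/-- The part of the cost functional that depends on the state. -/
def stateCost (u : LInfTime D.T n) : ℝ :=
  IsParabolicSystem.trackingCost (H1.toL2L D.Ω) D.T D.αQ D.αΩ D.ρQ D.ρΩ (D.G u) (contRep (D.G u))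

/-- The cost of a control. -/
def controlCost (u : LInfTime D.T n) : ℝ :=
  ∑ i, (D.γ i / 2 * (∫ t in Ioo 0 D.T, (u t i) ^ 2) + D.β i * ∫ t in Ioo 0 D.T, u t i)

theorem F_eq (u : LInfTime D.T n) : D.F u = D.stateCost u + D.controlCost u := rfl

theorem exists_abs_stateCost_sub_le (u : LInfTime D.T n) :
    ∃ C, 0 ≤ C ∧ ∀ v : LInfTime D.T n, ‖v‖ ≤ 1 →
      |D.stateCost (u + v) - D.stateCost u
        + ∫ t, ⟪∑ i, v t i • D.opControl i (D.G u t), D.adjoint u t⟫_ℝ ∂(timeMeasure D.T)|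
        ≤ C * ‖v‖ ^ 2 := by
  obtain ⟨r, hr, hrT, hp⟩ := (D.isAdjointState_iff _ u _).1 (D.isAdjointState_adjoint u)
  obtain ⟨C, hC0, hC⟩ := D.isParabolicSystem.exists_abs_trackingCost_sub_le (Lp.memLp D.ρQ)
    ((D.isWeakSolution_iff u _).1 (D.isWeakSolution_G u)) (D.isContRepr_G u) hr hrT hp
  exact ⟨C, hC0, fun v hv => hC v hv _ _
    ((D.isWeakSolution_iff (u + v) _).1 (D.isWeakSolution_G (u + v))) (D.isContRepr_G (u + v))⟩

end Data

end Concrete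

end FokkerPlanck

namespace FokkerPlanck

/-! ### The pairing of integrable functions with controls -/

section Pairing

variable {n : ℕ} {T : ℝ}

theorem ae_abs_apply_le_norm_linfTime (v : LInfTime T n) :
    ∀ᵐ t ∂(timeMeasure T), ∀ i, |v t i| ≤ ‖v‖ := by
  filter_upwards [ae_norm_le_norm_linfTime v] with t ht i
  exact (PiLp.norm_apply_le (v t) i).trans ht

theorem aestronglyMeasurable_apply_linfTime (v : LInfTime T n) (i : Fin n) :
    AEStronglyMeasurable (fun t => v t i) (timeMeasure T) :=
  ((EuclideanSpace.proj i : Vec n →L[ℝ] ℝ).comp_memLp' (Lp.memLp v)).1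

theorem integrable_mul_linfTime {φ : ℝ → ℝ} (hφ : Integrable φ (timeMeasure T))
    (v : LInfTime T n) (i : Fin n) : Integrable (fun t => φ t * v t i) (timeMeasure T) :=
  hφ.mul_bdd (aestronglyMeasurable_apply_linfTime v i)
    ((ae_abs_apply_le_norm_linfTime v).mono fun _ ht => ht i)

theorem integrable_apply_linfTime (v : LInfTime T n) (i : Fin n) :
    Integrable (fun t => v t i) (timeMeasure T) :=
  (integrable_mul_linfTime (integrable_const 1) v i).congr
    (Eventually.of_forall fun _ => one_mul _)

/-- The functional `v ↦ ∑ᵢ ∫₀ᵀ φᵢ vᵢ dt` on `L^∞(0,T;ℝⁿ)`. -/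
def controlPairing (φ : Fin n → ℝ → ℝ) (hφ : ∀ i, Integrable (φ i) (timeMeasure T)) :
    LInfTime T n →L[ℝ] ℝ :=
  LinearMap.mkContinuous
    { toFun := fun v => ∑ i, ∫ t, φ i t * v t i ∂(timeMeasure T)
      map_add' := fun v w => by
        rw [← Finset.sum_add_distrib]
        refine Finset.sum_congr rfl fun i _ => ?_
        rw [← integral_add (integrable_mul_linfTime (hφ i) v i)
          (integrable_mul_linfTime (hφ i) w i)]
        refine integral_congr_ae ?_
        filter_upwards [Lp.coeFn_add v w] with t ht
        rw [ht, Pi.add_apply, PiLp.add_apply, mul_add]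
      map_smul' := fun a v => by
        rw [RingHom.id_apply, smul_eq_mul, Finset.mul_sum]
        refine Finset.sum_congr rfl fun i _ => ?_
        rw [← integral_const_mul]
        refine integral_congr_ae ?_
        filter_upwards [Lp.coeFn_smul a v] with t ht
        rw [ht, Pi.smul_apply, PiLp.smul_apply, smul_eq_mul, mul_left_comm] }
    (∑ i, ∫ t, |φ i t| ∂(timeMeasure T)) fun v => by
      change |∑ i, ∫ t, φ i t * v t i ∂(timeMeasure T)| ≤ _
      refine (Finset.abs_sum_le_sum_abs _ _).trans ?_
      rw [Finset.sum_mul]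
      refine Finset.sum_le_sum fun i _ => ?_
      rw [← integral_mul_const]
      refine norm_integral_le_of_norm_le (f := fun t => φ i t * v t i) ((hφ i).abs.mul_const _) ?_
      filter_upwards [ae_abs_apply_le_norm_linfTime v] with t ht
      rw [norm_mul]
      exact mul_le_mul_of_nonneg_left (ht i) (norm_nonneg _)

theorem controlPairing_apply (φ : Fin n → ℝ → ℝ) (hφ : ∀ i, Integrable (φ i) (timeMeasure T))
    (v : LInfTime T n) :
    controlPairing φ hφ v = ∑ i, ∫ t, φ i t * v t i ∂(timeMeasure T) := rfl

theorem controlPairing_sub_apply (φ : Fin n → ℝ → ℝ)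
    (hφ : ∀ i, Integrable (φ i) (timeMeasure T)) (v w : LInfTime T n) :
    controlPairing φ hφ (v - w) = ∑ i, ∫ t, φ i t * (v t i - w t i) ∂(timeMeasure T) := by
  rw [controlPairing_apply]
  refine Finset.sum_congr rfl fun i _ => integral_congr_ae ?_
  filter_upwards [Lp.coeFn_sub v w] with t ht
  rw [ht, Pi.sub_apply, PiLp.sub_apply]

/-- The controls between `lo` and `hi`. -/
def controlBox (lo hi : LInfTime T n) : Set (LInfTime T n) :=
  {u | ∀ᵐ t ∂(timeMeasure T), ∀ i, lo t i ≤ u t i ∧ u t i ≤ hi t i}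

theorem convex_controlBox (lo hi : LInfTime T n) : Convex ℝ (controlBox lo hi) := by
  intro u hu v hv a b ha hb hab
  filter_upwards [hu, hv, Lp.coeFn_add (a • u) (b • v), Lp.coeFn_smul a u, Lp.coeFn_smul b v]
    with t h1 h2 h3 h4 h5 i
  rw [h3, Pi.add_apply, h4, h5, Pi.smul_apply, Pi.smul_apply, PiLp.add_apply, PiLp.smul_apply,
    PiLp.smul_apply]
  exact convex_Icc (lo t i) (hi t i) (h1 i) (h2 i) ha hb hab

theorem left_mem_controlBox {lo hi u : LInfTime T n} (hu : u ∈ controlBox lo hi) :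
    lo ∈ controlBox lo hi := by
  change ∀ᵐ t ∂(timeMeasure T), ∀ i, lo t i ≤ lo t i ∧ lo t i ≤ hi t i
  filter_upwards [hu] with t ht i
  exact ⟨le_rfl, (ht i).1.trans (ht i).2⟩

theorem right_mem_controlBox {lo hi u : LInfTime T n} (hu : u ∈ controlBox lo hi) :
    hi ∈ controlBox lo hi := by
  change ∀ᵐ t ∂(timeMeasure T), ∀ i, lo t i ≤ hi t i ∧ hi t i ≤ hi t i
  filter_upwards [hu] with t ht i
  exact ⟨(ht i).1.trans (ht i).2, le_rfl⟩

/-- Add to `u` the i-th component of `w - u`, restricted to `E`. These variations localize the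
variational inequality both in time and in the component. -/
theorem exists_replace_component (u w : LInfTime T n) (i : Fin n) {E : Set ℝ}
    (hE : MeasurableSet E) : ∃ z : LInfTime T n, ∀ᵐ t ∂(timeMeasure T), ∀ j,
      z t j - u t j = if j = i then E.indicator (fun t => w t i - u t i) t else 0 := by
  have h1 : MemLp (fun t => ((EuclideanSpace.proj i : Vec n →L[ℝ] ℝ).smulRight
      (EuclideanSpace.single i (1 : ℝ) : Vec n)) ((w - u : LInfTime T n) t)) ⊤ (timeMeasure T) :=
    ContinuousLinearMap.comp_memLp' _ (Lp.memLp _)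
  refine ⟨u + (h1.indicator hE).toLp _, ?_⟩
  filter_upwards [Lp.coeFn_add u ((h1.indicator hE).toLp _), (h1.indicator hE).coeFn_toLp,
    Lp.coeFn_sub w u] with t h2 h3 h4 j
  rw [h2, Pi.add_apply, h3, PiLp.add_apply, add_sub_cancel_left]
  by_cases htE : t ∈ E
  · rw [indicator_of_mem htE, indicator_of_mem htE, h4]
    by_cases hj : j = i
    · subst hj
      simp
    · simp [hj]
  · rw [indicator_of_notMem htE, indicator_of_notMem htE, PiLp.zero_apply, ite_self]

/-- Replacing the i-th component of `u` by that of `w` on `E` stays in the box. The inequality then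
says that the integral over `E` is nonnegative, and `E` is arbitrary. -/
theorem ae_nonneg_mul_sub_of_pairing_nonneg {lo hi u w : LInfTime T n} {φ : Fin n → ℝ → ℝ}
    (hφ : ∀ i, Integrable (φ i) (timeMeasure T)) (hu : u ∈ controlBox lo hi)
    (hw : w ∈ controlBox lo hi)
    (h : ∀ z ∈ controlBox lo hi, 0 ≤ ∑ i, ∫ t, φ i t * (z t i - u t i) ∂(timeMeasure T))
    (i : Fin n) : ∀ᵐ t ∂(timeMeasure T), 0 ≤ φ i t * (w t i - u t i) := by
  have hint : Integrable (fun t => φ i t * (w t i - u t i)) (timeMeasure T) :=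
    ((integrable_mul_linfTime (hφ i) w i).sub (integrable_mul_linfTime (hφ i) u i)).congr
      (Eventually.of_forall fun t => (mul_sub _ _ _).symm)
  refine ae_nonneg_of_forall_setIntegral_nonneg hint fun E hE _ => ?_
  obtain ⟨z, hz⟩ := exists_replace_component u w i hE
  have hzmem : z ∈ controlBox lo hi := by
    filter_upwards [hu, hw, hz] with t h1 h2 h3 j
    have h4 : z t j = u t j + if j = i then E.indicator (fun t => w t i - u t i) t else 0 := by
      rw [← h3 j, add_sub_cancel]
    rw [h4]
    by_cases hj : j = i
    · subst hj
      by_cases htE : t ∈ E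
      · rw [if_pos rfl, indicator_of_mem htE, add_sub_cancel]
        exact h2 j
      · rw [if_pos rfl, indicator_of_notMem htE, add_zero]
        exact h1 j
    · rw [if_neg hj, add_zero]
      exact h1 j
  refine (h z hzmem).trans_eq ?_
  rw [Finset.sum_eq_single i, ← integral_indicator hE]
  · refine integral_congr_ae ?_
    filter_upwards [hz] with t ht
    rw [ht i, if_pos rfl, indicator_mul_right]
  · intro j _ hj
    refine integral_eq_zero_of_ae ?_
    filter_upwards [hz] with t ht
    rw [ht j, if_neg hj, mul_zero]
    rfl
  · exact fun hi => absurd (Finset.mem_univ i) hi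

/-- Compare with the two bounds themselves, which lie in the box because `u` lies between them. The
signs of φ_i(lo_i - u_i) and φ_i(hi_i - u_i) give all three implications. -/
theorem ae_complementarity_of_pairing_nonneg {lo hi u : LInfTime T n} {φ : Fin n → ℝ → ℝ}
    (hφ : ∀ i, Integrable (φ i) (timeMeasure T)) (hu : u ∈ controlBox lo hi)
    (h : ∀ z ∈ controlBox lo hi, 0 ≤ ∑ i, ∫ t, φ i t * (z t i - u t i) ∂(timeMeasure T)) :
    ∀ᵐ t ∂(timeMeasure T), ∀ i, (0 < φ i t → u t i = lo t i) ∧ (φ i t < 0 → u t i = hi t i) ∧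
      (lo t i < u t i ∧ u t i < hi t i → φ i t = 0) := by
  have h1 := ae_all_iff.2
    (ae_nonneg_mul_sub_of_pairing_nonneg hφ hu (left_mem_controlBox hu) h)
  have h2 := ae_all_iff.2
    (ae_nonneg_mul_sub_of_pairing_nonneg hφ hu (right_mem_controlBox hu) h)
  filter_upwards [h1, h2, hu] with t h1 h2 h3 i
  have hlo : 0 < φ i t → u t i = lo t i := fun hp =>
    le_antisymm (sub_nonneg.1 (nonneg_of_mul_nonneg_right (h1 i) hp)) (h3 i).1
  have hhi : φ i t < 0 → u t i = hi t i := fun hp => by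
    refine le_antisymm (h3 i).2 (sub_nonpos.1 (le_of_not_gt fun hpos => ?_))
    exact (mul_neg_of_neg_of_pos hp hpos).not_ge (h2 i)
  refine ⟨hlo, hhi, fun hs => ?_⟩
  rcases lt_trichotomy (φ i t) 0 with hp | hp | hp
  · exact absurd (hhi hp) hs.2.ne
  · exact hp
  · exact absurd (hlo hp) hs.1.ne'

theorem abs_integral_sq_linfTime_le (hT : 0 ≤ T) (v : LInfTime T n) (i : Fin n) :
    |∫ t, v t i ^ 2 ∂(timeMeasure T)| ≤ T * ‖v‖ ^ 2 := by
  refine (norm_integral_le_of_norm_le (f := fun t => v t i ^ 2) (μ := timeMeasure T)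
    (integrable_const (‖v‖ ^ 2)) ?_).trans_eq ?_
  · filter_upwards [ae_abs_apply_le_norm_linfTime v] with t ht
    rw [norm_pow]
    exact pow_le_pow_left₀ (norm_nonneg _) (ht i) 2
  · simp [hT]

end Pairing

theorem inner_sum_smul_left {V : Type*} [NormedAddCommGroup V] [InnerProductSpace ℝ V] {n : ℕ}
    (a : Fin n → ℝ) (x : Fin n → V) (p : V) :
    ⟪∑ i, a i • x i, p⟫_ℝ = ∑ i, ⟪x i, p⟫_ℝ * a i := by
  simp only [sum_inner, real_inner_smul_left, mul_comm]

theorem hasFDerivAt_of_abs_sub_le {E : Type*} [NormedAddCommGroup E] [NormedSpace ℝ E] {f : E → ℝ}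
    {L : E →L[ℝ] ℝ} {x : E} {C : ℝ}
    (h : ∀ v, ‖v‖ ≤ 1 → |f (x + v) - f x - L v| ≤ C * ‖v‖ ^ 2) : HasFDerivAt f L x := by
  rw [hasFDerivAt_iff_isLittleO_nhds_zero]
  refine Asymptotics.IsBigO.trans_isLittleO (g := fun v : E => ‖v‖ ^ 2)
    (Asymptotics.IsBigO.of_bound C ?_) (Asymptotics.isLittleO_norm_pow_id one_lt_two)
  filter_upwards [Metric.closedBall_mem_nhds (0 : E) one_pos] with v hv
  rw [norm_pow, norm_norm]
  exact h v (by simpa using hv)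

/-! ### Derivative of the reduced cost and optimality conditions -/

namespace Data

variable {n : ℕ} (D : Data n)

theorem integrable_inner_opControl (u : LInfTime D.T n) (i : Fin n) :
    Integrable (fun t => ⟪D.opControl i (D.G u t), D.adjoint u t⟫_ℝ) (timeMeasure D.T) :=
  integrable_inner_of_memLp ((D.opControl i).comp_memLp' (Lp.memLp (D.G u)))
    (Lp.memLp (D.adjoint u))

theorem integrable_Φ (u : LInfTime D.T n) (i : Fin n) :
    Integrable (D.Φ u i) (timeMeasure D.T) :=
  (((D.integrable_inner_opControl u i).neg.add
    ((integrable_apply_linfTime u i).const_mul (D.γ i))).add (integrable_const (D.β i))).congr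
    (Eventually.of_forall fun t => (D.Φ_eq u i t).symm)

/-- The derivative of the reduced cost functional. -/
def gradF (u : LInfTime D.T n) : LInfTime D.T n →L[ℝ] ℝ := controlPairing (D.Φ u) (D.integrable_Φ u)

theorem integral_inner_sum_opControl (u v : LInfTime D.T n) :
    ∫ t, ⟪∑ i, v t i • D.opControl i (D.G u t), D.adjoint u t⟫_ℝ ∂(timeMeasure D.T)
      = ∑ i, ∫ t, ⟪D.opControl i (D.G u t), D.adjoint u t⟫_ℝ * v t i ∂(timeMeasure D.T) := by
  rw [← integral_finsetSum _ fun i _ =>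
    integrable_mul_linfTime (D.integrable_inner_opControl u i) v i]
  exact integral_congr_ae (Eventually.of_forall fun t => inner_sum_smul_left _ _ _)

theorem gradF_apply (u v : LInfTime D.T n) :
    D.gradF u v
      = -∫ t, ⟪∑ i, v t i • D.opControl i (D.G u t), D.adjoint u t⟫_ℝ ∂(timeMeasure D.T)
        + ∑ i, (D.γ i * (∫ t, u t i * v t i ∂(timeMeasure D.T))
          + D.β i * ∫ t, v t i ∂(timeMeasure D.T)) := by
  rw [integral_inner_sum_opControl, ← Finset.sum_neg_distrib, ← Finset.sum_add_distrib, gradF,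
    controlPairing_apply]
  refine Finset.sum_congr rfl fun i _ => ?_
  have i1 := integrable_mul_linfTime (D.integrable_inner_opControl u i) v i
  have i2 := (integrable_mul_linfTime (integrable_apply_linfTime u i) v i).const_mul (D.γ i)
  have i3 := (integrable_apply_linfTime v i).const_mul (D.β i)
  rw [← integral_neg, ← integral_const_mul, ← integral_const_mul, ← integral_add i2 i3]
  refine Eq.trans (integral_congr_ae (Eventually.of_forall fun t => ?_))
    (integral_add i1.neg (i2.add i3))
  simp only [Φ_eq]
  ring

/-- The control cost is a quadratic polynomial, so its expansion is exact, with a remainder purely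
quadratic in `v`. -/
theorem controlCost_sub (u v : LInfTime D.T n) :
    D.controlCost (u + v) - D.controlCost u
      = ∑ i, (D.γ i * (∫ t, u t i * v t i ∂(timeMeasure D.T))
          + D.β i * ∫ t, v t i ∂(timeMeasure D.T))
        + ∑ i, D.γ i / 2 * ∫ t, v t i ^ 2 ∂(timeMeasure D.T) := by
  rw [controlCost, controlCost, ← Finset.sum_sub_distrib, ← Finset.sum_add_distrib]
  refine Finset.sum_congr rfl fun i _ => ?_
  have hadd := Lp.coeFn_add u v
  have iu := integrable_apply_linfTime u i
  have iv := integrable_apply_linfTime v i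
  have iuu := integrable_mul_linfTime iu u i
  have iuv := integrable_mul_linfTime iu v i
  have ivv := integrable_mul_linfTime iv v i
  have e1 : ∫ t, (u + v : LInfTime D.T n) t i ∂(timeMeasure D.T)
      = ∫ t, u t i ∂(timeMeasure D.T) + ∫ t, v t i ∂(timeMeasure D.T) := by
    rw [← integral_add iu iv]
    refine integral_congr_ae ?_
    filter_upwards [hadd] with t ht
    rw [ht, Pi.add_apply, PiLp.add_apply]
  have e2 : ∫ t, (u + v : LInfTime D.T n) t i ^ 2 ∂(timeMeasure D.T)
      = ∫ t, u t i ^ 2 ∂(timeMeasure D.T) + (2 * ∫ t, u t i * v t i ∂(timeMeasure D.T)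
        + ∫ t, v t i ^ 2 ∂(timeMeasure D.T)) := by
    simp only [sq]
    rw [← integral_const_mul, ← integral_add (iuv.const_mul 2) ivv]
    refine Eq.trans (integral_congr_ae ?_) (integral_add iuu ((iuv.const_mul 2).add ivv))
    filter_upwards [hadd] with t ht
    rw [ht, Pi.add_apply, PiLp.add_apply]
    ring
  rw [e1, e2]
  ring

theorem hasFDerivAt_F (u : LInfTime D.T n) : HasFDerivAt D.F (D.gradF u) u := by
  obtain ⟨C, -, hC⟩ := D.exists_abs_stateCost_sub_le u
  refine hasFDerivAt_of_abs_sub_le (C := C + ∑ i, D.γ i / 2 * D.T) fun v hv => ?_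
  have hq : |∑ i, D.γ i / 2 * ∫ t, v t i ^ 2 ∂(timeMeasure D.T)|
      ≤ (∑ i, D.γ i / 2 * D.T) * ‖v‖ ^ 2 := by
    refine (Finset.abs_sum_le_sum_abs _ _).trans ?_
    rw [Finset.sum_mul]
    refine Finset.sum_le_sum fun i _ => ?_
    have hγ : 0 ≤ D.γ i / 2 := div_nonneg (D.γ_nonneg i) two_pos.le
    rw [abs_mul, abs_of_nonneg hγ, mul_assoc]
    exact mul_le_mul_of_nonneg_left (abs_integral_sq_linfTime_le D.T_pos.le v i) hγ
  -- The linear terms of the control cost cancel against those in the gradient, so only the tracking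
  -- remainder and the quadratic control term are left to estimate.
  have e : D.F (u + v) - D.F u - D.gradF u v
      = (D.stateCost (u + v) - D.stateCost u
        + ∫ t, ⟪∑ i, v t i • D.opControl i (D.G u t), D.adjoint u t⟫_ℝ ∂(timeMeasure D.T))
        + ∑ i, D.γ i / 2 * ∫ t, v t i ^ 2 ∂(timeMeasure D.T) := by
    have h1 := D.controlCost_sub u v
    have h2 := D.gradF_apply u v
    rw [F_eq, F_eq, h2]
    linear_combination h1
  rw [e, add_mul]
  exact (abs_add_le _ _).trans (add_le_add (hC v hv) hq)

/-- By convexity the segment from `u` to `v` is admissible, so `v - u` is a tangent direction, along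
which the derivative at a local minimum is nonnegative. -/
theorem gradF_sub_nonneg {u : LInfTime D.T n} (hu : D.IsLInfLocalMin u) {v : LInfTime D.T n}
    (hv : v ∈ D.Uad) : 0 ≤ D.gradF u (v - u) := by
  obtain ⟨hmem, ε, hε, hmin⟩ := hu
  have hloc : IsLocalMinOn D.F D.Uad u := by
    filter_upwards [self_mem_nhdsWithin, mem_nhdsWithin_of_mem_nhds (Metric.ball_mem_nhds u hε)]
      with w h1 h2
    exact hmin w ⟨h1, h2⟩
  refine hloc.hasFDerivWithinAt_nonneg (D.hasFDerivAt_F u).hasFDerivWithinAt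
    (sub_mem_posTangentConeAt_of_segment_subset ?_)
  exact (convex_controlBox D.umin D.umax).segment_subset hmem hv

end Data

end FokkerPlanck

end

open FokkerPlanck in
theorem mainTheorem4 {n : ℕ} (D : Data n) :
    -- the state and the adjoint state are well defined, uniquely, in `W(0,T)`
    (∀ u : LInfTime D.T n, (∃! ρ, D.IsWeakSolution u ρ) ∧ (∃! p, D.IsAdjointState (D.G u) u p)) ∧
    -- `F` is Fréchet differentiable on `L^∞(0,T;ℝⁿ)` and `F'(u)v = ∑ᵢ ∫₀ᵀ Φᵢ vᵢ dt`
    (∀ u : LInfTime D.T n,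
      (∀ i, MeasureTheory.IntegrableOn (D.Φ u i) (Set.Ioo 0 D.T)) ∧
      DifferentiableAt ℝ D.F u ∧
      ∀ v : LInfTime D.T n,
        fderiv ℝ D.F u v = ∑ i, ∫ t in Set.Ioo 0 D.T, D.Φ u i t * v t i) ∧
    -- first order necessary conditions at an `L^∞`-local minimum
    (∀ ubar : LInfTime D.T n, D.IsLInfLocalMin ubar →
      (∀ u ∈ D.Uad,
        0 ≤ ∑ i, ∫ t in Set.Ioo 0 D.T, D.Φ ubar i t * (u t i - ubar t i)) ∧
      (∀ᵐ t ∂(timeMeasure D.T), ∀ i,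
        (0 < D.Φ ubar i t → ubar t i = D.umin t i) ∧
        (D.Φ ubar i t < 0 → ubar t i = D.umax t i) ∧
        (D.umin t i < ubar t i ∧ ubar t i < D.umax t i → D.Φ ubar i t = 0))) := by
  have hpair : ∀ ubar : LInfTime D.T n, D.IsLInfLocalMin ubar → ∀ u ∈ D.Uad,
      0 ≤ ∑ i, ∫ t in Set.Ioo 0 D.T, D.Φ ubar i t * (u t i - ubar t i) := by
    intro ubar hubar u hu
    have h := D.gradF_sub_nonneg hubar hu
    rwa [Data.gradF, controlPairing_sub_apply] at h
  refine ⟨fun u => ⟨D.existsUnique_isWeakSolution u, D.existsUnique_isAdjointState (D.G u) u⟩,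
    fun u => ⟨D.integrable_Φ u, (D.hasFDerivAt_F u).differentiableAt, fun v => ?_⟩,
    fun ubar hubar => ⟨hpair ubar hubar, ?_⟩⟩
  · rw [(D.hasFDerivAt_F u).fderiv]
    rfl
  · exact ae_complementarity_of_pairing_nonneg (D.integrable_Φ ubar) hubar.1 (hpair ubar hubar)
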